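/- Let $N\ge 0$, $\tilde L>0$, $\gamma_i>0$, $q_i<0$ $(i=1,\dots,N)$, let $a_1,\dots,a_N\in\mathbb R^3$ be distinct, and put $$\mathcal G(x)=\tilde L^{-1}+\sum_{i=1}^N\frac{\gamma_i}{|x-a_i|},\qquad \mathcal Q(x)=-\tilde L+\sum_{i=1}^N\frac{q_i}{|x-a_i|}\qquad(x\in\mathbb R^3\setminus\{a_1,\dots,a_N\}).$$ Consider the null-class solution of five-dimensional minimal supergravity $$g=-\mathcal G^{-1}(\mathcal Q\,du^2+2\,du\,dv)+\mathcal G^2dx^idx^i,\qquad F=\tfrac{\sqrt3}{2}\star_3 d\mathcal G,$$ where $u$ is the periodic coordinate along the orbits of the axial Killing field $W=\partial_u$. Let $M_4=\mathbb R_v\times(\mathbb R^3\setminus\{a_1,\dots,a_N\})$ be the orbit space of $W$. (1) The Kaluza–Klein reduction along $W$, $$g=e^{\Phi/\sqrt3}g^{(4)}+e^{-2\Phi/\sqrt3}(du+\mathcal A)^2,\quad A=A^{(4)}+\rho\,du,\quad F=dA,\quad F^{(4)}=dA^{(4)}-d\rho\wedge\mathcal A,\quad G^{(4)}=d\mathcal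 A$$ (with $A,A^{(4)}$ local potentials), yields on $M_4$ the smooth fields $$g^{(4)}=-\frac{dv^2}{\sqrt{-\mathcal Q\mathcal G^3}}+\sqrt{-\mathcal Q\mathcal G^3}\,dx^idx^i,\quad \Phi=-\tfrac{\sqrt3}{2}\log\!\left(-\frac{\mathcal Q}{\mathcal G}\right),\quad \rho=0,\quad F^{(4)}=\tfrac{\sqrt3}{2}\star_3d\mathcal G,\quad G^{(4)}=\mathcal Q^{-2}dv\wedge d\mathcal Q ,$$ and any reduction has the same fields, with $\rho$ unique up to an additive constant. (2) These fields solve on $M_4$, for either choice of orientation, the field equations of the action $$\int R^{(4)}\star1-\tfrac12|d\Phi|^2\star1-2e^{2\Phi/\sqrt3}|d\rho|^2\star1-\tfrac12e^{-\sqrt3\Phi}G^{(4)}\wedge\star G^{(4)}-2e^{-\Phi/\sqrt3}F^{(4)}\wedge\star F^{(4)}-\tfrac{8}{\sqrt3}\rho\,dA^{(4)}\wedge dA^{(4)} .$$ (3) They describe an asymptotically flat black hole (for $N\ge1$), smooth on and outside the horizon: $M_4$ with its fields embeds in a time-oriented four-dimensional Lorentzian spacetime $\widehat M$ on which all fields are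 smooth, in such a way that $\partial_v$ is future directed on $M_4$; that $\widehat M$ has an asymptotically flat end, i.e. an end diffeomorphic to $\mathbb R\times(\mathbb R^3\setminus B^3)$ with coordinates $(u^0,u^i)$ in which $\partial_{u^0}$ is a positive constant multiple of $\partial_v$ and, for some $\alpha>0$, $g_{ab}=\eta_{ab}+O(R^{-\alpha})$ with $k$-th derivatives $O(R^{-\alpha-k})$ for $k=1,2$, where $R^2=u^iu^i$; that the domain of outer communication of this end is exactly $M_4$; and that the event horizon is a smooth null hypersurface with exactly $N$ connected components, each homeomorphic to $\mathbb R\times S^2$, the $i$-th being approached from $M_4$ only as $x\to a_i$. -/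

import Mathlib

open Set Filter Topology
open scoped ContDiff

noncomputable section

/-! ## Tensor calculus in a coordinate domain of `ℝⁿ`

Tensor fields are given by their components in the standard coordinates. -/

/-- The partial derivative `∂ₐ f` at `p`. -/
def pd {n : ℕ} (a : Fin n) (f : (Fin n → ℝ) → ℝ) (p : Fin n → ℝ) : ℝ :=
  fderiv ℝ f p (Pi.single a 1)

/-- Covector fields (1-forms), in components. -/
abbrev Cov1 (n : ℕ) := (Fin n → ℝ) → Fin n → ℝ

/-- Covariant 2-tensor fields (metrics, 2-forms), in components. -/
abbrev Cov2 (n : ℕ) := (Fin n → ℝ) → Matrix (Fin n) (Fin n) ℝ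

/-- All components of a 1-form are smooth on `S`. -/
def Cov1.SmoothOn {n : ℕ} (A : Cov1 n) (S : Set (Fin n → ℝ)) : Prop :=
  ∀ a, ContDiffOn ℝ ∞ (fun p => A p a) S

/-- All components of a 2-tensor field are smooth on `S`. -/
def Cov2.SmoothOn {n : ℕ} (w : Cov2 n) (S : Set (Fin n → ℝ)) : Prop :=
  ∀ a b, ContDiffOn ℝ ∞ (fun p => w p a b) S

/-- The 1-form `df`. -/
def gradForm {n : ℕ} (f : (Fin n → ℝ) → ℝ) : Cov1 n := fun p a => pd a f p

/-- The 2-form `dA`, `(dA)_{ab} = ∂ₐ A_b - ∂_b Aₐ`. -/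
def extD1 {n : ℕ} (A : Cov1 n) : Cov2 n := fun p =>
  Matrix.of fun a b => pd a (fun q => A q b) p - pd b (fun q => A q a) p

/-- The 3-form `dω` of a 2-form, `(dω)_{abc} = ∂ₐ ω_{bc} + ∂_b ω_{ca} + ∂_c ω_{ab}`. -/
def extD2 {n : ℕ} (w : Cov2 n) (p : Fin n → ℝ) (a b c : Fin n) : ℝ :=
  pd a (fun q => w q b c) p + pd b (fun q => w q c a) p + pd c (fun q => w q a b) p

/-- `α ∧ β` for covectors. -/
def wedge11 {n : ℕ} (α β : Fin n → ℝ) : Matrix (Fin n) (Fin n) ℝ :=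
  Matrix.of fun a b => α a * β b - α b * β a

/-- `α ∧ ω` for a covector `α` and a 2-form `ω`. -/
def wedge12 {n : ℕ} (α : Fin n → ℝ) (w : Matrix (Fin n) (Fin n) ℝ) (a b c : Fin n) : ℝ :=
  α a * w b c + α b * w c a + α c * w a b

/-- The Jacobian `∂φ^c/∂u^a` of a map. -/
def jac {m n : ℕ} (φ : (Fin m → ℝ) → (Fin n → ℝ)) (u : Fin m → ℝ) (c : Fin n) (a : Fin m) : ℝ :=
  pd a (fun q => φ q c) u

/-- Pull-back of a 1-form. -/
def pullback1 {m n : ℕ} (φ : (Fin m → ℝ) → (Fin n → ℝ)) (A : Cov1 n) : Cov1 m :=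
  fun u a => ∑ c, jac φ u c a * A (φ u) c

/-- Pull-back of a covariant 2-tensor. -/
def pullback2 {m n : ℕ} (φ : (Fin m → ℝ) → (Fin n → ℝ)) (w : Cov2 n) : Cov2 m :=
  fun u => Matrix.of fun a b => ∑ c, ∑ d, jac φ u c a * jac φ u d b * w (φ u) c d

/-- The Levi-Civita symbol: `1`, `-1` or `0` according as `s` is an even, an odd or no permutation. -/
def leviCivita {n : ℕ} (s : Fin n → Fin n) : ℝ :=
  Matrix.det (Matrix.of fun i j : Fin n => if s i = j then (1 : ℝ) else 0)

/-- The metric product `g(X, Y)` at a point. -/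
def gdot {n : ℕ} (m : Matrix (Fin n) (Fin n) ℝ) (X Y : Fin n → ℝ) : ℝ :=
  ∑ a, ∑ b, m a b * X a * Y b

/-- Both indices of a covariant 2-tensor raised with the metric `m`. -/
def raise2 {n : ℕ} (m w : Matrix (Fin n) (Fin n) ℝ) : Matrix (Fin n) (Fin n) ℝ :=
  Matrix.of fun a b => ∑ c, ∑ d, m⁻¹ a c * m⁻¹ b d * w c d

/-- The contraction `w_{ab} z^{ab}`. -/
def contr2 {n : ℕ} (m w z : Matrix (Fin n) (Fin n) ℝ) : ℝ :=
  ∑ a, ∑ b, w a b * raise2 m z a b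

/-- The tensor `w_{ac} w_b{}^c`. -/
def square2 {n : ℕ} (m w : Matrix (Fin n) (Fin n) ℝ) (a b : Fin n) : ℝ :=
  ∑ c, ∑ d, w a c * w b d * m⁻¹ c d

/-- The Christoffel symbol `Γ^a_{bc}` of the Levi-Civita connection. -/
def christoffel {n : ℕ} (g : Cov2 n) (a b c : Fin n) (p : Fin n → ℝ) : ℝ :=
  (1 / 2) * ∑ d, (g p)⁻¹ a d *
    (pd b (fun q => g q d c) p + pd c (fun q => g q d b) p - pd d (fun q => g q b c) p)

/-- The Ricci tensor `R_{bc}` (positive on round spheres). -/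
def ricci {n : ℕ} (g : Cov2 n) (p : Fin n → ℝ) (b c : Fin n) : ℝ :=
  ∑ a, (pd a (christoffel g a b c) p - pd c (christoffel g a b a) p
    + ∑ d, (christoffel g a a d p * christoffel g d b c p
      - christoffel g a c d p * christoffel g d b a p))

/-- The covariant divergence `∇ₐ (w ∇ᵃ h)`. -/
def divGrad {n : ℕ} (g : Cov2 n) (w h : (Fin n → ℝ) → ℝ) (p : Fin n → ℝ) : ℝ :=
  (√|(g p).det|)⁻¹ * ∑ a, pd a (fun q => √|(g q).det| * w q * ∑ b, (g q)⁻¹ a b * pd b h q) p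

/-- Hodge dual of a 2-form in four dimensions, `(⋆w)_{cd} = ½ w^{ab} ε_{abcd}` with
`ε_{0123} = σ √|det g|`; `σ = ±1` is the choice of orientation. -/
def hodge4 (σ : ℝ) (m w : Matrix (Fin 4) (Fin 4) ℝ) : Matrix (Fin 4) (Fin 4) ℝ :=
  Matrix.of fun c d =>
    (1 / 2) * ∑ a, ∑ b, raise2 m w a b * (σ * √|m.det| * leviCivita ![a, b, c, d])

/-- Minkowski metric `diag(-1, 1, 1, 1)`. -/
def minkowski : Matrix (Fin 4) (Fin 4) ℝ := Matrix.diagonal ![-1, 1, 1, 1]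

/-- A symmetric bilinear form of signature `(-,+,+,+)`. -/
def IsLorentzian (m : Matrix (Fin 4) (Fin 4) ℝ) : Prop :=
  m.IsSymm ∧ ∃ E : Matrix (Fin 4) (Fin 4) ℝ, E.det ≠ 0 ∧ E.transpose * m * E = minkowski

/-- Euclidean norm on `ℝ³`. -/
def norm3 (x : Fin 3 → ℝ) : ℝ := √(∑ i, x i ^ 2)

/-- The spatial part of a point of `ℝ × ℝ³`. -/
def spatial (p : Fin 4 → ℝ) : Fin 3 → ℝ := fun i => p i.succ

/-! ## The four-dimensional theory -/

/-- The physical fields of the four-dimensional theory: the metric, the two scalars (dilaton and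
axion) and the two field strengths `F^{(4)}`, `G^{(4)}`. -/
structure Fields4 where
  g : Cov2 4
  Φ : (Fin 4 → ℝ) → ℝ
  ρ : (Fin 4 → ℝ) → ℝ
  F : Cov2 4
  G : Cov2 4

/-- Smoothness of all fields. -/
def Fields4.SmoothOn (X : Fields4) (M : Set (Fin 4 → ℝ)) : Prop :=
  Cov2.SmoothOn X.g M ∧ ContDiffOn ℝ ∞ X.Φ M ∧ ContDiffOn ℝ ∞ X.ρ M ∧
    Cov2.SmoothOn X.F M ∧ Cov2.SmoothOn X.G M

/-- `X` is, on `M`, a smooth solution (with respect to the orientation `σ`) of the field equations of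
`∫ R ⋆1 - ½ |dΦ|² ⋆1 - 2 e^{2Φ/√3} |dρ|² ⋆1 - ½ e^{-√3Φ} G ∧ ⋆G - 2 e^{-Φ/√3} F ∧ ⋆F`
`  - (8/√3) ρ dA ∧ dA`, where `F = dA - dρ ∧ B`, `G = dB` and the metric, `Φ`, `ρ` and the (local)
potentials `A`, `B` are varied. The equations below are the variations with respect to `g`
(trace-reversed), `Φ`, `ρ`, `A`, `B`, in this order. -/
structure IsSolution4 (σ : ℝ) (M : Set (Fin 4 → ℝ)) (X : Fields4) : Prop where
  smooth : X.SmoothOn M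
  lorentzian : ∀ p ∈ M, IsLorentzian (X.g p)
  potentials : ∀ p ∈ M, ∃ U : Set (Fin 4 → ℝ), IsOpen U ∧ p ∈ U ∧ U ⊆ M ∧ ∃ A B : Cov1 4,
    A.SmoothOn U ∧ B.SmoothOn U ∧
      ∀ x ∈ U, X.F x = extD1 A x - wedge11 (gradForm X.ρ x) (B x) ∧ X.G x = extD1 B x
  einstein : ∀ p ∈ M, ∀ a b, ricci X.g p a b =
    (1 / 2) * pd a X.Φ p * pd b X.Φ p
      + 2 * Real.exp (2 * X.Φ p / √3) * (pd a X.ρ p * pd b X.ρ p)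
      + (1 / 2) * Real.exp (-√3 * X.Φ p) *
          (square2 (X.g p) (X.G p) a b - (1 / 4) * X.g p a b * contr2 (X.g p) (X.G p) (X.G p))
      + 2 * Real.exp (-X.Φ p / √3) *
          (square2 (X.g p) (X.F p) a b - (1 / 4) * X.g p a b * contr2 (X.g p) (X.F p) (X.F p))
  dilaton : ∀ p ∈ M, divGrad X.g (fun _ => 1) X.Φ p =
    (4 / √3) * Real.exp (2 * X.Φ p / √3) *
        gdot (X.g p)⁻¹ (gradForm X.ρ p) (gradForm X.ρ p)
      - (√3 / 4) * Real.exp (-√3 * X.Φ p) * contr2 (X.g p) (X.G p) (X.G p)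
      - (1 / √3) * Real.exp (-X.Φ p / √3) * contr2 (X.g p) (X.F p) (X.F p)
  axion : ∀ p ∈ M, divGrad X.g (fun q => Real.exp (2 * X.Φ q / √3)) X.ρ p =
    (1 / 2) * Real.exp (-X.Φ p / √3) * contr2 (X.g p) (X.G p) (X.F p)
      - (1 / √3) * contr2 (X.g p) (X.F p) (hodge4 σ (X.g p) (X.F p))
  maxwellF : ∀ p ∈ M, ∀ a b c,
    extD2 (fun q => Real.exp (-X.Φ q / √3) • hodge4 σ (X.g q) (X.F q)) p a b c =
      -(4 / √3) * wedge12 (gradForm X.ρ p) (X.F p) a b c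
  maxwellG : ∀ p ∈ M, ∀ a b c,
    extD2 (fun q => Real.exp (-√3 * X.Φ q) • hodge4 σ (X.g q) (X.G q)) p a b c =
      -4 * Real.exp (-X.Φ p / √3) *
        wedge12 (gradForm X.ρ p) (hodge4 σ (X.g p) (X.F p)) a b c

/-! ## Kaluza-Klein reduction

Five-dimensional coordinates are `(p, u)` with `p ∈ ℝ⁴` and `u` (the last coordinate) the periodic
coordinate along the orbits of the Killing field `W = ∂_u`. All fields are `u`-independent. -/

/-- The projection onto the orbit space of `W`. -/
def proj54 (P : Fin 5 → ℝ) : Fin 4 → ℝ := fun i => P i.castSucc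

/-- The 1-form `du`. -/
def duForm : Fin 5 → ℝ := Pi.single (Fin.last 4) 1

/-- The five-dimensional fields `(g₅, F₅)` on the bundle over `M` reduce along `W = ∂_u` to `X`:
`g₅ = e^{Φ/√3} g + e^{-2Φ/√3} (du + B)²` and, for local gauge potentials `A₅ = A + ρ du` with
`F₅ = dA₅`, `F = dA - dρ ∧ B`, `G = dB`. -/
def IsKKReduction (M : Set (Fin 4 → ℝ)) (g₅ F₅ : Cov2 5) (X : Fields4) : Prop :=
  X.SmoothOn M ∧ (∀ p ∈ M, IsLorentzian (X.g p)) ∧ ∃ B : Cov1 4, B.SmoothOn M ∧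
    (∀ P, proj54 P ∈ M →
      g₅ P = Real.exp (X.Φ (proj54 P) / √3) • pullback2 proj54 X.g P
        + Real.exp (-2 * X.Φ (proj54 P) / √3) •
          Matrix.vecMulVec (duForm + pullback1 proj54 B P) (duForm + pullback1 proj54 B P)) ∧
    (∀ p ∈ M, X.G p = extD1 B p) ∧
    ∀ p ∈ M, ∃ U : Set (Fin 4 → ℝ), IsOpen U ∧ p ∈ U ∧ U ⊆ M ∧ ∃ A : Cov1 4, A.SmoothOn U ∧
      (∀ P, proj54 P ∈ U →
        F₅ P = extD1 (fun Q => pullback1 proj54 A Q + X.ρ (proj54 Q) • duForm) P) ∧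
      ∀ x ∈ U, X.F x = extD1 A x - wedge11 (gradForm X.ρ x) (B x)

/-! ## Asymptotically flat black holes -/

/-- The region `ℝ × (ℝ³ ∖ B³)`, `B³` the closed ball of radius `R₀`. -/
def exteriorRegion (R₀ : ℝ) : Set (Fin 4 → ℝ) := {u | R₀ < norm3 (spatial u)}

/-- `φ` parametrises an asymptotically flat end of `(M, g)`: it is a diffeomorphism of
`ℝ × (ℝ³ ∖ B³)` onto an open part of `M` that is closed in `M` towards the inside, and in the
coordinates `u` it provides `g_{ab} = η_{ab} + O(R^{-α})` for some `α > 0`, the `k`-th derivatives of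
the components being `O(R^{-α-k})` for `k = 1, 2`. -/
structure IsAFEnd (M : Set (Fin 4 → ℝ)) (g : Cov2 4) (R₀ : ℝ)
    (φ : (Fin 4 → ℝ) → (Fin 4 → ℝ)) : Prop where
  radius_pos : 0 < R₀
  smooth : ContDiffOn ℝ ∞ φ (exteriorRegion R₀)
  injOn : InjOn φ (exteriorRegion R₀)
  immersion : ∀ u ∈ exteriorRegion R₀, (Matrix.of (jac φ u)).det ≠ 0
  mapsTo : MapsTo φ (exteriorRegion R₀) M
  isEnd : ∀ R₁ > R₀, closure (φ '' {u | R₁ ≤ norm3 (spatial u)}) ∩ M ⊆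
    φ '' {u | R₁ ≤ norm3 (spatial u)}
  falloff : ∃ α C R₁ : ℝ, 0 < α ∧ R₀ < R₁ ∧ ∀ u, R₁ ≤ norm3 (spatial u) → ∀ a b,
    |pullback2 φ g u a b - minkowski a b| ≤ C * norm3 (spatial u) ^ (-α) ∧
    (∀ c, |pd c (fun w => pullback2 φ g w a b) u| ≤ C * norm3 (spatial u) ^ (-α - 1)) ∧
    ∀ c d, |pd d (pd c (fun w => pullback2 φ g w a b)) u| ≤ C * norm3 (spatial u) ^ (-α - 2)

/-- A spacetime covered by one chart: a connected open set with a smooth Lorentzian metric `g`,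
time-oriented by the smooth timelike vector field `T`. -/
structure IsSpacetime (M : Set (Fin 4 → ℝ)) (g : Cov2 4) (T : (Fin 4 → ℝ) → (Fin 4 → ℝ)) :
    Prop where
  isOpen : IsOpen M
  connected : IsConnected M
  smooth : g.SmoothOn M
  lorentzian : ∀ p ∈ M, IsLorentzian (g p)
  smooth_time : ContDiffOn ℝ ∞ T M
  timelike : ∀ p ∈ M, gdot (g p) (T p) (T p) < 0

/-- There is a future-directed timelike `C¹` curve in `M` from `p` to `q`. -/
def Chron (M : Set (Fin 4 → ℝ)) (g : Cov2 4) (T : (Fin 4 → ℝ) → (Fin 4 → ℝ))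
    (p q : Fin 4 → ℝ) : Prop :=
  ∃ c : ℝ → (Fin 4 → ℝ), c 0 = p ∧ c 1 = q ∧ ContDiffOn ℝ 1 c (Icc 0 1) ∧
    ∀ t ∈ Icc (0 : ℝ) 1, c t ∈ M ∧
      gdot (g (c t)) (derivWithin c (Icc 0 1) t) (derivWithin c (Icc 0 1) t) < 0 ∧
      gdot (g (c t)) (T (c t)) (derivWithin c (Icc 0 1) t) < 0

/-- The chronological past `I⁻(S)`. -/
def chronPast (M : Set (Fin 4 → ℝ)) (g : Cov2 4) (T : (Fin 4 → ℝ) → (Fin 4 → ℝ))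
    (S : Set (Fin 4 → ℝ)) : Set (Fin 4 → ℝ) := {p | ∃ q ∈ S, Chron M g T p q}

/-- The chronological future `I⁺(S)`. -/
def chronFuture (M : Set (Fin 4 → ℝ)) (g : Cov2 4) (T : (Fin 4 → ℝ) → (Fin 4 → ℝ))
    (S : Set (Fin 4 → ℝ)) : Set (Fin 4 → ℝ) := {p | ∃ q ∈ S, Chron M g T q p}

/-- The domain of outer communication `I⁺(S) ∩ I⁻(S)` of an asymptotic end `S`. -/
def domainOuterComm (M : Set (Fin 4 → ℝ)) (g : Cov2 4) (T : (Fin 4 → ℝ) → (Fin 4 → ℝ))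
    (S : Set (Fin 4 → ℝ)) : Set (Fin 4 → ℝ) := chronFuture M g T S ∩ chronPast M g T S

/-- The (future) event horizon of an asymptotic end `S`: the boundary in `M` of `I⁻(S)`. -/
def eventHorizon (M : Set (Fin 4 → ℝ)) (g : Cov2 4) (T : (Fin 4 → ℝ) → (Fin 4 → ℝ))
    (S : Set (Fin 4 → ℝ)) : Set (Fin 4 → ℝ) := M ∩ frontier (chronPast M g T S)

/-- `X'` are the fields on the spacetime `M'` that correspond to the fields `X` on `M` under the
embedding `j`. -/
def IsFieldEmbedding (M : Set (Fin 4 → ℝ)) (X : Fields4) (M' : Set (Fin 4 → ℝ)) (X' : Fields4)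
    (j : (Fin 4 → ℝ) → (Fin 4 → ℝ)) : Prop :=
  ContDiffOn ℝ ∞ j M ∧ InjOn j M ∧ MapsTo j M M' ∧
    ∀ p ∈ M, (Matrix.of (jac j p)).det ≠ 0 ∧ pullback2 j X'.g p = X.g p ∧
      X'.Φ (j p) = X.Φ p ∧ X'.ρ (j p) = X.ρ p ∧
      pullback2 j X'.F p = X.F p ∧ pullback2 j X'.G p = X.G p

/-- `S` is a smooth null hypersurface of the spacetime `(M, g)`. -/
def IsNullHypersurface (M : Set (Fin 4 → ℝ)) (g : Cov2 4) (S : Set (Fin 4 → ℝ)) : Prop :=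
  S ⊆ M ∧ ∀ h ∈ S, ∃ U : Set (Fin 4 → ℝ), IsOpen U ∧ h ∈ U ∧ U ⊆ M ∧ ∃ s : (Fin 4 → ℝ) → ℝ,
    ContDiffOn ℝ ∞ s U ∧ (∀ p ∈ U, p ∈ S ↔ s p = 0) ∧
    ∀ p ∈ U ∩ S, gradForm s p ≠ 0 ∧ gdot (g p)⁻¹ (gradForm s p) (gradForm s p) = 0

/-- `(M, X)`, `M ⊆ ℝ × ℝ³` with `∂₀` as stationary Killing field, is the domain of outer
communication of an asymptotically flat black hole spacetime that is smooth on and outside the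
horizon, and whose horizon components correspond to the punctures `aᵢ` of `ℝ³`: there are a
spacetime `M'` with fields `X'`, all smooth, and an embedding `j` of `(M, X)` into it such that `M'`
has an asymptotically flat end, along which `∂₀` is the unit time translation up to a constant factor,
the domain of outer communication of this end is exactly `j(M)`, `∂₀` is future directed, the event
horizon is a smooth null hypersurface, and its connected components are sets `Cᵢ`, one for each
puncture, homeomorphic to `ℝ × S²`, such that points of `M` that approach `Cᵢ` have spatial
coordinates that tend to `aᵢ`. -/
def IsAFBlackHole {N : ℕ} (M : Set (Fin 4 → ℝ)) (X : Fields4) (a : Fin N → Fin 3 → ℝ) : Prop :=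
  ∃ (M' : Set (Fin 4 → ℝ)) (X' : Fields4) (T : (Fin 4 → ℝ) → (Fin 4 → ℝ))
    (j φ : (Fin 4 → ℝ) → (Fin 4 → ℝ)) (R₀ : ℝ),
    IsSpacetime M' X'.g T ∧ X'.SmoothOn M' ∧ IsFieldEmbedding M X M' X' j ∧
    (∀ p ∈ M, gdot (X'.g (j p)) (T (j p)) (fun c => jac j p c 0) < 0) ∧
    IsAFEnd M' X'.g R₀ φ ∧
    (∃ k : ℝ, 0 < k ∧ ∀ u ∈ exteriorRegion R₀, ∃ p ∈ M, φ u = j p ∧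
      ∀ c, jac φ u c 0 = k * jac j p c 0) ∧
    domainOuterComm M' X'.g T (φ '' exteriorRegion R₀) = j '' M ∧
    IsNullHypersurface M' X'.g (eventHorizon M' X'.g T (φ '' exteriorRegion R₀)) ∧
    ∃ C : Fin N → Set (Fin 4 → ℝ),
      (⋃ i, C i) = eventHorizon M' X'.g T (φ '' exteriorRegion R₀) ∧
      ∀ i, Nonempty (C i ≃ₜ ℝ × Metric.sphere (0 : EuclideanSpace ℝ (Fin 3)) 1) ∧
        ∀ h ∈ C i,
          connectedComponentIn (eventHorizon M' X'.g T (φ '' exteriorRegion R₀)) h = C i ∧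
          Tendsto spatial (𝓟 M ⊓ comap j (𝓝 h)) (𝓝 (a i))

/-! ## The null class of five-dimensional solutions and their reductions -/

/-- `ℝ³` without the centres. -/
def puncturedSpace {N : ℕ} (a : Fin N → Fin 3 → ℝ) : Set (Fin 3 → ℝ) := {x | ∀ i, x ≠ a i}

/-- The orbit space `ℝ × (ℝ³ ∖ {aᵢ})` of `W`, with coordinates `(v, x)`. -/
def nullRegion {N : ℕ} (a : Fin N → Fin 3 → ℝ) : Set (Fin 4 → ℝ) :=
  {p | spatial p ∈ puncturedSpace a}

/-- The multi-centred harmonic function `c + ∑ᵢ mᵢ / |x - aᵢ|`. -/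
def multiCentre {N : ℕ} (c : ℝ) (m : Fin N → ℝ) (a : Fin N → Fin 3 → ℝ) (x : Fin 3 → ℝ) : ℝ :=
  c + ∑ i, m i / norm3 (x - a i)

/-- `⋆₃ df` on Euclidean `ℝ³`. -/
def star3d (f : (Fin 3 → ℝ) → ℝ) (x : Fin 3 → ℝ) : Matrix (Fin 3) (Fin 3) ℝ :=
  Matrix.of fun i j => ∑ k, leviCivita ![i, j, k] * pd k f x

/-- The metric `-𝒢⁻¹ (𝒬 du² + 2 du dv) + 𝒢² dxⁱdxⁱ` in the coordinates `(v, x¹, x², x³, u)`. -/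
def nullMetric5 (𝒢 𝒬 : (Fin 3 → ℝ) → ℝ) : Cov2 5 := fun P =>
  let x := spatial (proj54 P)
  !![0, 0, 0, 0, -(𝒢 x)⁻¹;
     0, 𝒢 x ^ 2, 0, 0, 0;
     0, 0, 𝒢 x ^ 2, 0, 0;
     0, 0, 0, 𝒢 x ^ 2, 0;
     -(𝒢 x)⁻¹, 0, 0, 0, -((𝒢 x)⁻¹ * 𝒬 x)]

/-- The Maxwell field `(√3/2) ⋆₃ d𝒢` in five dimensions. -/
def nullMaxwell5 (𝒢 : (Fin 3 → ℝ) → ℝ) : Cov2 5 :=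
  pullback2 (fun P => spatial (proj54 P)) (fun x => (√3 / 2) • star3d 𝒢 x)

/-- The four-dimensional fields
`g = -dv²/√(-𝒬𝒢³) + √(-𝒬𝒢³) dxⁱdxⁱ`, `Φ = -(√3/2) log(-𝒬/𝒢)`, `ρ = 0`, `F = (√3/2) ⋆₃ d𝒢`,
`G = 𝒬⁻² dv ∧ d𝒬`. -/
def nullFields4 (𝒢 𝒬 : (Fin 3 → ℝ) → ℝ) : Fields4 where
  g := fun p =>
    let s := √(-(𝒬 (spatial p) * 𝒢 (spatial p) ^ 3))
    Matrix.diagonal ![-s⁻¹, s, s, s]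
  Φ := fun p => -(√3 / 2) * Real.log (-(𝒬 (spatial p) / 𝒢 (spatial p)))
  ρ := fun _ => 0
  F := pullback2 spatial (fun x => (√3 / 2) • star3d 𝒢 x)
  G := fun p => (𝒬 (spatial p) ^ 2)⁻¹ •
    wedge11 (Pi.single 0 1) (gradForm (fun q => 𝒬 (spatial q)) p)

end

/-! Put `A = √(-𝒬)`, `B = √𝒢` and `s = A B³`. Completing the square in `du` writes the
five-dimensional metric in Kaluza-Klein form with gauge potential `𝒬⁻¹ dv` (`nullMetric5_eq`). The
components of `g₅` with two, one and no `u`-index determine successively the dilaton, the gauge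
potential and the metric, and the `u`-components of `F₅` are the gradient of the axion. This gives
uniqueness, with the axion constant because the orbit space is connected (`IsKKReduction.unique`,
`IsKKReduction.axion_const`). Potentials of `⋆₃ d𝒢` are sums of Dirac monopole potentials whose
strings avoid the given point.

For the field equations, the metric is `diag(-s⁻¹, s, s, s)`, whose Ricci tensor contains second
derivatives only through the flat Laplacian of `log s = log A + 3 log B`. As `A²` and `B²` are
harmonic, `Δ log A = -2|∇A|²/A²`, and likewise for `B`; all second derivatives disappear and the
Einstein equation is an algebraic identity (`IsHarmonicRoot.einstein`). `F` is purely magnetic and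
`G` purely electric, so the sources of the axion vanish and `ρ = 0` is consistent; the Maxwell
equations say that a gradient is curl free and that `A²` is harmonic (`nullFields4_isSolution`).

For the horizon, let `r` be the distance to a centre. There `s = S/r²`, where `S²` is a smooth
function of `r` and the direction, also across `r = 0`. The direction enters `S²` only at order
`r²`, so `S² = φ² + r² E` with `φ = c₀ + c₁ r` depending on `r` alone and `E` smooth
(`CentreData.regQ_mul_regG`). With the new time `w = v - c₀/r + c₁ log r` one has `dv = dw - φ r⁻²
dr`, and the metric becomes `(-r² dw² + 2 φ dw dr + E dr²)/S + S dΩ²`, which is smooth and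
Lorentzian through `r = 0` (`CentreData.exteriorFields_g_collar`,
`CentreData.collarMetric_lorentzian`). The matter fields extend as well. To have one global chart,
every centre is replaced by a sphere of radius `δ`, the point at distance `r` being moved to
distance `r + δ` when `r` is small; the extension goes on to distance `δ/2`. The length `δ` is so
small that the constructions at different centres do not interact.

The causal structure follows from two facts. At `r = 0` every future directed timelike vector has
negative `dr`, so no future timelike curve leads out of `r ≤ 0` (`CentreData.ext_of_chron`). In the
exterior, straight segments that avoid the centres lift to timelike curves if enough time `v` is
allowed (`CentreData.exists_chron`), so every exterior point can be joined to the end in both time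
directions. Hence the past of the end is exactly the exterior, and its boundary is the union of the
spheres `r = 0` times the `w`-axis, on which `dr` is null.

At infinity `s` tends to `√(L · L⁻³) = L⁻¹`, with a remainder that is `O(1/R)` together with its
derivatives (`CentreData.exists_decays_conf`); rescaling time by `√L` and space by `1/√L` makes the
metric asymptotically Minkowskian. -/

/-! ## Partial derivatives -/

/-- `f` is differentiable at `p` with partial derivatives `d`. -/
def HasPd {n : ℕ} (f : (Fin n → ℝ) → ℝ) (d : Fin n → ℝ) (p : Fin n → ℝ) : Prop :=
  DifferentiableAt ℝ f p ∧ ∀ a, pd a f p = d a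

section HasPd

variable {n : ℕ} {f h : (Fin n → ℝ) → ℝ} {d e : Fin n → ℝ} {p : Fin n → ℝ}

theorem DifferentiableAt.hasPd (hf : DifferentiableAt ℝ f p) : HasPd f (fun a => pd a f p) p :=
  ⟨hf, fun _ => rfl⟩

theorem HasPd.congr_deriv (hf : HasPd f d p) (hd : ∀ a, d a = e a) : HasPd f e p :=
  ⟨hf.1, fun a => (hf.2 a).trans (hd a)⟩

theorem pd_congr {a : Fin n} (hfh : f =ᶠ[𝓝 p] h) : pd a f p = pd a h p := by
  unfold pd; rw [hfh.fderiv_eq]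

theorem HasPd.congr (hf : HasPd f d p) (hfh : h =ᶠ[𝓝 p] f) : HasPd h d p :=
  ⟨hf.1.congr_of_eventuallyEq hfh, fun a => (pd_congr hfh).trans (hf.2 a)⟩

theorem pd_congr_of_isOpen {a : Fin n} {S : Set (Fin n → ℝ)} (hS : IsOpen S) (hp : p ∈ S)
    (hfh : ∀ x ∈ S, f x = h x) : pd a f p = pd a h p :=
  pd_congr (eventually_of_mem (hS.mem_nhds hp) hfh)

theorem hasPd_const (c : ℝ) : HasPd (fun _ : Fin n → ℝ => c) (fun _ => 0) p :=
  ⟨differentiableAt_const c, fun a => by simp [pd]⟩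

theorem pd_const (a : Fin n) (c : ℝ) : pd a (fun _ : Fin n → ℝ => c) p = 0 :=
  (hasPd_const c).2 a

theorem hasPd_coord (i : Fin n) : HasPd (fun x : Fin n → ℝ => x i) (fun a => if a = i then 1 else 0) p := by
  refine ⟨differentiableAt_apply i p, fun a => ?_⟩
  have : HasFDerivAt (fun x : Fin n → ℝ => x i) (ContinuousLinearMap.proj (R := ℝ) i) p :=
    hasFDerivAt_apply i p
  rw [pd, this.fderiv]
  simp [Pi.single_apply, eq_comm]

theorem pd_coord (a i : Fin n) : pd a (fun x : Fin n → ℝ => x i) p = if a = i then 1 else 0 :=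
  (hasPd_coord i).2 a

theorem HasPd.add (hf : HasPd f d p) (hh : HasPd h e p) :
    HasPd (fun x => f x + h x) (fun a => d a + e a) p := by
  refine ⟨hf.1.add hh.1, fun a => ?_⟩
  beta_reduce; rw [← hf.2, ← hh.2, pd, fderiv_fun_add hf.1 hh.1]; rfl

theorem HasPd.sub (hf : HasPd f d p) (hh : HasPd h e p) :
    HasPd (fun x => f x - h x) (fun a => d a - e a) p := by
  refine ⟨hf.1.sub hh.1, fun a => ?_⟩
  beta_reduce; rw [← hf.2, ← hh.2, pd, fderiv_fun_sub hf.1 hh.1]; rfl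

theorem HasPd.neg (hf : HasPd f d p) : HasPd (fun x => -f x) (fun a => -d a) p :=
  ⟨hf.1.neg, fun a => by beta_reduce; rw [← hf.2, pd, fderiv_fun_neg]; rfl⟩

theorem HasPd.mul (hf : HasPd f d p) (hh : HasPd h e p) :
    HasPd (fun x => f x * h x) (fun a => d a * h p + f p * e a) p := by
  refine ⟨hf.1.mul hh.1, fun a => ?_⟩
  beta_reduce; rw [← hf.2, ← hh.2, pd, fderiv_fun_mul hf.1 hh.1]
  simp [pd]; ring

theorem HasPd.const_mul (c : ℝ) (hf : HasPd f d p) :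
    HasPd (fun x => c * f x) (fun a => c * d a) p :=
  ((hasPd_const c).mul hf).congr_deriv fun a => by ring

theorem HasPd.comp {k : ℝ → ℝ} {k' : ℝ} (hk : HasDerivAt k k' (f p)) (hf : HasPd f d p) :
    HasPd (fun x => k (f x)) (fun a => k' * d a) p := by
  have := hk.comp_hasFDerivAt p hf.1.hasFDerivAt
  refine ⟨this.differentiableAt, fun a => ?_⟩
  beta_reduce; rw [← hf.2, pd]
  erw [this.fderiv]; rfl

theorem HasPd.inv (hf : HasPd f d p) (h0 : f p ≠ 0) :
    HasPd (fun x => (f x)⁻¹) (fun a => -d a / f p ^ 2) p :=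
  (HasPd.comp (hasDerivAt_inv h0) hf).congr_deriv fun a => by ring

theorem HasPd.div (hf : HasPd f d p) (hh : HasPd h e p) (h0 : h p ≠ 0) :
    HasPd (fun x => f x / h x) (fun a => (d a * h p - f p * e a) / h p ^ 2) p := by
  simp only [div_eq_mul_inv (f _)]
  exact (hf.mul (hh.inv h0)).congr_deriv fun a => by field_simp; ring

theorem HasPd.pow (hf : HasPd f d p) (k : ℕ) :
    HasPd (fun x => f x ^ k) (fun a => k * f p ^ (k - 1) * d a) p :=
  HasPd.comp (hasDerivAt_pow k (f p)) hf

theorem HasPd.sqrt (hf : HasPd f d p) (h0 : f p ≠ 0) :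
    HasPd (fun x => √(f x)) (fun a => d a / (2 * √(f p))) p :=
  (HasPd.comp (Real.hasDerivAt_sqrt h0) hf).congr_deriv fun a => by ring

theorem HasPd.log (hf : HasPd f d p) (h0 : f p ≠ 0) :
    HasPd (fun x => Real.log (f x)) (fun a => d a / f p) p :=
  (HasPd.comp (Real.hasDerivAt_log h0) hf).congr_deriv fun a => by ring

theorem HasPd.sum {ι : Type*} (u : Finset ι) {f : ι → (Fin n → ℝ) → ℝ} {d : ι → Fin n → ℝ}
    (hf : ∀ i ∈ u, HasPd (f i) (d i) p) :
    HasPd (fun x => ∑ i ∈ u, f i x) (fun a => ∑ i ∈ u, d i a) p := by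
  classical
  induction u using Finset.induction_on with
  | empty => simpa using hasPd_const (p := p) 0
  | insert i s hi ih =>
    simp only [Finset.sum_insert hi]
    exact (hf i (Finset.mem_insert_self i s)).add (ih fun j hj => hf j (Finset.mem_insert_of_mem hj))

theorem fderiv_apply_eq_sum_pd (X : Fin n → ℝ) : fderiv ℝ f p X = ∑ a, pd a f p * X a := by
  conv_lhs => rw [← Finset.univ_sum_single X]
  rw [map_sum]
  refine Finset.sum_congr rfl fun a _ => ?_
  have : (Pi.single a (X a) : Fin n → ℝ) = X a • Pi.single a 1 := by
    rw [← Pi.single_smul]; simp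
  rw [this, map_smul, pd, smul_eq_mul, mul_comm]

theorem HasPd.comp_map {m : ℕ} {φ : (Fin m → ℝ) → (Fin n → ℝ)} {u : Fin m → ℝ}
    (hf : HasPd f d (φ u)) (hφ : DifferentiableAt ℝ φ u) :
    HasPd (fun x => f (φ x)) (fun a => ∑ c, jac φ u c a * d c) u := by
  have hc := hf.1.hasFDerivAt.comp u hφ.hasFDerivAt
  refine ⟨hc.differentiableAt, fun a => ?_⟩
  rw [pd]
  erw [hc.fderiv]
  rw [ContinuousLinearMap.comp_apply, fderiv_apply_eq_sum_pd]
  refine Finset.sum_congr rfl fun c _ => ?_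
  rw [hf.2, mul_comm, jac, pd]
  congr 1
  have := ((hasFDerivAt_pi'.1 hφ.hasFDerivAt) c).fderiv
  rw [this]; rfl

end HasPd

theorem ContDiffAt.pd {n : ℕ} {f : (Fin n → ℝ) → ℝ} {p : Fin n → ℝ} (a : Fin n)
    (hf : ContDiffAt ℝ ∞ f p) : ContDiffAt ℝ ∞ (fun q => pd a f q) p := by
  unfold _root_.pd
  exact (hf.fderiv_right (m := ∞) (by simp)).clm_apply contDiffAt_const

theorem ContDiffAt.diff {n : ℕ} {f : (Fin n → ℝ) → ℝ} {p : Fin n → ℝ}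
    (hf : ContDiffAt ℝ ∞ f p) : DifferentiableAt ℝ f p := hf.differentiableAt (by simp)

theorem ContDiffOn.pd {n : ℕ} {f : (Fin n → ℝ) → ℝ} {S : Set (Fin n → ℝ)} (a : Fin n)
    (hS : IsOpen S) (hf : ContDiffOn ℝ ∞ f S) : ContDiffOn ℝ ∞ (fun q => pd a f q) S :=
  fun _ hp => ((hf.contDiffAt (hS.mem_nhds hp)).pd a).contDiffWithinAt

theorem pd_comm {n : ℕ} {f : (Fin n → ℝ) → ℝ} {p : Fin n → ℝ} (a b : Fin n)
    (hf : ContDiffAt ℝ ∞ f p) : pd a (pd b f) p = pd b (pd a f) p := by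
  have hs : IsSymmSndFDerivAt ℝ f p := hf.isSymmSndFDerivAt (by simpa using WithTop.coe_le_coe.2 (le_top : (2 : ℕ∞) ≤ ⊤))
  have hd : DifferentiableAt ℝ (fderiv ℝ f) p :=
    (hf.fderiv_right (m := ∞) (by simp)).differentiableAt (by simp)
  have key : ∀ u v : Fin n → ℝ, fderiv ℝ (fun q => fderiv ℝ f q v) p u = fderiv ℝ (fderiv ℝ f) p u v := by
    intro u v
    have := (hd.hasFDerivAt.clm_apply (hasFDerivAt_const v p)).fderiv
    rw [this]; simp
  have := hs (Pi.single a 1) (Pi.single b 1)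
  rw [← key, ← key] at this
  exact this

/-! ## Pull-backs -/

theorem pullback2_eq_mul {m n : ℕ} (φ : (Fin m → ℝ) → (Fin n → ℝ)) (w : Cov2 n) (u : Fin m → ℝ) :
    pullback2 φ w u = (Matrix.of (jac φ u)).transpose * w (φ u) * Matrix.of (jac φ u) := by
  ext a b
  simp only [pullback2, Matrix.of_apply, Matrix.mul_apply, Matrix.transpose_apply, Finset.sum_mul]
  rw [Finset.sum_comm]
  exact Finset.sum_congr rfl fun c _ => Finset.sum_congr rfl fun d _ => by ring

theorem jac_eq_of_hasPd {m n : ℕ} {φ : (Fin m → ℝ) → (Fin n → ℝ)} {u : Fin m → ℝ}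
    {d : Fin n → Fin m → ℝ} (h : ∀ c, HasPd (fun x => φ x c) (d c) u) : jac φ u = d := by
  ext c a; exact (h c).2 a

theorem jac_comp {l m n : ℕ} {ψ : (Fin m → ℝ) → (Fin n → ℝ)} {φ : (Fin l → ℝ) → (Fin m → ℝ)}
    {u : Fin l → ℝ} (hψ : DifferentiableAt ℝ ψ (φ u)) (hφ : DifferentiableAt ℝ φ u) :
    Matrix.of (jac (fun x => ψ (φ x)) u) = Matrix.of (jac ψ (φ u)) * Matrix.of (jac φ u) := by
  ext c a
  have h := ((differentiableAt_pi.1 hψ c).hasPd.comp_map hφ).2 a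
  simp only [Matrix.of_apply, Matrix.mul_apply]
  rw [jac, h]
  exact Finset.sum_congr rfl fun d _ => mul_comm _ _

theorem jac_congr {m n : ℕ} {φ ψ : (Fin m → ℝ) → (Fin n → ℝ)} {u : Fin m → ℝ}
    (h : φ =ᶠ[𝓝 u] ψ) : jac φ u = jac ψ u := by
  ext c a; exact pd_congr (h.mono fun x hx => congrFun hx c)

theorem jac_id {n : ℕ} (u : Fin n → ℝ) : Matrix.of (jac (fun x : Fin n → ℝ => x) u) = 1 := by
  ext c a
  simp [jac, pd_coord, Matrix.one_apply, eq_comm]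

theorem pullback2_comp {l m n : ℕ} {ψ : (Fin m → ℝ) → (Fin n → ℝ)}
    {φ : (Fin l → ℝ) → (Fin m → ℝ)} {u : Fin l → ℝ} (w : Cov2 n)
    (hψ : DifferentiableAt ℝ ψ (φ u)) (hφ : DifferentiableAt ℝ φ u) :
    pullback2 φ (pullback2 ψ w) u = pullback2 (fun x => ψ (φ x)) w u := by
  rw [pullback2_eq_mul, pullback2_eq_mul, pullback2_eq_mul, jac_comp hψ hφ, Matrix.transpose_mul]
  simp only [Matrix.mul_assoc]

theorem pullback2_id_of_eventually {n : ℕ} {φ : (Fin n → ℝ) → (Fin n → ℝ)} {u : Fin n → ℝ}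
    (w : Cov2 n) (h : ∀ᶠ x in 𝓝 u, φ x = x) : pullback2 φ w u = w u := by
  rw [pullback2_eq_mul, jac_congr h, jac_id, h.self_of_nhds]; simp

theorem gdot_eq {n : ℕ} (m : Matrix (Fin n) (Fin n) ℝ) (X Y : Fin n → ℝ) :
    gdot m X Y = X ⬝ᵥ m.mulVec Y := by
  simp only [gdot, dotProduct, Matrix.mulVec, Finset.mul_sum]
  exact Finset.sum_congr rfl fun c _ => Finset.sum_congr rfl fun d _ => by ring

theorem gdot_pullback2 {m n : ℕ} (φ : (Fin m → ℝ) → (Fin n → ℝ)) (w : Cov2 n) (u X Y : Fin m → ℝ) :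
    gdot (pullback2 φ w u) X Y =
      gdot (w (φ u)) ((Matrix.of (jac φ u)).mulVec X) ((Matrix.of (jac φ u)).mulVec Y) := by
  rw [pullback2_eq_mul, gdot_eq, gdot_eq, ← Matrix.mulVec_mulVec, ← Matrix.mulVec_mulVec,
    Matrix.dotProduct_mulVec, Matrix.vecMul_transpose]

theorem pullback2_smoothOn {m n : ℕ} {φ : (Fin m → ℝ) → (Fin n → ℝ)} {w : Cov2 n}
    {S : Set (Fin m → ℝ)} {S' : Set (Fin n → ℝ)} (hS : IsOpen S) (hφ : ContDiffOn ℝ ∞ φ S)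
    (hm : MapsTo φ S S') (hw : w.SmoothOn S') : (pullback2 φ w).SmoothOn S := by
  intro a b
  have hj : ∀ c a, ContDiffOn ℝ ∞ (fun u => jac φ u c a) S := fun c a =>
    (contDiffOn_pi.1 hφ c).pd a hS
  simp only [pullback2, Matrix.of_apply]
  exact ContDiffOn.sum fun c _ => ContDiffOn.sum fun d _ =>
    ((hj c a).mul (hj d b)).mul ((hw c d).comp hφ hm)

theorem IsLorentzian.pullback {m : Matrix (Fin 4) (Fin 4) ℝ} (hm : IsLorentzian m)
    {P : Matrix (Fin 4) (Fin 4) ℝ} (hP : P.det ≠ 0) : IsLorentzian (P.transpose * m * P) := by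
  obtain ⟨hs, E, hE, h⟩ := hm
  refine ⟨?_, P⁻¹ * E, ?_, ?_⟩
  · rw [Matrix.IsSymm, Matrix.transpose_mul, Matrix.transpose_mul, Matrix.transpose_transpose,
      hs.eq, Matrix.mul_assoc]
  · rw [Matrix.det_mul, Matrix.det_nonsing_inv]
    exact mul_ne_zero (by simpa using hP) hE
  · have hu : IsUnit P.det := isUnit_iff_ne_zero.2 hP
    rw [Matrix.transpose_mul, ← h]
    calc _ = E.transpose * ((P * P⁻¹).transpose * m * (P * P⁻¹)) * E := by
          simp only [Matrix.transpose_mul, Matrix.mul_assoc]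
      _ = _ := by rw [Matrix.mul_nonsing_inv _ hu]; simp

/-- Invertibility of the frame is automatic: a singular `E` would force `det minkowski = -1` to
vanish. -/
theorem isLorentzian_of_frame {m E : Matrix (Fin 4) (Fin 4) ℝ} (hm : m.IsSymm)
    (h : E.transpose * m * E = minkowski) : IsLorentzian m := by
  refine ⟨hm, E, fun h0 => ?_, h⟩
  have := congrArg Matrix.det h
  rw [Matrix.det_mul, h0, mul_zero, minkowski, Matrix.det_diagonal] at this
  simp [Fin.prod_univ_four] at this

theorem IsLorentzian.isUnit_det {m : Matrix (Fin 4) (Fin 4) ℝ} (hm : IsLorentzian m) :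
    IsUnit m.det := by
  obtain ⟨-, E, -, h⟩ := hm
  have := congrArg Matrix.det h
  rw [Matrix.det_mul, Matrix.det_mul, minkowski, Matrix.det_diagonal] at this
  rw [isUnit_iff_ne_zero]
  rintro h0
  simp [Fin.prod_univ_four, h0] at this

/-! ## The spatial projection -/

theorem spatial_apply (p : Fin 4 → ℝ) (i : Fin 3) : spatial p i = p i.succ := rfl

theorem contDiff_spatial : ContDiff ℝ ∞ spatial :=
  contDiff_pi.2 fun i => contDiff_apply ℝ ℝ i.succ

theorem continuous_spatial : Continuous spatial := contDiff_spatial.continuous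

theorem jac_spatial (p : Fin 4 → ℝ) (c : Fin 3) (a : Fin 4) :
    jac spatial p c a = if a = c.succ then 1 else 0 := by
  simp only [jac, spatial_apply, pd_coord]

theorem pd_spatial_zero {f : (Fin 3 → ℝ) → ℝ} {p : Fin 4 → ℝ}
    (hf : DifferentiableAt ℝ f (spatial p)) : pd 0 (fun q => f (spatial q)) p = 0 := by
  rw [(hf.hasPd.comp_map (contDiff_spatial.contDiffAt.differentiableAt (by simp))).2 0]
  simp only [jac_spatial, (Fin.succ_ne_zero _).symm, if_false, zero_mul, Finset.sum_const_zero]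

theorem pd_spatial_succ {f : (Fin 3 → ℝ) → ℝ} {p : Fin 4 → ℝ} (i : Fin 3)
    (hf : DifferentiableAt ℝ f (spatial p)) :
    pd i.succ (fun q => f (spatial q)) p = pd i f (spatial p) := by
  rw [(hf.hasPd.comp_map (contDiff_spatial.contDiffAt.differentiableAt (by simp))).2 i.succ]
  simp [jac_spatial]

/-! ## The Euclidean norm -/

theorem norm3_sq (x : Fin 3 → ℝ) : norm3 x ^ 2 = x 0 ^ 2 + x 1 ^ 2 + x 2 ^ 2 := by
  rw [norm3, Real.sq_sqrt (by positivity), Fin.sum_univ_three]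

theorem norm3_nonneg (x : Fin 3 → ℝ) : 0 ≤ norm3 x := Real.sqrt_nonneg _

theorem norm3_eq_norm (x : Fin 3 → ℝ) : norm3 x = ‖(WithLp.toLp 2 x : EuclideanSpace ℝ (Fin 3))‖ := by
  rw [norm3, EuclideanSpace.norm_eq]; simp

theorem norm3_eq_zero {x : Fin 3 → ℝ} : norm3 x = 0 ↔ x = 0 := by
  rw [norm3_eq_norm]; simp

theorem norm3_zero : norm3 0 = 0 := norm3_eq_zero.2 rfl

theorem norm3_pos {x : Fin 3 → ℝ} : 0 < norm3 x ↔ x ≠ 0 := by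
  rw [← not_iff_not, not_lt, not_not, ← norm3_eq_zero]
  exact ⟨fun h => le_antisymm h (norm3_nonneg x), fun h => h.le⟩

theorem norm3_add_le (x y : Fin 3 → ℝ) : norm3 (x + y) ≤ norm3 x + norm3 y := by
  simp only [norm3_eq_norm, WithLp.toLp_add]; exact norm_add_le _ _

theorem norm3_neg (x : Fin 3 → ℝ) : norm3 (-x) = norm3 x := by
  simp only [norm3_eq_norm, WithLp.toLp_neg, norm_neg]

theorem norm3_sub_comm (x y : Fin 3 → ℝ) : norm3 (x - y) = norm3 (y - x) := by
  rw [← norm3_neg, neg_sub]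

theorem norm3_smul (c : ℝ) (x : Fin 3 → ℝ) : norm3 (c • x) = |c| * norm3 x := by
  simp only [norm3_eq_norm, WithLp.toLp_smul, norm_smul, Real.norm_eq_abs]

theorem norm3_sub_le (x y z : Fin 3 → ℝ) : norm3 (x - z) ≤ norm3 (x - y) + norm3 (y - z) := by
  simpa using norm3_add_le (x - y) (y - z)

theorem abs_le_norm3 (x : Fin 3 → ℝ) (i : Fin 3) : |x i| ≤ norm3 x := by
  refine Real.le_sqrt_of_sq_le ?_
  rw [sq_abs]
  exact Finset.single_le_sum (f := fun i => x i ^ 2) (fun i _ => sq_nonneg _) (Finset.mem_univ i)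

theorem continuous_norm3 : Continuous norm3 := by
  unfold norm3; fun_prop

theorem contDiffAt_norm3 {x : Fin 3 → ℝ} (hx : x ≠ 0) : ContDiffAt ℝ ∞ norm3 x := by
  have h : (∑ i, x i ^ 2) ≠ 0 := by
    intro h0; exact hx (norm3_eq_zero.1 (by rw [norm3, h0, Real.sqrt_zero]))
  unfold norm3
  exact ContDiffAt.sqrt (by fun_prop) h

theorem hasPd_norm3 {x : Fin 3 → ℝ} (hx : x ≠ 0) : HasPd norm3 (fun a => x a / norm3 x) x := by
  have h : (∑ i, x i ^ 2) ≠ 0 := by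
    intro h0; exact hx (norm3_eq_zero.1 (by rw [norm3, h0, Real.sqrt_zero]))
  unfold norm3
  refine ((HasPd.sum Finset.univ fun i _ => (hasPd_coord (p := x) i).pow 2).sqrt h).congr_deriv
    fun a => ?_
  have h2 : (∑ i : Fin 3, ((2 : ℕ) : ℝ) * x i ^ (2 - 1) * if a = i then 1 else 0) = 2 * x a := by
    simp
  rw [h2, mul_div_mul_left _ _ two_ne_zero]

theorem sub_map_hasPd (b x : Fin 3 → ℝ) {f : (Fin 3 → ℝ) → ℝ} {d : Fin 3 → ℝ}
    (hf : HasPd f d (x - b)) : HasPd (fun y => f (y - b)) d x := by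
  refine (hf.comp_map (φ := fun y => y - b) (by fun_prop)).congr_deriv fun a => ?_
  have : jac (fun y : Fin 3 → ℝ => y - b) x = fun c a => if a = c then 1 else 0 := by
    apply jac_eq_of_hasPd; intro c
    exact ((hasPd_coord c).sub (hasPd_const (b c))).congr_deriv fun a => by simp
  simp [this]

/-! ## Multi-centred harmonic functions -/

section MultiCentre

variable {N : ℕ} {c : ℝ} {m : Fin N → ℝ} {a : Fin N → Fin 3 → ℝ} {x : Fin 3 → ℝ}

theorem isOpen_puncturedSpace (a : Fin N → Fin 3 → ℝ) : IsOpen (puncturedSpace a) := by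
  have : puncturedSpace a = ⋂ i, {a i}ᶜ := by ext; simp [puncturedSpace]
  rw [this]
  exact isOpen_iInter_of_finite fun i => isOpen_compl_singleton

theorem isOpen_nullRegion (a : Fin N → Fin 3 → ℝ) : IsOpen (nullRegion a) :=
  (isOpen_puncturedSpace a).preimage continuous_spatial

theorem hasPd_inv_norm3 (hx : x ≠ 0) :
    HasPd (fun y => (norm3 y)⁻¹) (fun k => -x k / norm3 x ^ 3) x := by
  have h := (norm3_pos.2 hx).ne'
  exact ((hasPd_norm3 hx).inv h).congr_deriv fun k => by field_simp

theorem hasPd_pd_inv_norm3 (k : Fin 3) (hx : x ≠ 0) :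
    HasPd (fun y => -y k / norm3 y ^ 3)
      (fun l => 3 * x k * x l / norm3 x ^ 5 - (if l = k then 1 else 0) / norm3 x ^ 3) x := by
  have h := (norm3_pos.2 hx).ne'
  refine ((hasPd_coord k).neg.div ((hasPd_norm3 hx).pow 3) (pow_ne_zero 3 h)).congr_deriv
    fun l => ?_
  field_simp
  split_ifs <;> push_cast <;> ring

theorem contDiffAt_inv_norm3_sub {b : Fin 3 → ℝ} (hx : x ≠ b) :
    ContDiffAt ℝ ∞ (fun y => (norm3 (y - b))⁻¹) x := by
  have h : x - b ≠ 0 := sub_ne_zero.2 hx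
  exact ContDiffAt.inv (ContDiffAt.comp (g := norm3) x (contDiffAt_norm3 h) (by fun_prop)) (norm3_pos.2 h).ne'

theorem contDiffAt_multiCentre (hx : x ∈ puncturedSpace a) :
    ContDiffAt ℝ ∞ (multiCentre c m a) x := by
  unfold multiCentre
  simp only [div_eq_mul_inv]
  exact contDiffAt_const.add (ContDiffAt.sum fun i _ =>
    contDiffAt_const.mul (contDiffAt_inv_norm3_sub (hx i)))

theorem contDiffOn_multiCentre : ContDiffOn ℝ ∞ (multiCentre c m a) (puncturedSpace a) :=
  fun _ hx => (contDiffAt_multiCentre hx).contDiffWithinAt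

theorem hasPd_multiCentre (hx : x ∈ puncturedSpace a) :
    HasPd (multiCentre c m a)
      (fun k => ∑ i, m i * (-(x - a i) k / norm3 (x - a i) ^ 3)) x := by
  unfold multiCentre
  simp only [div_eq_mul_inv (m _)]
  refine ((hasPd_const c).add (HasPd.sum Finset.univ fun i _ =>
    (sub_map_hasPd (a i) x (hasPd_inv_norm3 (sub_ne_zero.2 (hx i)))).const_mul (m i))).congr_deriv
    fun k => by simp

theorem hasPd_pd_multiCentre (k : Fin 3) (hx : x ∈ puncturedSpace a) :
    HasPd (pd k (multiCentre c m a))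
      (fun l => ∑ i, m i * (3 * (x - a i) k * (x - a i) l / norm3 (x - a i) ^ 5
        - (if l = k then 1 else 0) / norm3 (x - a i) ^ 3)) x := by
  have h1 : HasPd (fun y => ∑ i, m i * (-(y - a i) k / norm3 (y - a i) ^ 3)) (fun l => ∑ i, m i * (3 * (x - a i) k * (x - a i) l / norm3 (x - a i) ^ 5
        - (if l = k then 1 else 0) / norm3 (x - a i) ^ 3)) x :=
    HasPd.sum Finset.univ fun i _ =>
      (sub_map_hasPd (a i) x (hasPd_pd_inv_norm3 k (sub_ne_zero.2 (hx i)))).const_mul (m i)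
  exact h1.congr (eventually_of_mem ((isOpen_puncturedSpace a).mem_nhds hx)
    fun y hy => (hasPd_multiCentre hy).2 k)

/-- The Hessian of `1/r` is `3 x xᵀ / r⁵ - 1 / r³`, and its trace is `3/r³ - 3/r³`. -/
theorem multiCentre_harmonic (hx : x ∈ puncturedSpace a) :
    ∑ k, pd k (pd k (multiCentre c m a)) x = 0 := by
  simp only [fun k => (hasPd_pd_multiCentre (c := c) (m := m) k hx).2 k]
  rw [Finset.sum_comm]
  refine Finset.sum_eq_zero fun i _ => ?_
  have h := (norm3_pos.2 (sub_ne_zero.2 (hx i))).ne'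
  have h2 := norm3_sq (x - a i)
  rw [Fin.sum_univ_three]
  simp only [if_true]
  field_simp
  linear_combination (-3 * m i) * h2

/-- At a centre the singular term is a division by zero, hence `0`. Positivity therefore holds on
all of `ℝ³`, and the later sign arguments need no restriction to the punctured space. -/
theorem multiCentre_pos (hc : 0 < c) (hm : ∀ i, 0 < m i) (x : Fin 3 → ℝ) :
    0 < multiCentre c m a x :=
  add_pos_of_pos_of_nonneg hc (Finset.sum_nonneg fun i _ => div_nonneg (hm i).le (norm3_nonneg _))

theorem multiCentre_neg (c : ℝ) (m : Fin N → ℝ) (a : Fin N → Fin 3 → ℝ) (x : Fin 3 → ℝ) :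
    multiCentre (-c) (fun i => -m i) a x = -multiCentre c m a x := by
  simp only [multiCentre, neg_div, Finset.sum_neg_distrib, neg_add]

end MultiCentre

/-! ## Exterior derivatives of pull-backs along affine maps -/

/-- The Jacobian is taken to be constant, which covers the spatial projection to which this is
applied; second derivatives of `φ` then never occur. -/
theorem extD1_pullback1 {m n : ℕ} {φ : (Fin m → ℝ) → (Fin n → ℝ)} {A : Cov1 n} {u : Fin m → ℝ}
    {J : Fin n → Fin m → ℝ} (hφ : Differentiable ℝ φ) (hJ : ∀ u, jac φ u = J)
    (hA : ∀ c, DifferentiableAt ℝ (fun q => A q c) (φ u)) :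
    extD1 (pullback1 φ A) u = pullback2 φ (extD1 A) u := by
  have key : ∀ a b, pd a (fun q => pullback1 φ A q b) u
      = ∑ c, ∑ d, J c a * J d b * pd c (fun q => A q d) (φ u) := by
    intro a b
    simp only [pullback1, hJ]
    rw [(HasPd.sum Finset.univ fun c _ => ((hA c).hasPd.comp_map (hφ u)).const_mul (J c b)).2 a]
    simp only [hJ, Finset.mul_sum]
    rw [Finset.sum_comm]
    exact Finset.sum_congr rfl fun c _ => Finset.sum_congr rfl fun d _ => by ring
  ext a b
  simp only [extD1, Matrix.of_apply, key, pullback2, hJ]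
  rw [Finset.sum_comm (f := fun c d => J c b * J d a * _), ← Finset.sum_sub_distrib]
  refine Finset.sum_congr rfl fun c _ => ?_
  rw [← Finset.sum_sub_distrib]
  exact Finset.sum_congr rfl fun d _ => by ring

/-! ## Local potentials of the magnetic field -/

/-- The Dirac monopole potential on `ℝ³` with string in the direction `-ε e₂`. -/
noncomputable def diracPotential (ε : ℝ) : Cov1 3 := fun x =>
  ![-(ε * x 1) / (norm3 x * (norm3 x + ε * x 2)), ε * x 0 / (norm3 x * (norm3 x + ε * x 2)), 0]

/-- The right side is the quotient of the Vandermonde products of `(i, j, k)` and of `(0, 1, 2)`,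
the latter being `2`. -/
theorem leviCivita_three (i j k : Fin 3) : leviCivita ![i, j, k] =
    (((j : ℕ) : ℝ) - (i : ℕ)) * (((k : ℕ) : ℝ) - (i : ℕ)) * (((k : ℕ) : ℝ) - (j : ℕ)) / 2 := by
  fin_cases i <;> fin_cases j <;> fin_cases k <;>
    simp [leviCivita, Matrix.det_fin_three] <;> norm_num

theorem star3d_eq (f : (Fin 3 → ℝ) → ℝ) (x : Fin 3 → ℝ) :
    star3d f x = !![0, pd 2 f x, -pd 1 f x; -pd 2 f x, 0, pd 0 f x; pd 1 f x, -pd 0 f x, 0] := by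
  ext i j
  simp only [star3d, Matrix.of_apply, Fin.sum_univ_three, leviCivita_three]
  fin_cases i <;> fin_cases j <;> norm_num

theorem contDiffAt_diracPotential {ε : ℝ} {x : Fin 3 → ℝ} (hx : x ≠ 0)
    (hs : norm3 x + ε * x 2 ≠ 0) (c : Fin 3) :
    ContDiffAt ℝ ∞ (fun y => diracPotential ε y c) x := by
  have hn := contDiffAt_norm3 hx
  have h0 := (norm3_pos.2 hx).ne'
  have hd : ContDiffAt ℝ ∞ (fun y : Fin 3 → ℝ => norm3 y * (norm3 y + ε * y 2)) x :=
    hn.mul (hn.add (by fun_prop))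
  fin_cases c
  · exact ContDiffAt.div (by fun_prop) hd (mul_ne_zero h0 hs)
  · exact ContDiffAt.div (by fun_prop) hd (mul_ne_zero h0 hs)
  · exact contDiffAt_const

/-- After clearing denominators every component is an identity or a multiple of `|x|² = x₀² + x₁² +
x₂²`, once `ε² = 1` is used. The minus sign is compensated by the coefficient of the superposition
in `exists_potential`. -/
theorem extD1_diracPotential {ε : ℝ} (hε : ε = 1 ∨ ε = -1) {x : Fin 3 → ℝ} (hx : x ≠ 0)
    (hs : norm3 x + ε * x 2 ≠ 0) :
    extD1 (diracPotential ε) x = -star3d (fun y => (norm3 y)⁻¹) x := by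
  have h0 := (norm3_pos.2 hx).ne'
  have h2 := norm3_sq x
  have hn := hasPd_norm3 hx
  have hd := hn.mul (hn.add ((hasPd_coord 2).const_mul ε))
  have e0 : HasPd (fun y => diracPotential ε y 0) _ x :=
    ((hasPd_coord 1).const_mul ε).neg.div hd (mul_ne_zero h0 hs)
  have e1 : HasPd (fun y => diracPotential ε y 1) _ x :=
    ((hasPd_coord 0).const_mul ε).div hd (mul_ne_zero h0 hs)
  have e2 : HasPd (fun y => diracPotential ε y 2) _ x := hasPd_const 0
  have hi := hasPd_inv_norm3 hx
  rw [star3d_eq]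
  ext i j
  set r := norm3 x
  simp only [extD1, Matrix.of_apply, hi.2]
  fin_cases i <;> fin_cases j <;>
    simp only [Fin.zero_eta, Fin.mk_one, Fin.reduceFinMk, e0.2, e1.2, e2.2, Matrix.neg_apply] <;>
    simp <;> field_simp <;> rcases hε with rfl | rfl <;>
    first
    | ring1
    | linear_combination (2 * r + x 2) * h2
    | linear_combination (-(2 * r + x 2)) * h2
    | linear_combination (2 * r - x 2) * h2
    | linear_combination (-(2 * r - x 2)) * h2

/-- The potential is singular where `|x| + ε x₂ = 0`, a half-axis; taking `ε` to be the sign of `x₂`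
keeps the point off it. -/
theorem exists_string {x : Fin 3 → ℝ} (hx : x ≠ 0) :
    ∃ ε : ℝ, (ε = 1 ∨ ε = -1) ∧ 0 < norm3 x + ε * x 2 := by
  have h0 := norm3_pos.2 hx
  rcases le_or_gt 0 (x 2) with h | h
  · exact ⟨1, Or.inl rfl, by linarith⟩
  · exact ⟨-1, Or.inr rfl, by linarith⟩

/-- The magnetic field `⋆₃ df` of a multi-centred harmonic function has local potentials. -/
theorem exists_potential {N : ℕ} (c κ : ℝ) (m : Fin N → ℝ) (a : Fin N → Fin 3 → ℝ)
    {p : Fin 4 → ℝ} (hp : p ∈ nullRegion a) :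
    ∃ U : Set (Fin 4 → ℝ), IsOpen U ∧ p ∈ U ∧ U ⊆ nullRegion a ∧ ∃ A : Cov1 4, A.SmoothOn U ∧
      ∀ x ∈ U, pullback2 spatial (fun y => κ • star3d (multiCentre c m a) y) x = extD1 A x := by
  choose ε hε hs using fun i => exists_string (sub_ne_zero.2 (hp i))
  -- An open neighbourhood that misses all centres and all the strings chosen above.
  set V : Set (Fin 3 → ℝ) := puncturedSpace a ∩
    ⋂ i, {y | 0 < norm3 (y - a i) + ε i * (y - a i) 2} with hV
  have hVo : IsOpen V := (isOpen_puncturedSpace a).inter <| isOpen_iInter_of_finite fun i =>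
    isOpen_lt continuous_const ((continuous_norm3.comp (continuous_id.sub continuous_const)).add
      (by fun_prop))
  -- Superposition of one monopole per centre; the constant `c` has no gradient and contributes
  -- nothing.
  set A₃ : Cov1 3 := fun y k => ∑ i, -(κ * m i) * diracPotential (ε i) (y - a i) k with hA
  have hsm : ∀ y ∈ V, ∀ i k, ContDiffAt ℝ ∞ (fun y => diracPotential (ε i) (y - a i) k) y :=
    fun y hy i k => ContDiffAt.comp (g := fun y => diracPotential (ε i) y k) y
      (contDiffAt_diracPotential (sub_ne_zero.2 (hy.1 i)) (mem_iInter.1 hy.2 i).ne' k) (by fun_prop)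
  have hA₃ : ∀ y ∈ V, ∀ k, ContDiffAt ℝ ∞ (fun y => A₃ y k) y := fun y hy k =>
    ContDiffAt.sum fun i _ => contDiffAt_const.mul (hsm y hy i k)
  have hd : ∀ y ∈ V, κ • star3d (multiCentre c m a) y = extD1 A₃ y := by
    intro y hy
    have h1 : ∀ j k, pd j (fun y => A₃ y k) y
        = ∑ i, -(κ * m i) * pd j (fun y => diracPotential (ε i) y k) (y - a i) := fun j k =>
      (HasPd.sum Finset.univ fun i _ => (sub_map_hasPd (a i) y (contDiffAt_diracPotential
        (sub_ne_zero.2 (hy.1 i)) (mem_iInter.1 hy.2 i).ne' k).diff.hasPd).const_mul _).2 j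
    have h2 : ∀ i j k, pd j (fun y => diracPotential (ε i) y k) (y - a i)
        - pd k (fun y => diracPotential (ε i) y j) (y - a i)
        = -star3d (fun y => (norm3 y)⁻¹) (y - a i) j k := fun i j k => by
      have := congrFun (congrFun (extD1_diracPotential (hε i) (sub_ne_zero.2 (hy.1 i))
        (mem_iInter.1 hy.2 i).ne') j) k
      simpa [extD1] using this
    ext j k
    simp only [extD1, Matrix.of_apply, h1, ← Finset.sum_sub_distrib, ← mul_sub, h2]
    simp only [star3d, Matrix.smul_apply, Matrix.of_apply, smul_eq_mul,
      (hasPd_multiCentre hy.1).2, fun i l => (hasPd_inv_norm3 (sub_ne_zero.2 (hy.1 i))).2 l,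
      Fin.sum_univ_three, mul_neg, neg_mul, neg_neg, Finset.mul_sum, ← Finset.sum_add_distrib]
    exact Finset.sum_congr rfl fun i _ => by ring
  have hjac : ∀ u : Fin 4 → ℝ, jac spatial u = fun c a => if a = c.succ then 1 else 0 :=
    fun u => by ext c a; exact jac_spatial u c a
  have hsd : Differentiable ℝ spatial := contDiff_spatial.differentiable (by simp)
  refine ⟨spatial ⁻¹' V, hVo.preimage continuous_spatial, ⟨hp, mem_iInter.2 hs⟩, fun y hy => hy.1,
    pullback1 spatial A₃, fun k => ?_, fun y hy => ?_⟩
  · simp only [pullback1, hjac]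
    exact ContDiffOn.sum fun i _ => contDiffOn_const.mul fun y hy =>
      ((hA₃ _ hy i).comp y contDiff_spatial.contDiffAt).contDiffWithinAt
  · rw [extD1_pullback1 hsd hjac fun k => (hA₃ _ hy k).diff, pullback2_eq_mul, pullback2_eq_mul,
      hd _ hy]

/-! ## Kaluza-Klein reduction -/

theorem jac_proj54 (P : Fin 5 → ℝ) (c : Fin 4) (a : Fin 5) :
    jac proj54 P c a = if a = c.castSucc then 1 else 0 := by
  simp only [jac, proj54, pd_coord]

theorem contDiff_proj54 : ContDiff ℝ ∞ proj54 :=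
  contDiff_pi.2 fun i => contDiff_apply ℝ ℝ i.castSucc

theorem pullback1_proj54_castSucc (A : Cov1 4) (P : Fin 5 → ℝ) (i : Fin 4) :
    pullback1 proj54 A P i.castSucc = A (proj54 P) i := by
  simp [pullback1, jac_proj54]

theorem pullback1_proj54_last (A : Cov1 4) (P : Fin 5 → ℝ) :
    pullback1 proj54 A P (Fin.last 4) = 0 := by
  simp [pullback1, jac_proj54, (Fin.castSucc_ne_last _).symm, -Fin.reduceLast]

theorem pullback2_proj54_castSucc (w : Cov2 4) (P : Fin 5 → ℝ) (i j : Fin 4) :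
    pullback2 proj54 w P i.castSucc j.castSucc = w (proj54 P) i j := by
  simp [pullback2, jac_proj54]

theorem pullback2_proj54_last_left (w : Cov2 4) (P : Fin 5 → ℝ) (b : Fin 5) :
    pullback2 proj54 w P (Fin.last 4) b = 0 := by
  simp [pullback2, jac_proj54, (Fin.castSucc_ne_last _).symm, -Fin.reduceLast]

theorem pullback2_proj54_last_right (w : Cov2 4) (P : Fin 5 → ℝ) (a : Fin 5) :
    pullback2 proj54 w P a (Fin.last 4) = 0 := by
  simp [pullback2, jac_proj54, (Fin.castSucc_ne_last _).symm, -Fin.reduceLast]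

theorem duForm_castSucc (i : Fin 4) : duForm i.castSucc = 0 := by
  simp [duForm, Fin.castSucc_ne_last, -Fin.reduceLast]

theorem duForm_last : duForm (Fin.last 4) = 1 := by simp [duForm]

theorem pd_proj54_castSucc {f : (Fin 4 → ℝ) → ℝ} {P : Fin 5 → ℝ} (i : Fin 4)
    (hf : DifferentiableAt ℝ f (proj54 P)) :
    pd i.castSucc (fun Q => f (proj54 Q)) P = pd i f (proj54 P) := by
  rw [(hf.hasPd.comp_map (contDiff_proj54.contDiffAt.differentiableAt (by simp))).2]
  simp [jac_proj54]

theorem pd_proj54_last {f : (Fin 4 → ℝ) → ℝ} {P : Fin 5 → ℝ}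
    (hf : DifferentiableAt ℝ f (proj54 P)) :
    pd (Fin.last 4) (fun Q => f (proj54 Q)) P = 0 := by
  rw [(hf.hasPd.comp_map (contDiff_proj54.contDiffAt.differentiableAt (by simp))).2]
  simp [jac_proj54, (Fin.castSucc_ne_last _).symm, -Fin.reduceLast]

section Potential

variable {A : Cov1 4} {ρ : (Fin 4 → ℝ) → ℝ} {P : Fin 5 → ℝ}

theorem extD1_potential_castSucc (hA : ∀ c, DifferentiableAt ℝ (fun q => A q c) (proj54 P))
    (i j : Fin 4) :
    extD1 (fun Q => pullback1 proj54 A Q + ρ (proj54 Q) • duForm) P i.castSucc j.castSucc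
      = extD1 A (proj54 P) i j := by
  simp only [extD1, Matrix.of_apply, Pi.add_apply, Pi.smul_apply, duForm_castSucc, smul_zero,
    add_zero, pullback1_proj54_castSucc]
  rw [pd_proj54_castSucc i (hA j), pd_proj54_castSucc j (hA i)]

theorem extD1_potential_last (hA : ∀ c, DifferentiableAt ℝ (fun q => A q c) (proj54 P))
    (hρ : DifferentiableAt ℝ ρ (proj54 P)) (i : Fin 4) :
    extD1 (fun Q => pullback1 proj54 A Q + ρ (proj54 Q) • duForm) P i.castSucc (Fin.last 4)
      = pd i ρ (proj54 P) := by
  simp only [extD1, Matrix.of_apply, Pi.add_apply, Pi.smul_apply, duForm_castSucc, smul_eq_mul,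
    mul_zero, add_zero, pullback1_proj54_castSucc, pullback1_proj54_last, duForm_last, mul_one,
    zero_add]
  rw [pd_proj54_castSucc i hρ, pd_proj54_last (hA i), sub_zero]

end Potential

theorem exists_proj54_eq (p : Fin 4 → ℝ) : ∃ P, proj54 P = p :=
  ⟨Fin.snoc p 0, funext fun i => by simp [proj54]⟩

/-- The fields of a Kaluza-Klein reduction are determined by the five-dimensional fields, up to the
gauge freedom of the axion. -/
theorem IsKKReduction.unique {M : Set (Fin 4 → ℝ)} (hM : IsOpen M) {g₅ F₅ : Cov2 5}
    {X Y : Fields4} (hX : IsKKReduction M g₅ F₅ X) (hY : IsKKReduction M g₅ F₅ Y)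
    {p : Fin 4 → ℝ} (hp : p ∈ M) :
    Y.g p = X.g p ∧ Y.Φ p = X.Φ p ∧ Y.F p = X.F p ∧ Y.G p = X.G p ∧
      ∀ a, pd a Y.ρ p = pd a X.ρ p := by
  obtain ⟨hXs, -, BX, hBX, hgX, hGX, hFX⟩ := hX
  obtain ⟨hYs, -, BY, hBY, hgY, hGY, hFY⟩ := hY
  have metric : ∀ p ∈ M, Y.Φ p = X.Φ p ∧ (∀ i, BY p i = BX p i) ∧ Y.g p = X.g p := by
    intro p hp
    obtain ⟨P, rfl⟩ := exists_proj54_eq p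
    have h := (hgY P hp).symm.trans (hgX P hp)
    -- The `uu`-component is `e^{-2Φ/√3}` alone. Given `Φ`, the mixed components `iu` yield the
    -- gauge potential, and then the components `ij` yield the metric.
    have hΦ : Y.Φ (proj54 P) = X.Φ (proj54 P) := by
      have := congrFun (congrFun h (Fin.last 4)) (Fin.last 4)
      simp only [Matrix.add_apply, Matrix.smul_apply, pullback2_proj54_last_left, smul_eq_mul,
        mul_zero, zero_add, Matrix.vecMulVec_apply, Pi.add_apply, duForm_last,
        pullback1_proj54_last, add_zero, mul_one] at this
      have := Real.exp_injective this
      have h3 : √(3 : ℝ) ≠ 0 := by positivity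
      field_simp at this
      linarith
    have hB : ∀ i, BY (proj54 P) i = BX (proj54 P) i := by
      intro i
      have := congrFun (congrFun h i.castSucc) (Fin.last 4)
      simp only [Matrix.add_apply, Matrix.smul_apply, pullback2_proj54_last_right, smul_eq_mul,
        mul_zero, zero_add, Matrix.vecMulVec_apply, Pi.add_apply, duForm_last,
        duForm_castSucc, pullback1_proj54_castSucc,
        pullback1_proj54_last, add_zero, mul_one, hΦ] at this
      exact mul_left_cancel₀ (Real.exp_ne_zero _) this
    refine ⟨hΦ, hB, ?_⟩
    ext i j
    have := congrFun (congrFun h i.castSucc) j.castSucc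
    simp only [Matrix.add_apply, Matrix.smul_apply, pullback2_proj54_castSucc, smul_eq_mul,
      zero_add, Matrix.vecMulVec_apply, Pi.add_apply,
      duForm_castSucc, pullback1_proj54_castSucc, hΦ, hB] at this
    exact mul_left_cancel₀ (Real.exp_ne_zero _) (add_right_cancel this)
  have hG : Y.G p = X.G p := by
    rw [hGX p hp, hGY p hp]
    ext a b
    simp only [extD1, Matrix.of_apply]
    rw [pd_congr_of_isOpen hM hp fun x hx => (metric x hx).2.1 b,
      pd_congr_of_isOpen hM hp fun x hx => (metric x hx).2.1 a]
  obtain ⟨U, hU, hpU, hUM, A, hA, hAF, hF⟩ := hFX p hp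
  obtain ⟨U', hU', hpU', hUM', A', hA', hAF', hF'⟩ := hFY p hp
  have dX : DifferentiableAt ℝ X.ρ p := (hXs.2.2.1.contDiffAt (hM.mem_nhds hp)).diff
  have dY : DifferentiableAt ℝ Y.ρ p := (hYs.2.2.1.contDiffAt (hM.mem_nhds hp)).diff
  have dA : ∀ c, DifferentiableAt ℝ (fun q => A q c) p := fun c =>
    ((hA c).contDiffAt (hU.mem_nhds hpU)).diff
  have dA' : ∀ c, DifferentiableAt ℝ (fun q => A' q c) p := fun c =>
    ((hA' c).contDiffAt (hU'.mem_nhds hpU')).diff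
  obtain ⟨P, rfl⟩ := exists_proj54_eq p
  -- The `u`-components of `F₅` are the gradient of the axion. The potentials themselves may differ
  -- by a gauge transformation, so only field strengths are compared.
  have hρ : ∀ a, pd a Y.ρ (proj54 P) = pd a X.ρ (proj54 P) := fun a => by
    rw [← extD1_potential_last dA' dY a, ← extD1_potential_last dA dX a, ← hAF P hpU, hAF' P hpU']
  refine ⟨(metric _ hp).2.2, (metric _ hp).1, ?_, hG, hρ⟩
  rw [hF _ hpU, hF' _ hpU']
  ext i j
  have e : extD1 A' (proj54 P) i j = extD1 A (proj54 P) i j := by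
    rw [← extD1_potential_castSucc (ρ := Y.ρ) dA' i j, ← extD1_potential_castSucc (ρ := X.ρ) dA i j,
      ← hAF P hpU, hAF' P hpU']
  simp only [Matrix.sub_apply, wedge11, Matrix.of_apply, gradForm, hρ, (metric _ hp).2.1, e]

theorem isConnected_puncturedSpace {N : ℕ} (a : Fin N → Fin 3 → ℝ) :
    IsConnected (puncturedSpace a) := by
  have : puncturedSpace a = (range a)ᶜ := by
    ext x; simp [puncturedSpace, eq_comm]
  rw [this]
  refine (Set.Countable.isPathConnected_compl_of_one_lt_rank ?_ (countable_range a)).isConnected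
  rw [rank_fin_fun]
  norm_num

theorem isConnected_preimage_spatial {S : Set (Fin 3 → ℝ)} (hS : IsConnected S) :
    IsConnected (spatial ⁻¹' S) := by
  have : spatial ⁻¹' S = (fun q : ℝ × (Fin 3 → ℝ) => (Fin.cons q.1 q.2 : Fin 4 → ℝ)) '' (univ ×ˢ S) := by
    ext p
    constructor
    · intro hp
      refine ⟨(p 0, spatial p), ⟨mem_univ _, hp⟩, ?_⟩
      ext i; refine Fin.cases rfl (fun i => rfl) i
    · rintro ⟨⟨t, x⟩, ⟨-, hx⟩, rfl⟩
      have : spatial (Fin.cons t x : Fin 4 → ℝ) = x := by ext i; simp [spatial]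
      simpa [this] using hx
  rw [this]
  refine (isConnected_univ.prod hS).image _ (Continuous.continuousOn ?_)
  exact continuous_pi fun i => Fin.cases (by simpa using continuous_fst)
    (fun i => by simp only [Fin.cons_succ]; fun_prop) i

theorem isConnected_nullRegion {N : ℕ} (a : Fin N → Fin 3 → ℝ) : IsConnected (nullRegion a) :=
  isConnected_preimage_spatial (isConnected_puncturedSpace a)

theorem IsKKReduction.axion_const {M : Set (Fin 4 → ℝ)} (hM : IsOpen M) (hc : IsConnected M)
    {g₅ F₅ : Cov2 5} {X Y : Fields4} (hX : IsKKReduction M g₅ F₅ X)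
    (hY : IsKKReduction M g₅ F₅ Y) (hρ : ∀ p, X.ρ p = 0) : ∃ c : ℝ, ∀ p ∈ M, Y.ρ p = c := by
  refine hM.exists_is_const_of_fderiv_eq_zero (𝕜 := ℝ) hc.isPreconnected
    (hY.1.2.2.1.differentiableOn (by simp)) fun p hp => ?_
  ext V
  rw [fderiv_apply_eq_sum_pd]
  have : ∀ a, pd a Y.ρ p = 0 := fun a => by
    rw [(hX.unique hM hY hp).2.2.2.2 a, show X.ρ = fun _ => 0 from funext hρ, pd_const]
  simp [this]

/-! ## The fields of the null class -/

/-- With `A = √(-𝒬)` and `B = √𝒢` every exponential of the dilaton that is evaluated in the proof is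
an integer power of `A/B` or `B/A`, and the conformal factor is `A B³`. The reduction and the field
equations thereby become rational identities. -/
theorem exp_dilaton {A B : ℝ} (hA : 0 < A) (hB : 0 < B) (k : ℕ) {t : ℝ}
    (ht : t = k * (Real.log A - Real.log B)) : Real.exp t = (A / B) ^ k := by
  rw [ht, ← Real.log_div hA.ne' hB.ne', ← Real.log_pow, Real.exp_log (by positivity)]

section NullFields

variable {𝒢 𝒬 : (Fin 3 → ℝ) → ℝ} {p : Fin 4 → ℝ}

theorem nullFields4_conformal (hG : 0 < 𝒢 (spatial p)) (hQ : 𝒬 (spatial p) < 0) :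
    √(-(𝒬 (spatial p) * 𝒢 (spatial p) ^ 3)) = √(-𝒬 (spatial p)) * √(𝒢 (spatial p)) ^ 3 := by
  rw [← neg_mul, Real.sqrt_mul (by linarith)]
  congr 1
  rw [Real.sqrt_eq_iff_mul_self_eq (by positivity) (by positivity)]
  have := Real.sq_sqrt hG.le
  calc _ = ((√(𝒢 (spatial p))) ^ 2) ^ 3 := by rw [this]
    _ = _ := by ring

theorem nullFields4_dilaton (hG : 0 < 𝒢 (spatial p)) (hQ : 𝒬 (spatial p) < 0) :
    (nullFields4 𝒢 𝒬).Φ p =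
      -√3 * (Real.log √(-𝒬 (spatial p)) - Real.log √(𝒢 (spatial p))) := by
  simp only [nullFields4]
  rw [← neg_div (𝒢 (spatial p)), Real.log_div (by linarith) hG.ne', Real.log_sqrt (by linarith),
    Real.log_sqrt hG.le]
  ring

end NullFields

theorem isLorentzian_diagonal {s : ℝ} (hs : 0 < s) :
    IsLorentzian (Matrix.diagonal ![-s⁻¹, s, s, s]) := by
  have h := Real.sq_sqrt hs.le
  have h0 : √s ≠ 0 := (Real.sqrt_pos.2 hs).ne'
  refine isLorentzian_of_frame (E := Matrix.diagonal ![√s, (√s)⁻¹, (√s)⁻¹, (√s)⁻¹])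
    (Matrix.isSymm_diagonal _) ?_
  rw [Matrix.diagonal_transpose, Matrix.diagonal_mul_diagonal, Matrix.diagonal_mul_diagonal,
    minkowski]
  congr 1
  ext i
  fin_cases i <;> simp <;> field_simp <;> nlinarith [h]

section Reduction

variable {𝒢 𝒬 : (Fin 3 → ℝ) → ℝ} {S : Set (Fin 3 → ℝ)}

theorem contDiffOn_spatial {f : (Fin 3 → ℝ) → ℝ} (hf : ContDiffOn ℝ ∞ f S) :
    ContDiffOn ℝ ∞ (fun p => f (spatial p)) (spatial ⁻¹' S) :=
  hf.comp contDiff_spatial.contDiffOn fun _ h => h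

theorem smul_star3d_smoothOn (κ : ℝ) {f : (Fin 3 → ℝ) → ℝ} (hS : IsOpen S)
    (hf : ContDiffOn ℝ ∞ f S) : Cov2.SmoothOn (fun x => κ • star3d f x) S := fun a b => by
  simp only [Matrix.smul_apply, star3d, Matrix.of_apply, smul_eq_mul]
  exact contDiffOn_const.mul (ContDiffOn.sum fun k _ => contDiffOn_const.mul (hf.pd k hS))

theorem nullFields4_smoothOn (hS : IsOpen S) (hGs : ContDiffOn ℝ ∞ 𝒢 S) (hQs : ContDiffOn ℝ ∞ 𝒬 S)
    (hG : ∀ x ∈ S, 0 < 𝒢 x) (hQ : ∀ x ∈ S, 𝒬 x < 0) :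
    (nullFields4 𝒢 𝒬).SmoothOn (spatial ⁻¹' S) := by
  have hs : ContDiffOn ℝ ∞ (fun p => √(-(𝒬 (spatial p) * 𝒢 (spatial p) ^ 3))) (spatial ⁻¹' S) := by
    refine ContDiffOn.sqrt ((contDiffOn_spatial hQs).mul ((contDiffOn_spatial hGs).pow 3)).neg
      fun p hp => ?_
    have h1 := hG _ hp
    have h2 := hQ _ hp
    have : 0 < 𝒢 (spatial p) ^ 3 := by positivity
    nlinarith
  have hs0 : ∀ p ∈ spatial ⁻¹' S, √(-(𝒬 (spatial p) * 𝒢 (spatial p) ^ 3)) ≠ 0 := by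
    intro p hp
    have h1 := hG _ hp
    have h2 := hQ _ hp
    have : 0 < 𝒢 (spatial p) ^ 3 := by positivity
    exact (Real.sqrt_pos.2 (by nlinarith)).ne'
  have hMo : IsOpen (spatial ⁻¹' S) := hS.preimage continuous_spatial
  refine ⟨?_, ?_, contDiffOn_const, ?_, ?_⟩
  · intro a b
    by_cases hab : a = b
    · subst hab
      simp only [nullFields4, Matrix.diagonal_apply_eq]
      fin_cases a
      · exact (hs.inv hs0).neg
      all_goals exact hs
    · simp only [nullFields4, Matrix.diagonal_apply_ne _ hab]
      exact contDiffOn_const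
  · have h1 : ContDiffOn ℝ ∞ (fun p => -(𝒬 (spatial p) / 𝒢 (spatial p))) (spatial ⁻¹' S) :=
      ((contDiffOn_spatial hQs).div (contDiffOn_spatial hGs) fun p hp => (hG _ hp).ne').neg
    exact contDiffOn_const.mul (h1.log fun p hp =>
      neg_ne_zero.2 (div_ne_zero (hQ _ hp).ne (hG _ hp).ne'))
  · exact pullback2_smoothOn (w := fun x => (√3 / 2) • star3d 𝒢 x) hMo contDiff_spatial.contDiffOn
      (mapsTo_preimage _ _) (smul_star3d_smoothOn _ hS hGs)
  · intro a b
    simp only [nullFields4, Matrix.smul_apply, wedge11, Matrix.of_apply, smul_eq_mul, gradForm]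
    have h1 : ContDiffOn ℝ ∞ (fun p => (𝒬 (spatial p) ^ 2)⁻¹) (spatial ⁻¹' S) :=
      ((contDiffOn_spatial hQs).pow 2).inv fun p hp => pow_ne_zero 2 (hQ _ hp).ne
    have h2 := fun i => (contDiffOn_spatial hQs).pd i hMo
    exact h1.mul ((contDiffOn_const.mul (h2 b)).sub (contDiffOn_const.mul (h2 a)))

theorem nullFields4_lorentzian {p : Fin 4 → ℝ} (hG : 0 < 𝒢 (spatial p)) (hQ : 𝒬 (spatial p) < 0) :
    IsLorentzian ((nullFields4 𝒢 𝒬).g p) := by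
  refine isLorentzian_diagonal (Real.sqrt_pos.2 ?_)
  have : 0 < 𝒢 (spatial p) ^ 3 := by positivity
  nlinarith

/-- The potential `𝒬⁻¹ dv` of the Kaluza-Klein gauge field. -/
noncomputable def kkPotential (𝒬 : (Fin 3 → ℝ) → ℝ) : Cov1 4 := fun p =>
  (𝒬 (spatial p))⁻¹ • Pi.single 0 1

theorem kkPotential_smoothOn (hQs : ContDiffOn ℝ ∞ 𝒬 S) (hQ : ∀ x ∈ S, 𝒬 x < 0) :
    (kkPotential 𝒬).SmoothOn (spatial ⁻¹' S) := fun a => by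
  simp only [kkPotential, Pi.smul_apply, smul_eq_mul]
  exact ((contDiffOn_spatial hQs).inv fun p hp => (hQ _ hp).ne).mul contDiffOn_const

theorem extD1_kkPotential {p : Fin 4 → ℝ} (hQs : DifferentiableAt ℝ (fun q => 𝒬 (spatial q)) p)
    (hQ : 𝒬 (spatial p) < 0) :
    (nullFields4 𝒢 𝒬).G p = extD1 (kkPotential 𝒬) p := by
  ext a b
  simp only [extD1, nullFields4, kkPotential, Matrix.of_apply, Pi.smul_apply, smul_eq_mul,
    Matrix.smul_apply, wedge11, gradForm]
  rw [((hQs.hasPd.inv hQ.ne).mul (hasPd_const _)).2, ((hQs.hasPd.inv hQ.ne).mul (hasPd_const _)).2]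
  have := hQ.ne
  field_simp
  ring

theorem nullMetric5_last_last (P : Fin 5 → ℝ) : nullMetric5 𝒢 𝒬 P (Fin.last 4) (Fin.last 4) =
    -((𝒢 (spatial (proj54 P)))⁻¹ * 𝒬 (spatial (proj54 P))) := rfl

theorem nullMetric5_castSucc_last (P : Fin 5 → ℝ) (i : Fin 4) :
    nullMetric5 𝒢 𝒬 P i.castSucc (Fin.last 4) =
      -((𝒢 (spatial (proj54 P)))⁻¹ * (Pi.single 0 1 : Fin 4 → ℝ) i) := by
  fin_cases i <;> simp [nullMetric5, Fin.last]

theorem nullMetric5_symm (P : Fin 5 → ℝ) (i j : Fin 5) :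
    nullMetric5 𝒢 𝒬 P i j = nullMetric5 𝒢 𝒬 P j i := by
  fin_cases i <;> fin_cases j <;> rfl

theorem nullMetric5_castSucc (P : Fin 5 → ℝ) (i j : Fin 4) :
    nullMetric5 𝒢 𝒬 P i.castSucc j.castSucc =
      𝒢 (spatial (proj54 P)) ^ 2 * Matrix.diagonal ![0, 1, 1, 1] i j := by
  fin_cases i <;> fin_cases j <;> simp [nullMetric5]

/-- Completing the square: `-𝒢⁻¹(𝒬 du² + 2 du dv) = -(𝒬/𝒢)(du + 𝒬⁻¹ dv)² + dv²/(𝒬𝒢)`, where the last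
term is `e^{Φ/√3}` times `-dv²/√(-𝒬𝒢³)`. -/
theorem nullMetric5_eq (P : Fin 5 → ℝ) (hG : 0 < 𝒢 (spatial (proj54 P)))
    (hQ : 𝒬 (spatial (proj54 P)) < 0) :
    nullMetric5 𝒢 𝒬 P =
      Real.exp ((nullFields4 𝒢 𝒬).Φ (proj54 P) / √3) • pullback2 proj54 (nullFields4 𝒢 𝒬).g P
        + Real.exp (-2 * (nullFields4 𝒢 𝒬).Φ (proj54 P) / √3) •
          Matrix.vecMulVec (duForm + pullback1 proj54 (kkPotential 𝒬) P)
            (duForm + pullback1 proj54 (kkPotential 𝒬) P) := by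
  set A := √(-𝒬 (spatial (proj54 P))) with hA
  set B := √(𝒢 (spatial (proj54 P))) with hB
  have hA0 : 0 < A := Real.sqrt_pos.2 (by linarith)
  have hB0 : 0 < B := Real.sqrt_pos.2 hG
  have h3 : √(3 : ℝ) ≠ 0 := by positivity
  have hΦ : (nullFields4 𝒢 𝒬).Φ (proj54 P) = _ := nullFields4_dilaton hG hQ
  rw [← hA, ← hB] at hΦ
  have e1 : Real.exp ((nullFields4 𝒢 𝒬).Φ (proj54 P) / √3) = (B / A) ^ 1 :=
    exp_dilaton hB0 hA0 1 (by rw [hΦ]; field_simp; push_cast; ring)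
  have e2 : Real.exp (-2 * (nullFields4 𝒢 𝒬).Φ (proj54 P) / √3) = (A / B) ^ 2 :=
    exp_dilaton hA0 hB0 2 (by rw [hΦ]; field_simp; push_cast; ring)
  have hg : (nullFields4 𝒢 𝒬).g (proj54 P) =
      Matrix.diagonal ![-(A * B ^ 3)⁻¹, A * B ^ 3, A * B ^ 3, A * B ^ 3] := by
    simp only [nullFields4, nullFields4_conformal hG hQ, hA, hB]
  have hQA : 𝒬 (spatial (proj54 P)) = -A ^ 2 := by rw [Real.sq_sqrt (by linarith)]; ring
  have hGB : 𝒢 (spatial (proj54 P)) = B ^ 2 := by rw [Real.sq_sqrt hG.le]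
  rw [e1, e2]
  ext i j
  refine Fin.lastCases ?_ (fun i => ?_) i <;> refine Fin.lastCases ?_ (fun j => ?_) j
  · simp only [Matrix.add_apply, Matrix.smul_apply, pullback2_proj54_last_right, smul_eq_mul,
      Matrix.vecMulVec_apply, Pi.add_apply, duForm_last, pullback1_proj54_last,
      nullMetric5_last_last, hQA, hGB]
    field_simp; ring
  · rw [nullMetric5_symm]
    simp only [Matrix.add_apply, Matrix.smul_apply, pullback2_proj54_last_left, smul_eq_mul,
      Matrix.vecMulVec_apply, Pi.add_apply, duForm_last, pullback1_proj54_last, duForm_castSucc,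
      pullback1_proj54_castSucc, nullMetric5_castSucc_last, hQA, hGB, kkPotential, Pi.smul_apply]
    field_simp; ring
  · simp only [Matrix.add_apply, Matrix.smul_apply, pullback2_proj54_last_right, smul_eq_mul,
      Matrix.vecMulVec_apply, Pi.add_apply, duForm_last, pullback1_proj54_last, duForm_castSucc,
      pullback1_proj54_castSucc, nullMetric5_castSucc_last, hQA, hGB, kkPotential, Pi.smul_apply]
    field_simp; ring
  · simp only [Matrix.add_apply, Matrix.smul_apply, pullback2_proj54_castSucc, smul_eq_mul,
      Matrix.vecMulVec_apply, Pi.add_apply, duForm_castSucc, hg,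
      pullback1_proj54_castSucc, nullMetric5_castSucc, hQA, hGB, kkPotential, Pi.smul_apply]
    fin_cases i <;> fin_cases j <;> simp <;> field_simp <;> ring

theorem nullMaxwell5_eq {U : Set (Fin 4 → ℝ)} {A : Cov1 4} (hU : IsOpen U) (hA : A.SmoothOn U)
    (hAF : ∀ x ∈ U, (nullFields4 𝒢 𝒬).F x = extD1 A x) {P : Fin 5 → ℝ} (hP : proj54 P ∈ U) :
    nullMaxwell5 𝒢 P =
      extD1 (fun Q => pullback1 proj54 A Q + (nullFields4 𝒢 𝒬).ρ (proj54 Q) • duForm) P := by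
  have hd : ∀ c, DifferentiableAt ℝ (fun q => A q c) (proj54 P) := fun c =>
    ((hA c).contDiffAt (hU.mem_nhds hP)).diff
  have h1 : nullMaxwell5 𝒢 P = pullback2 proj54 (nullFields4 𝒢 𝒬).F P := by
    rw [nullMaxwell5, nullFields4, pullback2_comp]
    · exact contDiff_spatial.contDiffAt.differentiableAt (by simp)
    · exact contDiff_proj54.contDiffAt.differentiableAt (by simp)
  rw [h1]
  have hanti : ∀ i j, extD1 (fun Q => pullback1 proj54 A Q + (nullFields4 𝒢 𝒬).ρ (proj54 Q) • duForm)
      P i j = -extD1 (fun Q => pullback1 proj54 A Q + (nullFields4 𝒢 𝒬).ρ (proj54 Q) • duForm) P j i :=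
    fun i j => by simp only [extD1, Matrix.of_apply]; ring
  have hlast := fun i => extD1_potential_last (ρ := (nullFields4 𝒢 𝒬).ρ) hd
    (differentiableAt_const _) i
  have hz : ∀ i, pd i (nullFields4 𝒢 𝒬).ρ (proj54 P) = 0 := fun i => pd_const i 0
  ext i j
  refine Fin.lastCases ?_ (fun i => ?_) i <;> refine Fin.lastCases ?_ (fun j => ?_) j
  · rw [pullback2_proj54_last_left]; simp [extD1]
  · rw [pullback2_proj54_last_left, hanti, hlast, hz, neg_zero]
  · rw [pullback2_proj54_last_right, hlast, hz]
  · rw [pullback2_proj54_castSucc, extD1_potential_castSucc hd, hAF _ hP]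

end Reduction

theorem nullFields4_isKKReduction {N : ℕ} {c e : ℝ} {m q : Fin N → ℝ} {a : Fin N → Fin 3 → ℝ}
    {𝒢 𝒬 : (Fin 3 → ℝ) → ℝ} (h𝒢 : 𝒢 = multiCentre c m a) (h𝒬 : 𝒬 = multiCentre e q a)
    (hG : ∀ x, 0 < 𝒢 x) (hQ : ∀ x, 𝒬 x < 0) :
    IsKKReduction (nullRegion a) (nullMetric5 𝒢 𝒬) (nullMaxwell5 𝒢) (nullFields4 𝒢 𝒬) := by
  have hQs : ContDiffOn ℝ ∞ 𝒬 (puncturedSpace a) := h𝒬 ▸ contDiffOn_multiCentre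
  refine ⟨nullFields4_smoothOn (isOpen_puncturedSpace a) (h𝒢 ▸ contDiffOn_multiCentre) hQs
    (fun x _ => hG x) (fun x _ => hQ x), fun p _ => nullFields4_lorentzian (hG _) (hQ _),
    kkPotential 𝒬, kkPotential_smoothOn hQs fun x _ => hQ x, fun P _ => nullMetric5_eq P (hG _) (hQ _),
    fun p hp => extD1_kkPotential ((contDiffOn_spatial hQs).contDiffAt
      ((isOpen_nullRegion a).mem_nhds hp)).diff (hQ _), fun p hp => ?_⟩
  obtain ⟨U, hU, hpU, hUM, A, hA, hAF⟩ := exists_potential c (√3 / 2) m a hp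
  have hAF' : ∀ x ∈ U, (nullFields4 𝒢 𝒬).F x = extD1 A x := fun x hx => by
    rw [← hAF x hx, nullFields4, h𝒢]
  refine ⟨U, hU, hpU, hUM, A, hA, fun P hP => nullMaxwell5_eq hU hA hAF' hP, fun x hx => ?_⟩
  rw [hAF' x hx]
  ext i j
  simp [wedge11, gradForm, nullFields4, pd_const]

/-! ## Static metrics `diag(-s⁻¹, s, s, s)` -/

/-- A positive smooth function on an open set that does not depend on the time. -/
structure IsStatic (M : Set (Fin 4 → ℝ)) (s : (Fin 4 → ℝ) → ℝ) : Prop where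
  isOpen : IsOpen M
  smooth : ContDiffOn ℝ ∞ s M
  pos : ∀ p ∈ M, 0 < s p
  static : ∀ p ∈ M, pd 0 s p = 0

namespace IsStatic

variable {M : Set (Fin 4 → ℝ)} {s t : (Fin 4 → ℝ) → ℝ} {p : Fin 4 → ℝ}

theorem contDiffAt (h : IsStatic M s) (hp : p ∈ M) : ContDiffAt ℝ ∞ s p :=
  h.smooth.contDiffAt (h.isOpen.mem_nhds hp)

theorem hasPd (h : IsStatic M s) (hp : p ∈ M) : HasPd s (fun a => pd a s p) p :=
  (h.contDiffAt hp).diff.hasPd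

theorem hasPd_pd (h : IsStatic M s) (hp : p ∈ M) (a : Fin 4) :
    HasPd (pd a s) (fun b => pd b (pd a s) p) p :=
  ((h.contDiffAt hp).pd a).diff.hasPd

theorem pd_zero_right (h : IsStatic M s) (hp : p ∈ M) (a : Fin 4) : pd a (pd 0 s) p = 0 := by
  rw [pd_congr_of_isOpen (h := fun _ => 0) h.isOpen hp h.static, pd_const]

theorem pd_zero_left (h : IsStatic M s) (hp : p ∈ M) (a : Fin 4) : pd 0 (pd a s) p = 0 := by
  rw [pd_comm 0 a (h.contDiffAt hp), h.pd_zero_right hp]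

theorem hasPd_logDeriv (h : IsStatic M s) (hp : p ∈ M) (a : Fin 4) :
    HasPd (fun q => pd a s q / s q)
      (fun b => (pd b (pd a s) p * s p - pd a s p * pd b s p) / s p ^ 2) p :=
  (h.hasPd_pd hp a).div (h.hasPd hp) (h.pos p hp).ne'

theorem mul_pow_three (h : IsStatic M s) (h' : IsStatic M t) : IsStatic M fun q => s q * t q ^ 3 where
  isOpen := h.isOpen
  smooth := h.smooth.mul (h'.smooth.pow 3)
  pos p hp := mul_pos (h.pos p hp) (pow_pos (h'.pos p hp) 3)
  static p hp := by
    rw [((h.hasPd hp).mul ((h'.hasPd hp).pow 3)).2]; beta_reduce; rw [h.static p hp, h'.static p hp]; simp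

end IsStatic

/-- The metric `diag(-s⁻¹, s, s, s)`. -/
noncomputable def staticMetric (s : (Fin 4 → ℝ) → ℝ) : Cov2 4 := fun p =>
  Matrix.diagonal ![-(s p)⁻¹, s p, s p, s p]

/-- The diagonal of the inverse of `diag(-s⁻¹, s, s, s)`. -/
noncomputable def staticInv (s : ℝ) : Fin 4 → ℝ := ![-s, s⁻¹, s⁻¹, s⁻¹]

theorem inv_staticMetric {s : (Fin 4 → ℝ) → ℝ} {p : Fin 4 → ℝ} (hs : 0 < s p) :
    (staticMetric s p)⁻¹ = Matrix.diagonal (staticInv (s p)) := by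
  apply Matrix.inv_eq_right_inv
  rw [staticMetric, staticInv, Matrix.diagonal_mul_diagonal, ← Matrix.diagonal_one]
  congr 1
  ext i
  fin_cases i <;> simp [hs.ne']

theorem det_staticMetric {s : (Fin 4 → ℝ) → ℝ} {p : Fin 4 → ℝ} (hs : 0 < s p) :
    √|(staticMetric s p).det| = s p := by
  have : (staticMetric s p).det = -(s p ^ 2) := by
    rw [staticMetric, Matrix.det_diagonal, Fin.prod_univ_four]
    simp; field_simp
  rw [this, abs_neg, abs_of_nonneg (by positivity), Real.sqrt_sq hs.le]

/-- The Christoffel symbols of `diag(-s⁻¹, s, s, s)`. -/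
noncomputable def staticChristoffel (s : (Fin 4 → ℝ) → ℝ) (a b c : Fin 4) (p : Fin 4 → ℝ) : ℝ :=
  (1 / 2) * ((if a = c then ![-1, 1, 1, 1] a else 0) * (pd b s p / s p)
    + (if a = b then ![-1, 1, 1, 1] a else 0) * (pd c s p / s p)
    - (if b = c then ![(s p ^ 2)⁻¹, 1, 1, 1] b else 0) * (pd a s p / s p))

section StaticMetric

variable {M : Set (Fin 4 → ℝ)} {s : (Fin 4 → ℝ) → ℝ} {p : Fin 4 → ℝ}

theorem pd_staticMetric (h : IsStatic M s) (hp : p ∈ M) (a b c : Fin 4) :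
    pd a (fun q => staticMetric s q b c) p =
      if b = c then ![(s p ^ 2)⁻¹, 1, 1, 1] b * pd a s p else 0 := by
  by_cases hbc : b = c
  · subst hbc
    simp only [staticMetric, Matrix.diagonal_apply_eq, if_true]
    have h1 := ((h.hasPd hp).inv (h.pos p hp).ne').neg.2 a
    have h0 := (h.pos p hp).ne'
    fin_cases b <;> simp [h1]
    field_simp
  · simp only [staticMetric, Matrix.diagonal_apply_ne _ hbc, if_neg hbc, pd_const]

theorem christoffel_staticMetric (h : IsStatic M s) (hp : p ∈ M) (a b c : Fin 4) :
    christoffel (staticMetric s) a b c p = staticChristoffel s a b c p := by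
  have h0 := (h.pos p hp).ne'
  have hs := h.static p hp
  simp only [christoffel, inv_staticMetric (h.pos p hp), pd_staticMetric h hp, Matrix.diagonal_apply,
    staticChristoffel, ite_mul, zero_mul, Finset.sum_ite_eq, Finset.mem_univ, if_true]
  fin_cases a <;> fin_cases b <;> fin_cases c <;> simp [staticInv, hs] <;> field_simp

theorem hasPd_staticChristoffel (h : IsStatic M s) (hp : p ∈ M) (a b c : Fin 4) :
    HasPd (staticChristoffel s a b c) (fun e =>
      (1 / 2) * ((if a = c then ![-1, 1, 1, 1] a else 0)
          * ((pd e (pd b s) p * s p - pd b s p * pd e s p) / s p ^ 2)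
        + (if a = b then ![-1, 1, 1, 1] a else 0)
          * ((pd e (pd c s) p * s p - pd c s p * pd e s p) / s p ^ 2)
        - ((if b = c then ![-2 * pd e s p / s p ^ 3, 0, 0, 0] b else 0) * (pd a s p / s p)
          + (if b = c then ![(s p ^ 2)⁻¹, 1, 1, 1] b else 0)
            * ((pd e (pd a s) p * s p - pd a s p * pd e s p) / s p ^ 2)))) p := by
  have h0 := (h.pos p hp).ne'
  -- Among the three diagonal coefficients of `staticChristoffel` only this one varies with the
  -- point, and only in its `00` entry `s⁻²`.
  have hτ : HasPd (fun q => if b = c then ![(s q ^ 2)⁻¹, 1, 1, 1] b else 0)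
      (fun e => if b = c then ![-2 * pd e s p / s p ^ 3, 0, 0, 0] b else 0) p := by
    split_ifs
    · fin_cases b
      · exact (((h.hasPd hp).pow 2).inv (pow_ne_zero 2 h0)).congr_deriv fun e => by
          simp; field_simp
      all_goals exact hasPd_const 1
    · exact hasPd_const 0
  exact ((((h.hasPd_logDeriv hp b).const_mul _).add ((h.hasPd_logDeriv hp c).const_mul _)).sub
    (hτ.mul (h.hasPd_logDeriv hp a))).const_mul _

/-- The sum on the right is the flat Laplacian of `log s`. This is the only place where second
derivatives survive, so that harmonicity can remove them. -/
theorem ricci_staticMetric (h : IsStatic M s) (hp : p ∈ M) (b c : Fin 4) :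
    ricci (staticMetric s) p b c =
      -(1 / 2) * (if b = c then ![(s p ^ 2)⁻¹, 1, 1, 1] b else 0) *
          (∑ a, (pd a (pd a s) p / s p - (pd a s p / s p) ^ 2))
        - (1 / 2) * (pd b s p / s p) * (pd c s p / s p) := by
  have h0 := (h.pos p hp).ne'
  have e1 : ∀ a b c e, pd e (christoffel (staticMetric s) a b c) p = _ := fun a b c e =>
    (pd_congr_of_isOpen h.isOpen hp fun x hx => christoffel_staticMetric h hx a b c).trans
      ((hasPd_staticChristoffel h hp a b c).2 e)
  simp only [ricci, e1, christoffel_staticMetric h hp, staticChristoffel]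
  have hs := h.static p hp
  have hl := h.pd_zero_left hp
  have hr := h.pd_zero_right hp
  have c1 := pd_comm 1 2 (h.contDiffAt hp)
  have c2 := pd_comm 1 3 (h.contDiffAt hp)
  have c3 := pd_comm 2 3 (h.contDiffAt hp)
  fin_cases b <;> fin_cases c <;>
    simp [Fin.sum_univ_four, hs, hl, hr, c1, c2, c3] <;> field_simp <;> ring

end StaticMetric

/-! ## Tensor algebra for the metric `diag(-s⁻¹, s, s, s)` -/

/-- The matrix in `leviCivita` carries the Vandermonde matrix of `(0, 1, 2, 3)`, whose determinant
is `12`, to that of `s`; taking determinants gives the formula without running through all index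
tuples. -/
theorem leviCivita_four (s : Fin 4 → Fin 4) : leviCivita s =
    (∏ i : Fin 4, ∏ j ∈ Finset.Ioi i, (((s j : ℕ) : ℝ) - (s i : ℕ))) / 12 := by
  have h : (Matrix.of fun i j : Fin 4 => if s i = j then (1 : ℝ) else 0)
      * Matrix.vandermonde (fun i : Fin 4 => ((i : ℕ) : ℝ))
      = Matrix.vandermonde fun i => ((s i : ℕ) : ℝ) := by
    ext i k
    simp [Matrix.mul_apply, Matrix.vandermonde]
  have h2 := congrArg Matrix.det h
  rw [Matrix.det_mul, Matrix.det_vandermonde, Matrix.det_vandermonde] at h2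
  have h3 : (∏ i : Fin 4, ∏ j ∈ Finset.Ioi i, (((j : ℕ) : ℝ) - (i : ℕ))) = 12 := by
    have : ∀ i : Fin 4, Finset.Ioi i = Finset.univ.filter fun j => i < j := fun i => by ext; simp
    simp [Fin.prod_univ_four, this, Finset.prod_filter]
    norm_num
  rw [h3] at h2
  rw [leviCivita, eq_div_iff (by norm_num), h2]

theorem leviCivita_vec_four (a b c d : Fin 4) : leviCivita ![a, b, c, d] =
    (((b : ℕ) : ℝ) - (a : ℕ)) * (((c : ℕ) : ℝ) - (a : ℕ)) * (((d : ℕ) : ℝ) - (a : ℕ)) *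
      (((c : ℕ) : ℝ) - (b : ℕ)) * (((d : ℕ) : ℝ) - (b : ℕ)) * (((d : ℕ) : ℝ) - (c : ℕ)) / 12 := by
  rw [leviCivita_four]
  have : ∀ i : Fin 4, Finset.Ioi i = Finset.univ.filter fun j => i < j := fun i => by ext; simp
  simp [Fin.prod_univ_four, this, Finset.prod_filter]
  left
  ring

/-- The electric 2-form `e₀ ∧ u`. -/
def electric (u : Fin 4 → ℝ) : Matrix (Fin 4) (Fin 4) ℝ :=
  !![0, u 1, u 2, u 3; -u 1, 0, 0, 0; -u 2, 0, 0, 0; -u 3, 0, 0, 0]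

/-- The magnetic 2-form `⋆₃ u`. -/
def magnetic (u : Fin 4 → ℝ) : Matrix (Fin 4) (Fin 4) ℝ :=
  !![0, 0, 0, 0; 0, 0, u 3, -u 2; 0, -u 3, 0, u 1; 0, u 2, -u 1, 0]

section Algebra

variable {s : (Fin 4 → ℝ) → ℝ} {p : Fin 4 → ℝ}

theorem raise2_staticMetric (hs : 0 < s p) (w : Matrix (Fin 4) (Fin 4) ℝ) (a b : Fin 4) :
    raise2 (staticMetric s p) w a b = staticInv (s p) a * staticInv (s p) b * w a b := by
  simp only [raise2, inv_staticMetric hs, Matrix.of_apply, Matrix.diagonal_apply, ite_mul, mul_ite,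
    zero_mul, mul_zero, Finset.sum_ite_eq, Finset.mem_univ, if_true]

theorem contr2_staticMetric (hs : 0 < s p) (w z : Matrix (Fin 4) (Fin 4) ℝ) :
    contr2 (staticMetric s p) w z =
      ∑ a, ∑ b, w a b * (staticInv (s p) a * staticInv (s p) b * z a b) := by
  simp only [contr2, raise2_staticMetric hs]

theorem square2_staticMetric (hs : 0 < s p) (w : Matrix (Fin 4) (Fin 4) ℝ) (a b : Fin 4) :
    square2 (staticMetric s p) w a b = ∑ c, w a c * w b c * staticInv (s p) c := by
  simp only [square2, inv_staticMetric hs, Matrix.diagonal_apply, mul_ite, mul_zero,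
    Finset.sum_ite_eq, Finset.mem_univ, if_true]

theorem hodge4_magnetic (hs : 0 < s p) (σ : ℝ) (u : Fin 4 → ℝ) (k : ℝ) :
    hodge4 σ (staticMetric s p) (k • magnetic u) = (σ * k * (s p)⁻¹) • electric u := by
  ext c d
  simp only [hodge4, Matrix.of_apply, raise2_staticMetric hs, det_staticMetric hs,
    leviCivita_vec_four, Fin.sum_univ_four]
  fin_cases c <;> fin_cases d <;> simp [magnetic, electric, staticInv] <;> field_simp <;> norm_num <;> ring

theorem hodge4_electric (hs : 0 < s p) (σ : ℝ) (u : Fin 4 → ℝ) (k : ℝ) :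
    hodge4 σ (staticMetric s p) (k • electric u) = (-(σ * k * s p)) • magnetic u := by
  ext c d
  simp only [hodge4, Matrix.of_apply, raise2_staticMetric hs, det_staticMetric hs,
    leviCivita_vec_four, Fin.sum_univ_four]
  fin_cases c <;> fin_cases d <;> simp [magnetic, electric, staticInv] <;> field_simp <;> norm_num <;> ring

theorem contr2_electric_magnetic (hs : 0 < s p) (u w : Fin 4 → ℝ) (k l : ℝ) :
    contr2 (staticMetric s p) (k • electric u) (l • magnetic w) = 0 := by
  simp [contr2_staticMetric hs, Fin.sum_univ_four, electric, magnetic]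

theorem contr2_magnetic_electric (hs : 0 < s p) (u w : Fin 4 → ℝ) (k l : ℝ) :
    contr2 (staticMetric s p) (k • magnetic u) (l • electric w) = 0 := by
  simp [contr2_staticMetric hs, Fin.sum_univ_four, electric, magnetic]

theorem contr2_electric (hs : 0 < s p) (u : Fin 4 → ℝ) (k : ℝ) :
    contr2 (staticMetric s p) (k • electric u) (k • electric u) =
      -2 * k ^ 2 * (u 1 ^ 2 + u 2 ^ 2 + u 3 ^ 2) := by
  simp [contr2_staticMetric hs, Fin.sum_univ_four, electric, staticInv]
  field_simp
  ring

theorem contr2_magnetic (hs : 0 < s p) (u : Fin 4 → ℝ) (k : ℝ) :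
    contr2 (staticMetric s p) (k • magnetic u) (k • magnetic u) =
      2 * k ^ 2 * (s p ^ 2)⁻¹ * (u 1 ^ 2 + u 2 ^ 2 + u 3 ^ 2) := by
  simp [contr2_staticMetric hs, Fin.sum_univ_four, magnetic, staticInv]
  field_simp
  ring

/-- The stress tensor of an electric field. -/
theorem stress_electric (hs : 0 < s p) {u : Fin 4 → ℝ} (hu : u 0 = 0) (k : ℝ) (a b : Fin 4) :
    square2 (staticMetric s p) (k • electric u) a b - (1 / 4) * staticMetric s p a b *
        contr2 (staticMetric s p) (k • electric u) (k • electric u) =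
      k ^ 2 * s p * ((1 / 2) * (if a = b then ![(s p ^ 2)⁻¹, 1, 1, 1] a else 0) *
        (u 1 ^ 2 + u 2 ^ 2 + u 3 ^ 2) - u a * u b) := by
  rw [contr2_electric hs, square2_staticMetric hs]
  fin_cases a <;> fin_cases b <;>
    simp [Fin.sum_univ_four, electric, staticInv, staticMetric, hu] <;> field_simp <;> ring

/-- The stress tensor of a magnetic field. -/
theorem stress_magnetic (hs : 0 < s p) {u : Fin 4 → ℝ} (hu : u 0 = 0) (k : ℝ) (a b : Fin 4) :
    square2 (staticMetric s p) (k • magnetic u) a b - (1 / 4) * staticMetric s p a b *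
        contr2 (staticMetric s p) (k • magnetic u) (k • magnetic u) =
      k ^ 2 * (s p)⁻¹ * ((1 / 2) * (if a = b then ![(s p ^ 2)⁻¹, 1, 1, 1] a else 0) *
        (u 1 ^ 2 + u 2 ^ 2 + u 3 ^ 2) - u a * u b) := by
  rw [contr2_magnetic hs, square2_staticMetric hs]
  fin_cases a <;> fin_cases b <;>
    simp [Fin.sum_univ_four, magnetic, staticInv, staticMetric, hu] <;> field_simp <;> ring

end Algebra

section Closed

variable {p : Fin 4 → ℝ} {u : (Fin 4 → ℝ) → Fin 4 → ℝ}

/-- For static `u` one has `d(e₀ ∧ u) = -e₀ ∧ du`, and the symmetry of `d` says that `u` is curl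
free. -/
theorem extD2_electric {d : Fin 4 → Fin 4 → ℝ} (hd : ∀ b, HasPd (fun q => u q b) (d b) p)
    (hsymm : ∀ a b, d a b = d b a) (h0 : ∀ b, d b 0 = 0) (a b c : Fin 4) :
    extD2 (fun q => electric (u q)) p a b c = 0 := by
  have h1 := fun i j => (hd i).2 j
  have h2 := fun i j => (hd i).neg.2 j
  have c1 := hsymm 1 2
  have c2 := hsymm 1 3
  have c3 := hsymm 2 3
  fin_cases a <;> fin_cases b <;> fin_cases c <;>
    simp [extD2, electric, h1, h2, pd_const, h0, c1, c2, c3]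

/-- For static `u`, `d(⋆₃ u)` is the divergence of `u` times the spatial volume form. -/
theorem extD2_magnetic {d : Fin 4 → Fin 4 → ℝ} (hd : ∀ b, HasPd (fun q => u q b) (d b) p)
    (hdiv : d 1 1 + d 2 2 + d 3 3 = 0) (h0 : ∀ b, d b 0 = 0) (a b c : Fin 4) :
    extD2 (fun q => magnetic (u q)) p a b c = 0 := by
  have h1 := fun i j => (hd i).2 j
  have h2 := fun i j => (hd i).neg.2 j
  fin_cases a <;> fin_cases b <;> fin_cases c <;>
    simp [extD2, magnetic, h1, h2, pd_const, h0] <;> linarith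

end Closed

/-! ## The field equations -/

/-- A static function whose square is harmonic. -/
structure IsHarmonicRoot (M : Set (Fin 4 → ℝ)) (A : (Fin 4 → ℝ) → ℝ) : Prop extends IsStatic M A where
  harmonic : ∀ p ∈ M, A p * (∑ a, pd a (pd a A) p) + ∑ a, pd a A p ^ 2 = 0

section Root

variable {S : Set (Fin 3 → ℝ)} {f : (Fin 3 → ℝ) → ℝ}

theorem pd_pd_spatial_succ (hS : IsOpen S) (hf : ContDiffOn ℝ ∞ f S) {p : Fin 4 → ℝ}
    (hp : spatial p ∈ S) (i j : Fin 3) :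
    pd i.succ (pd j.succ fun q => f (spatial q)) p = pd i (pd j f) (spatial p) := by
  have hd : ∀ x ∈ S, ContDiffAt ℝ ∞ f x := fun x hx => hf.contDiffAt (hS.mem_nhds hx)
  rw [← pd_spatial_succ i ((hd _ hp).pd j).diff]
  exact pd_congr_of_isOpen (hS.preimage continuous_spatial) hp
    fun q hq => pd_spatial_succ j (hd _ hq).diff

theorem isStatic_sqrt (hS : IsOpen S) (hf : ContDiffOn ℝ ∞ f S) (hpos : ∀ x ∈ S, 0 < f x) :
    IsStatic (spatial ⁻¹' S) fun p => √(f (spatial p)) where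
  isOpen := hS.preimage continuous_spatial
  smooth := (contDiffOn_spatial hf).sqrt fun p hp => (hpos _ hp).ne'
  pos p hp := Real.sqrt_pos.2 (hpos _ hp)
  static p hp := by
    have hd : ContDiffAt ℝ ∞ f (spatial p) := hf.contDiffAt (hS.mem_nhds hp)
    have h1 : DifferentiableAt ℝ (fun q => f (spatial q)) p :=
      (hd.comp p contDiff_spatial.contDiffAt).diff
    rw [(h1.hasPd.sqrt (hpos _ hp).ne').2]
    beta_reduce
    rw [pd_spatial_zero hd.diff, zero_div]

/-- Half the Laplacian of `f = A²` is `A ΔA + |∇A|²`. -/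
theorem isHarmonicRoot_sqrt (hS : IsOpen S) (hf : ContDiffOn ℝ ∞ f S) (hpos : ∀ x ∈ S, 0 < f x)
    (hh : ∀ x ∈ S, ∑ k, pd k (pd k f) x = 0) :
    IsHarmonicRoot (spatial ⁻¹' S) fun p => √(f (spatial p)) where
  toIsStatic := isStatic_sqrt hS hf hpos
  harmonic p hp := by
    have h := isStatic_sqrt hS hf hpos
    set A : (Fin 4 → ℝ) → ℝ := fun p => √(f (spatial p)) with hA
    have h1 : ∀ a, ∀ q ∈ spatial ⁻¹' S, pd a (fun q => f (spatial q)) q = 2 * A q * pd a A q := by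
      intro a q hq
      have e : (fun q => f (spatial q)) =ᶠ[𝓝 q] fun q => A q ^ 2 :=
        eventually_of_mem (h.isOpen.mem_nhds hq) fun x hx => (Real.sq_sqrt (hpos _ hx).le).symm
      rw [pd_congr e, ((h.hasPd hq).pow 2).2]
      norm_num
    have h2 : ∀ a, pd a (pd a fun q => f (spatial q)) p
        = 2 * pd a A p * pd a A p + 2 * A p * pd a (pd a A) p := by
      intro a
      rw [pd_congr_of_isOpen h.isOpen hp (h1 a),
        (((h.hasPd hp).const_mul 2).mul (h.hasPd_pd hp a)).2]
    have h3 := hh _ hp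
    simp only [← pd_pd_spatial_succ hS hf hp, h2] at h3
    rw [Fin.sum_univ_three] at h3
    rw [Fin.sum_univ_four, Fin.sum_univ_four, h.static p hp, h.pd_zero_left hp]
    simp only [Fin.succ_zero_eq_one, Fin.succ_one_eq_two, Fin.reduceSucc] at h3
    linarith

end Root

section FieldEquations

variable {M : Set (Fin 4 → ℝ)} {A B : (Fin 4 → ℝ) → ℝ} {p : Fin 4 → ℝ}

namespace IsHarmonicRoot

theorem laplace (h : IsHarmonicRoot M A) (hp : p ∈ M) :
    A p * (pd 1 (pd 1 A) p + pd 2 (pd 2 A) p + pd 3 (pd 3 A) p)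
      + (pd 1 A p ^ 2 + pd 2 A p ^ 2 + pd 3 A p ^ 2) = 0 := by
  have := h.harmonic p hp
  rw [Fin.sum_univ_four, Fin.sum_univ_four, h.static p hp, h.pd_zero_left hp] at this
  linarith

/-- Insert `log s = log A + 3 log B` in the Ricci tensor. The first derivatives regroup into the
square of the gradient of `log A - log B`, which is the dilaton term, and the stress tensors of an
electric field along `∇A` and a magnetic field along `∇B`. -/
theorem einstein (hA : IsHarmonicRoot M A) (hB : IsHarmonicRoot M B) (hp : p ∈ M) (a b : Fin 4) :
    ricci (staticMetric fun q => A q * B q ^ 3) p a b =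
      (3 / 2) * ((pd a A p / A p - pd a B p / B p) * (pd b A p / A p - pd b B p / B p))
      + 2 * ((1 / 2) * (if a = b then ![((A p * B p ^ 3) ^ 2)⁻¹, 1, 1, 1] a else 0) *
          (pd 1 A p ^ 2 + pd 2 A p ^ 2 + pd 3 A p ^ 2) - pd a A p * pd b A p) / A p ^ 2
      + 6 * ((1 / 2) * (if a = b then ![((A p * B p ^ 3) ^ 2)⁻¹, 1, 1, 1] a else 0) *
          (pd 1 B p ^ 2 + pd 2 B p ^ 2 + pd 3 B p ^ 2) - pd a B p * pd b B p) / B p ^ 2 := by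
  have hA0 := (hA.pos p hp).ne'
  have hB0 := (hB.pos p hp).ne'
  have hs := hA.mul_pow_three hB.toIsStatic
  rw [ricci_staticMetric hs hp]
  set s : (Fin 4 → ℝ) → ℝ := fun q => A q * B q ^ 3 with hsdef
  have l : ∀ a, ∀ q ∈ M, pd a s q / s q = pd a A q / A q + 3 * (pd a B q / B q) := by
    intro a q hq
    have := (hA.pos q hq).ne'
    have := (hB.pos q hq).ne'
    rw [((hA.hasPd hq).mul ((hB.hasPd hq).pow 3)).2, hsdef]
    push_cast
    field_simp
  have l2 : ∀ a, pd a (pd a s) p / s p - (pd a s p / s p) ^ 2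
      = (pd a (pd a A) p / A p - (pd a A p / A p) ^ 2)
        + 3 * (pd a (pd a B) p / B p - (pd a B p / B p) ^ 2) := by
    intro a
    have h1 := (hs.hasPd_logDeriv hp a).2 a
    have h2 := ((hA.hasPd_logDeriv hp a).add ((hB.hasPd_logDeriv hp a).const_mul 3)).2 a
    rw [pd_congr_of_isOpen hs.isOpen hp (l a), h2] at h1
    have h0 := (hs.pos p hp).ne'
    calc _ = (pd a (pd a s) p * s p - pd a s p * pd a s p) / s p ^ 2 := by field_simp
      _ = _ := h1.symm.trans (by field_simp)
  have la := hA.laplace hp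
  have lb := hB.laplace hp
  rw [Finset.sum_congr rfl fun a _ => l2 a, l a p hp, l b p hp]
  -- This is `Δ log s`: harmonicity of `A²` gives `Δ log A = -2|∇A|²/A²`, and similarly for `B`.
  have key : ∑ a, ((pd a (pd a A) p / A p - (pd a A p / A p) ^ 2)
        + 3 * (pd a (pd a B) p / B p - (pd a B p / B p) ^ 2))
      = -2 * (pd 1 A p ^ 2 + pd 2 A p ^ 2 + pd 3 A p ^ 2) / A p ^ 2
        - 6 * (pd 1 B p ^ 2 + pd 2 B p ^ 2 + pd 3 B p ^ 2) / B p ^ 2 := by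
    rw [Fin.sum_univ_four, hA.static p hp, hA.pd_zero_left hp, hB.static p hp, hB.pd_zero_left hp]
    field_simp
    linear_combination B p ^ 2 * la + 3 * A p ^ 2 * lb
  rw [key]
  generalize (if a = b then ![(s p ^ 2)⁻¹, 1, 1, 1] a else 0) = τ
  field_simp
  ring

theorem dilaton (hA : IsHarmonicRoot M A) (hB : IsHarmonicRoot M B) (hp : p ∈ M)
    {Φ : (Fin 4 → ℝ) → ℝ} (hΦ : ∀ q, Φ q = -√3 * (Real.log (A q) - Real.log (B q))) :
    divGrad (staticMetric fun q => A q * B q ^ 3) (fun _ => 1) Φ p =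
      √3 * (A p * B p ^ 3)⁻¹ * (2 * (pd 1 A p ^ 2 + pd 2 A p ^ 2 + pd 3 A p ^ 2) / A p ^ 2
        - 2 * (pd 1 B p ^ 2 + pd 2 B p ^ 2 + pd 3 B p ^ 2) / B p ^ 2) := by
  obtain rfl : Φ = fun q => -√3 * (Real.log (A q) - Real.log (B q)) := funext hΦ
  have hs := hA.mul_pow_three hB.toIsStatic
  set s : (Fin 4 → ℝ) → ℝ := fun q => A q * B q ^ 3 with hsdef
  have hA0 := (hA.pos p hp).ne'
  have hB0 := (hB.pos p hp).ne'
  have hgrad : ∀ q ∈ M, HasPd (fun q => -√3 * (Real.log (A q) - Real.log (B q)))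
      (fun a => -√3 * (pd a A q / A q - pd a B q / B q)) q := fun q hq =>
    (((hA.hasPd hq).log (hA.pos q hq).ne').sub ((hB.hasPd hq).log (hB.pos q hq).ne')).const_mul _
  -- On spatial indices `√|det g| g^{ab}` is the identity matrix, so the wave operator on static
  -- functions is `s⁻¹` times the flat Laplacian. In the time direction both sides vanish.
  have inner : ∀ a, ∀ q ∈ M, √|(staticMetric s q).det| * 1 * ∑ b, (staticMetric s q)⁻¹ a b *
      pd b (fun q => -√3 * (Real.log (A q) - Real.log (B q))) q
      = -√3 * (pd a A q / A q - pd a B q / B q) := by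
    intro a q hq
    have h0 := (hs.pos q hq).ne'
    rw [det_staticMetric (hs.pos q hq), inv_staticMetric (hs.pos q hq)]
    simp only [(hgrad q hq).2, Matrix.diagonal_apply, ite_mul, zero_mul, Finset.sum_ite_eq,
      Finset.mem_univ, if_true]
    have z1 := hA.static q hq
    have z2 := hB.static q hq
    fin_cases a <;> simp [staticInv, z1, z2, h0]
  have hd : ∀ a, pd a (fun q => -√3 * (pd a A q / A q - pd a B q / B q)) p = _ := fun a =>
    (((hA.hasPd_logDeriv hp a).sub (hB.hasPd_logDeriv hp a)).const_mul _).2 a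
  rw [divGrad, det_staticMetric (hs.pos p hp)]
  simp only [fun a => pd_congr_of_isOpen (a := a) hs.isOpen hp (inner a), hd]
  have la := hA.laplace hp
  have lb := hB.laplace hp
  rw [Fin.sum_univ_four, hA.static p hp, hA.pd_zero_left hp, hB.static p hp, hB.pd_zero_left hp,
    hsdef]
  beta_reduce
  field_simp
  linear_combination (-B p ^ 2) * la + A p ^ 2 * lb

end IsHarmonicRoot

end FieldEquations

theorem pullback2_spatial_star3d {f : (Fin 3 → ℝ) → ℝ} (κ : ℝ) {p : Fin 4 → ℝ}
    (hf : DifferentiableAt ℝ f (spatial p)) :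
    pullback2 spatial (fun x => κ • star3d f x) p =
      κ • magnetic fun a => pd a (fun q => f (spatial q)) p := by
  have h := fun i : Fin 3 => pd_spatial_succ i hf
  have h1 : pd 1 (fun q => f (spatial q)) p = _ := h 0
  have h2 : pd 2 (fun q => f (spatial q)) p = _ := h 1
  have h3 : pd 3 (fun q => f (spatial q)) p = _ := h 2
  ext a b
  simp only [pullback2, star3d_eq, jac_spatial, Matrix.of_apply, magnetic]
  fin_cases a <;> fin_cases b <;> simp [Fin.sum_univ_three, h1, h2, h3]

theorem magnetic_smul (k : ℝ) (u : Fin 4 → ℝ) : magnetic (k • u) = k • magnetic u := by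
  ext a b; fin_cases a <;> fin_cases b <;> simp [magnetic]

theorem electric_smul (k : ℝ) (u : Fin 4 → ℝ) : electric (k • u) = k • electric u := by
  ext a b; fin_cases a <;> fin_cases b <;> simp [electric]

theorem wedge11_single (u : Fin 4 → ℝ) (hu : u 0 = 0) :
    wedge11 (Pi.single 0 1) u = electric u := by
  ext a b; fin_cases a <;> fin_cases b <;> simp [electric, wedge11, hu]

theorem extD2_congr {n : ℕ} {w z : Cov2 n} {S : Set (Fin n → ℝ)} (hS : IsOpen S) {p : Fin n → ℝ}
    (hp : p ∈ S) (h : ∀ q ∈ S, w q = z q) (a b c : Fin n) : extD2 w p a b c = extD2 z p a b c := by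
  have e : ∀ i j k, pd i (fun q => w q j k) p = pd i (fun q => z q j k) p := fun i j k =>
    pd_congr_of_isOpen hS hp fun q hq => by rw [h q hq]
  simp only [extD2, e]

/-- A harmonic pair `𝒬 < 0 < 𝒢` yields a solution, provided that `⋆₃ d𝒢` has local potentials. -/
theorem nullFields4_isSolution {S : Set (Fin 3 → ℝ)} {𝒢 𝒬 : (Fin 3 → ℝ) → ℝ} (hS : IsOpen S)
    (hGs : ContDiffOn ℝ ∞ 𝒢 S) (hQs : ContDiffOn ℝ ∞ 𝒬 S) (hG : ∀ x, 0 < 𝒢 x) (hQ : ∀ x, 𝒬 x < 0)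
    (hGh : ∀ x ∈ S, ∑ k, pd k (pd k 𝒢) x = 0) (hQh : ∀ x ∈ S, ∑ k, pd k (pd k 𝒬) x = 0)
    (hpot : ∀ p ∈ spatial ⁻¹' S, ∃ U : Set (Fin 4 → ℝ), IsOpen U ∧ p ∈ U ∧ U ⊆ spatial ⁻¹' S ∧
      ∃ A : Cov1 4, A.SmoothOn U ∧ ∀ x ∈ U, (nullFields4 𝒢 𝒬).F x = extD1 A x) (σ : ℝ) :
    IsSolution4 σ (spatial ⁻¹' S) (nullFields4 𝒢 𝒬) := by
  set A : (Fin 4 → ℝ) → ℝ := fun p => √(-𝒬 (spatial p)) with hAdef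
  set B : (Fin 4 → ℝ) → ℝ := fun p => √(𝒢 (spatial p)) with hBdef
  have hA : IsHarmonicRoot (spatial ⁻¹' S) A := by
    refine isHarmonicRoot_sqrt (f := fun x => -𝒬 x) hS hQs.neg
      (fun x _ => neg_pos.2 (hQ x)) fun x hx => ?_
    have hx' := fun y hy => (hQs.contDiffAt (hS.mem_nhds (x := y) hy))
    have : ∀ k, pd k (pd k fun x => -𝒬 x) x = -pd k (pd k 𝒬) x := fun k => by
      rw [pd_congr_of_isOpen hS hx fun y hy => (hx' y hy).diff.hasPd.neg.2 k,
        (((hx' x hx).pd k).diff.hasPd.neg).2 k]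
    simp only [this, Finset.sum_neg_distrib, hQh x hx, neg_zero]
  have hB : IsHarmonicRoot (spatial ⁻¹' S) B :=
    isHarmonicRoot_sqrt hS hGs (fun x _ => hG x) hGh
  set X := nullFields4 𝒢 𝒬 with hX
  have hMo := hA.isOpen
  set s : (Fin 4 → ℝ) → ℝ := fun q => A q * B q ^ 3 with hsdef
  have hs : IsStatic (spatial ⁻¹' S) s := hA.mul_pow_three hB.toIsStatic
  have hA0 : ∀ q, 0 < A q := fun q => Real.sqrt_pos.2 (neg_pos.2 (hQ _))
  have hB0 : ∀ q, 0 < B q := fun q => Real.sqrt_pos.2 (hG _)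
  have hs0 : ∀ q, 0 < s q := fun q => mul_pos (hA0 q) (pow_pos (hB0 q) 3)
  have h3 : √(3 : ℝ) ≠ 0 := by positivity
  have h33 : √(3 : ℝ) ^ 2 = 3 := Real.sq_sqrt (by norm_num)
  have hΦ : ∀ q, X.Φ q = -√3 * (Real.log (A q) - Real.log (B q)) := fun q =>
    nullFields4_dilaton (hG _) (hQ _)
  have e1 : ∀ q, Real.exp (-X.Φ q / √3) = A q / B q := fun q => by
    rw [exp_dilaton (hA0 q) (hB0 q) 1 (by rw [hΦ]; field_simp; push_cast; ring), pow_one]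
  have e3 : ∀ q, Real.exp (-√3 * X.Φ q) = (A q / B q) ^ 3 := fun q =>
    exp_dilaton (hA0 q) (hB0 q) 3 (by
      rw [hΦ]; push_cast
      linear_combination (Real.log (A q) - Real.log (B q)) * h33)
  have hg : X.g = staticMetric s := by
    funext q
    simp only [hX, nullFields4, nullFields4_conformal (hG (spatial q)) (hQ (spatial q)),
      staticMetric, hsdef, hAdef, hBdef]
  have hρ : X.ρ = fun _ => 0 := rfl
  have hρ' : ∀ a q, pd a X.ρ q = 0 := fun a q => pd_const a 0
  -- Here and for `G` below, `𝒢 = B²` and `𝒬 = -A²` express the field strengths through the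
  -- gradients of the roots.
  have hF : ∀ q ∈ spatial ⁻¹' S, X.F q = (√3 * B q) • magnetic fun a => pd a B q := by
    intro q hq
    have h1 := pullback2_spatial_star3d (√3 / 2) (hGs.contDiffAt (hS.mem_nhds hq)).diff
    have h2 : (fun q => 𝒢 (spatial q)) = fun q => B q ^ 2 :=
      funext fun q => (Real.sq_sqrt (hG _).le).symm
    have h4 : (fun a => pd a (fun q => 𝒢 (spatial q)) q) = (2 * B q) • fun a => pd a B q := by
      funext a
      rw [h2, ((hB.hasPd hq).pow 2).2]; simp
    change pullback2 spatial (fun x => (√3 / 2) • star3d 𝒢 x) q = _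
    rw [h1, h4, magnetic_smul, smul_smul]
    congr 1; ring
  have hGf : ∀ q ∈ spatial ⁻¹' S, X.G q = (-2 / A q ^ 3) • electric fun a => pd a A q := by
    intro q hq
    have h2 : (fun q => 𝒬 (spatial q)) = fun q => -A q ^ 2 := funext fun q => by
      rw [Real.sq_sqrt (neg_pos.2 (hQ _)).le, neg_neg]
    have h4 : gradForm (fun q => 𝒬 (spatial q)) q = (-2 * A q) • fun a => pd a A q := by
      funext a
      rw [gradForm, h2, ((hA.hasPd hq).pow 2).neg.2]; simp
    have h5 : 𝒬 (spatial q) = -A q ^ 2 := congrFun h2 q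
    change (𝒬 (spatial q) ^ 2)⁻¹ • wedge11 (Pi.single 0 1) (gradForm (fun q => 𝒬 (spatial q)) q) = _
    rw [h4, wedge11_single _ (by simp [hA.static q hq]), electric_smul, smul_smul, h5]
    congr 1
    have := (hA0 q).ne'
    field_simp
  have hzA : ∀ q ∈ spatial ⁻¹' S, (fun a => pd a A q) 0 = 0 := hA.static
  have hzB : ∀ q ∈ spatial ⁻¹' S, (fun a => pd a B q) 0 = 0 := hB.static
  have dΦ : ∀ q ∈ spatial ⁻¹' S, ∀ a, pd a X.Φ q = -√3 * (pd a A q / A q - pd a B q / B q) := by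
    intro q hq a
    rw [show X.Φ = _ from funext hΦ]
    exact ((((hA.hasPd hq).log (hA0 q).ne').sub ((hB.hasPd hq).log (hB0 q).ne')).const_mul _).2 a
  refine ⟨nullFields4_smoothOn hS hGs hQs (fun x _ => hG x) (fun x _ => hQ x),
    fun p _ => nullFields4_lorentzian (hG _) (hQ _), fun p hp => ?_, fun p hp a b => ?_,
    fun p hp => ?_, fun p hp => ?_, fun p hp a b c => ?_, fun p hp a b c => ?_⟩
  · obtain ⟨U, hU, hpU, hUM, A', hA', hAF⟩ := hpot p hp
    refine ⟨U, hU, hpU, hUM, A', kkPotential 𝒬, hA', fun a => (kkPotential_smoothOn hQs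
      (fun x _ => hQ x) a).mono hUM, fun x hx => ⟨?_, ?_⟩⟩
    · rw [hAF x hx]
      ext i j
      simp [wedge11, gradForm, hρ']
    · exact extD1_kkPotential ((contDiffOn_spatial hQs).contDiffAt (hMo.mem_nhds (hUM hx))).diff
        (hQ _)
  · rw [hg, hF p hp, hGf p hp, stress_electric (hs0 p) (hzA p hp), stress_magnetic (hs0 p) (hzB p hp),
      hA.einstein hB hp, e1, e3, dΦ p hp, dΦ p hp, hρ']
    have hA' := (hA0 p).ne'
    have hB' := (hB0 p).ne'
    simp only [hsdef]
    -- All terms contain the same diagonal matrix, so the equation is an identity in its entry and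
    -- needs no distinction of index pairs; what remains to be used is `√3² = 3`.
    generalize (if a = b then ![((A p * B p ^ 3) ^ 2)⁻¹, 1, 1, 1] a else 0) = τ
    field_simp
    linear_combination (-(pd a A p * B p - pd a B p * A p) * (pd b A p * B p - pd b B p * A p)
      - 4 * A p ^ 2 * (τ / 2 * (pd 1 B p ^ 2 + pd 2 B p ^ 2 + pd 3 B p ^ 2) - pd a B p * pd b B p)) * h33
  · rw [hg, hF p hp, hGf p hp, contr2_electric (hs0 p), contr2_magnetic (hs0 p),
      hA.dilaton hB hp hΦ, e1, e3]
    have hA' := (hA0 p).ne'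
    have hB' := (hB0 p).ne'
    have hz : gdot (staticMetric s p)⁻¹ (gradForm X.ρ p) (gradForm X.ρ p) = 0 := by
      simp [gdot, gradForm, hρ']
    rw [hz]
    simp only [hsdef]
    field_simp
    ring
  -- With `ρ = 0` the two sources have to vanish. `G` and `⋆F` are electric and `F` is magnetic, so
  -- both contractions are zero.
  · rw [hg, hF p hp, hGf p hp, contr2_electric_magnetic (hs0 p), hodge4_magnetic (hs0 p),
      contr2_magnetic_electric (hs0 p)]
    simp [divGrad, hρ', pd_const]
  · have hz : wedge12 (gradForm X.ρ p) (X.F p) a b c = 0 := by simp [wedge12, gradForm, hρ']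
    rw [hz, mul_zero]
    -- Up to a constant factor the right side is `dv ∧ d(B⁻²)`, a closed form.
    have hu : ∀ q ∈ spatial ⁻¹' S, Real.exp (-X.Φ q / √3) • hodge4 σ (X.g q) (X.F q)
        = electric ((√3 * σ) • fun b => pd b B q / B q ^ 3) := fun q hq => by
      have := (hA0 q).ne'
      have := (hB0 q).ne'
      rw [hg, hF q hq, hodge4_magnetic (hs0 q), e1, smul_smul, ← electric_smul]
      congr 1
      funext b
      simp only [Pi.smul_apply, smul_eq_mul, hsdef]
      field_simp
    have hext : extD2 (fun q => Real.exp (-X.Φ q / √3) • hodge4 σ (X.g q) (X.F q)) p a b c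
        = extD2 (fun q => electric ((√3 * σ) • fun b => pd b B q / B q ^ 3)) p a b c :=
      extD2_congr hMo hp hu a b c
    rw [hext]
    refine extD2_electric (fun b => ((hB.hasPd_pd hp b).div ((hB.hasPd hp).pow 3)
      (pow_ne_zero 3 (hB0 p).ne')).const_mul _) (fun a b => ?_) (fun b => ?_) a b c
    · rw [pd_comm a b (hB.contDiffAt hp)]; ring
    · rw [hB.pd_zero_left hp, hB.static p hp]; ring
  · have hz : wedge12 (gradForm X.ρ p) (hodge4 σ (X.g p) (X.F p)) a b c = 0 := by
      simp [wedge12, gradForm, hρ']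
    rw [hz, mul_zero]
    -- The right side is `σ ⋆₃ d(A²)`, which is closed because `A²` is harmonic.
    have hu : ∀ q ∈ spatial ⁻¹' S, Real.exp (-√3 * X.Φ q) • hodge4 σ (X.g q) (X.G q)
        = magnetic ((2 * σ) • fun b => A q * pd b A q) := fun q hq => by
      have := (hA0 q).ne'
      have := (hB0 q).ne'
      rw [hg, hGf q hq, hodge4_electric (hs0 q), e3, smul_smul, ← magnetic_smul]
      congr 1
      funext b
      simp only [Pi.smul_apply, smul_eq_mul, hsdef]
      field_simp
    have hext : extD2 (fun q => Real.exp (-√3 * X.Φ q) • hodge4 σ (X.g q) (X.G q)) p a b c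
        = extD2 (fun q => magnetic ((2 * σ) • fun b => A q * pd b A q)) p a b c :=
      extD2_congr hMo hp hu a b c
    rw [hext]
    refine extD2_magnetic (fun b => ((hA.hasPd hp).mul (hA.hasPd_pd hp b)).const_mul _) ?_
      (fun b => ?_) a b c
    · have := hA.laplace hp
      linear_combination 2 * σ * this
    · rw [hA.pd_zero_left hp, hA.static p hp]; ring

/-! ## The radial profile -/

section Profile

variable {δ : ℝ}

/-- A smooth increasing function with `profile δ ρ = ρ - δ` for `ρ ≤ 2 δ`, and `profile δ ρ = ρ` for
`ρ ≥ 3 δ`. -/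
noncomputable def profile (δ ρ : ℝ) : ℝ := ρ - δ + δ * Real.smoothTransition (ρ / δ - 2)

theorem profile_of_le (hδ : 0 < δ) {ρ : ℝ} (h : ρ ≤ 2 * δ) : profile δ ρ = ρ - δ := by
  rw [profile, Real.smoothTransition.zero_of_nonpos, mul_zero, add_zero]
  rw [sub_nonpos, div_le_iff₀ hδ]; exact h

theorem profile_of_ge (hδ : 0 < δ) {ρ : ℝ} (h : 3 * δ ≤ ρ) : profile δ ρ = ρ := by
  rw [profile, Real.smoothTransition.one_of_one_le]
  · ring
  · rw [le_sub_iff_add_le, le_div_iff₀ hδ]; linarith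

theorem contDiff_profile : ContDiff ℝ ∞ (profile δ) := by
  have h : ContDiff ℝ ∞ Real.smoothTransition := Real.smoothTransition.contDiff
  exact (contDiff_id.sub contDiff_const).add
    (contDiff_const.mul (h.comp ((contDiff_id.div_const δ).sub contDiff_const)))

/-- The derivative is `1` plus the derivative of the monotone transition function; the factors `δ`
and `1/δ` cancel. -/
theorem exists_hasDerivAt_profile (hδ : 0 < δ) (ρ : ℝ) : ∃ d, 0 < d ∧ HasDerivAt (profile δ) d ρ := by
  have h1 : DifferentiableAt ℝ Real.smoothTransition (ρ / δ - 2) :=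
    (Real.smoothTransition.contDiffAt (n := 1)).differentiableAt (by simp)
  have h2 : HasDerivAt (fun ρ => ρ / δ - 2) (1 / δ) ρ := ((hasDerivAt_id ρ).div_const δ).sub_const 2
  have h3 := (((hasDerivAt_id ρ).sub_const δ).add ((h1.hasDerivAt.comp ρ h2).const_mul δ))
  refine ⟨_, ?_, h3⟩
  have := Real.smoothTransition.monotone.deriv_nonneg (x := ρ / δ - 2)
  positivity

theorem strictMono_profile (hδ : 0 < δ) : StrictMono (profile δ) := by
  refine strictMono_of_deriv_pos fun ρ => ?_
  obtain ⟨d, hd, h⟩ := exists_hasDerivAt_profile hδ ρ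
  rwa [h.deriv]

theorem surjective_profile (hδ : 0 < δ) : Function.Surjective (profile δ) := by
  refine contDiff_profile.continuous.surjective ?_ ?_
  · exact tendsto_id.congr' (eventually_atTop.2 ⟨3 * δ, fun ρ h => (profile_of_ge hδ h).symm⟩)
  · exact (tendsto_atBot_add_const_right _ (-δ) tendsto_id).congr'
      (eventually_atBot.2 ⟨2 * δ, fun ρ h => (profile_of_le hδ h).symm⟩)

/-- The inverse of the radial profile. -/
noncomputable def profileInv (δ : ℝ) : ℝ → ℝ := Function.invFun (profile δ)

theorem profile_profileInv (hδ : 0 < δ) (r : ℝ) : profile δ (profileInv δ r) = r :=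
  Function.rightInverse_invFun (surjective_profile hδ) r

theorem profileInv_profile (hδ : 0 < δ) (ρ : ℝ) : profileInv δ (profile δ ρ) = ρ :=
  Function.leftInverse_invFun (strictMono_profile hδ).injective ρ

theorem contDiff_profileInv (hδ : 0 < δ) : ContDiff ℝ ∞ (profileInv δ) := by
  set e := ((strictMono_profile hδ).orderIsoOfSurjective _ (surjective_profile hδ)).toHomeomorph
  have he : profileInv δ = e.symm := by
    ext r
    apply (strictMono_profile hδ).injective
    rw [profile_profileInv hδ]
    exact (e.apply_symm_apply r).symm
  choose d hd h using fun ρ => exists_hasDerivAt_profile hδ ρ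
  rw [he]
  exact e.contDiff_symm_deriv (fun x => (hd x).ne') h contDiff_profile

theorem profileInv_of_ge (hδ : 0 < δ) {r : ℝ} (h : 3 * δ ≤ r) : profileInv δ r = r := by
  conv_lhs => rw [← profile_of_ge hδ h]
  exact profileInv_profile hδ r

theorem profileInv_lt (hδ : 0 < δ) {r : ℝ} (h : r < 4 * δ) : profileInv δ r < 4 * δ := by
  rw [← (strictMono_profile hδ).lt_iff_lt, profile_profileInv hδ, profile_of_ge hδ (by linarith)]
  exact h

theorem lt_profileInv (hδ : 0 < δ) {r : ℝ} (h : 0 < r) : δ < profileInv δ r := by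
  rw [← (strictMono_profile hδ).lt_iff_lt, profile_profileInv hδ, profile_of_le hδ (by linarith)]
  linarith

theorem profile_pos (hδ : 0 < δ) {ρ : ℝ} (h : δ < ρ) : 0 < profile δ ρ := by
  have := strictMono_profile hδ h
  rwa [profile_of_le hδ (by linarith), sub_self] at this

theorem profile_lt (hδ : 0 < δ) {ρ : ℝ} (h : ρ < 4 * δ) : profile δ ρ < 4 * δ := by
  have := strictMono_profile hδ h
  rwa [profile_of_ge hδ (show 3 * δ ≤ 4 * δ by linarith)] at this

end Profile

/-! ## Radial maps around separated centres -/

section RadialMap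

variable {N : ℕ} {a : Fin N → Fin 3 → ℝ} {δ : ℝ} {τ : ℝ → ℝ} {y : Fin 3 → ℝ}

/-- Centres are more than `10 δ` apart, so a point within `4 δ` of one is more than `6 δ` from the
others, where terms cut off at `3 δ` vanish. All sums over centres below have at most one active
term. -/
theorem sum_eq_of_near {E : Type*} [AddCommMonoid E] (hsep : ∀ i j, i ≠ j → 10 * δ < norm3 (a i - a j))
    {c : Fin N → (Fin 3 → ℝ) → E} (hc : ∀ i y, 3 * δ ≤ norm3 (y - a i) → c i y = 0) {i : Fin N}
    (hy : norm3 (y - a i) < 4 * δ) : ∑ k, c k y = c i y := by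
  refine Finset.sum_eq_single i (fun k _ hk => hc k y ?_) (by simp)
  have h1 := norm3_sub_le (a k) y (a i)
  have h2 := hsep k i hk
  rw [norm3_sub_comm (a k) y] at h1
  have h0 := norm3_nonneg (y - a i)
  linarith

theorem lt_norm3_of_near (hsep : ∀ i j, i ≠ j → 10 * δ < norm3 (a i - a j)) {i k : Fin N}
    (hk : k ≠ i) (hy : norm3 (y - a i) < 4 * δ) : 6 * δ < norm3 (y - a k) := by
  have h1 := norm3_sub_le (a k) y (a i)
  have h2 := hsep k i hk
  rw [norm3_sub_comm (a k) y] at h1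
  linarith

/-- The map that moves the points at distance `ρ` from a centre to the distance `τ ρ`. -/
noncomputable def radialMap (a : Fin N → Fin 3 → ℝ) (τ : ℝ → ℝ) (y : Fin 3 → ℝ) : Fin 3 → ℝ :=
  y + ∑ i, ((τ (norm3 (y - a i)) - norm3 (y - a i)) / norm3 (y - a i)) • (y - a i)

theorem radialMap_near (hsep : ∀ i j, i ≠ j → 10 * δ < norm3 (a i - a j))
    (hτ : ∀ ρ, 3 * δ ≤ ρ → τ ρ = ρ) {i : Fin N} (h0 : 0 < norm3 (y - a i))
    (hy : norm3 (y - a i) < 4 * δ) :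
    radialMap a τ y = a i + (τ (norm3 (y - a i)) / norm3 (y - a i)) • (y - a i) := by
  rw [radialMap, sum_eq_of_near hsep
    (c := fun i y => ((τ (norm3 (y - a i)) - norm3 (y - a i)) / norm3 (y - a i)) • (y - a i))
    (fun i y h => by rw [hτ _ h, sub_self, zero_div, zero_smul]) hy, sub_div, div_self h0.ne']
  ext k
  simp
  ring

theorem radialMap_far (hτ : ∀ ρ, 3 * δ ≤ ρ → τ ρ = ρ) (hy : ∀ i, 3 * δ ≤ norm3 (y - a i)) :
    radialMap a τ y = y := by
  rw [radialMap, Finset.sum_eq_zero, add_zero]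
  intro i _
  rw [hτ _ (hy i), sub_self, zero_div, zero_smul]

theorem norm3_radialMap_near (hsep : ∀ i j, i ≠ j → 10 * δ < norm3 (a i - a j))
    (hτ : ∀ ρ, 3 * δ ≤ ρ → τ ρ = ρ) {i : Fin N} (h0 : 0 < norm3 (y - a i))
    (hy : norm3 (y - a i) < 4 * δ) (hp : 0 < τ (norm3 (y - a i))) :
    norm3 (radialMap a τ y - a i) = τ (norm3 (y - a i)) := by
  rw [radialMap_near hsep hτ h0 hy, add_sub_cancel_left, norm3_smul, abs_of_pos (div_pos hp h0),
    div_mul_cancel₀ _ h0.ne']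

theorem contDiffAt_norm3_sub {b : Fin 3 → ℝ} (h : 0 < norm3 (y - b)) :
    ContDiffAt ℝ ∞ (fun y => norm3 (y - b)) y :=
  ContDiffAt.comp (g := norm3) y (contDiffAt_norm3 (norm3_pos.1 h)) (by fun_prop)

theorem contDiffAt_radialMap (hτ : ContDiff ℝ ∞ τ) (h0 : ∀ i, 0 < norm3 (y - a i)) :
    ContDiffAt ℝ ∞ (radialMap a τ) y := by
  refine contDiffAt_id.add (ContDiffAt.sum fun i _ => ?_)
  have hn := contDiffAt_norm3_sub (h0 i)
  exact (((hτ.contDiffAt.comp y hn).sub hn).div hn (h0 i).ne').smul (by fun_prop)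

/-- Every point is near exactly one centre or far from all of them. -/
theorem near_or_far (a : Fin N → Fin 3 → ℝ) (d : ℝ) (y : Fin 3 → ℝ) :
    (∃ i, norm3 (y - a i) < d) ∨ ∀ i, d ≤ norm3 (y - a i) := by
  by_cases h : ∃ i, norm3 (y - a i) < d
  · exact Or.inl h
  · push Not at h; exact Or.inr h

/-- Near a centre the map preserves the direction and acts on the distance by `τ`, so the
composition acts by `τ' ∘ τ`. The bound `hlt` keeps the image in the ball in which only this centre
is felt. -/
theorem radialMap_radialMap (hδ : 0 < δ) (hsep : ∀ i j, i ≠ j → 10 * δ < norm3 (a i - a j))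
    (hτ : ∀ ρ, 3 * δ ≤ ρ → τ ρ = ρ) {τ' : ℝ → ℝ} (hτ' : ∀ ρ, 3 * δ ≤ ρ → τ' ρ = ρ)
    (hinv : ∀ ρ, τ' (τ ρ) = ρ) (hlt : ∀ ρ, ρ < 4 * δ → τ ρ < 4 * δ) (h0 : ∀ i, 0 < norm3 (y - a i))
    (hp : ∀ i, 0 < τ (norm3 (y - a i))) : radialMap a τ' (radialMap a τ y) = y := by
  rcases near_or_far a (4 * δ) y with ⟨i, hi⟩ | h
  · have h1 := norm3_radialMap_near hsep hτ (h0 i) hi (hp i)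
    rw [radialMap_near hsep hτ' (h1 ▸ hp i) (h1 ▸ hlt _ hi), h1, hinv,
      radialMap_near hsep hτ (h0 i) hi, add_sub_cancel_left, smul_smul,
      div_mul_div_cancel₀ (hp i).ne', div_self (h0 i).ne', one_smul, add_sub_cancel]
  · have h' : ∀ i, 3 * δ ≤ norm3 (y - a i) := fun i => by linarith [h i]
    rw [radialMap_far hτ h', radialMap_far hτ' h']

end RadialMap

/-! ## The regular part of a multi-centred harmonic function at a centre -/

section Rest

variable {N : ℕ}

/-- The harmonic function without the contribution of the centre `a i`. -/
noncomputable def restCentre (c : ℝ) (m : Fin N → ℝ) (a : Fin N → Fin 3 → ℝ) (i : Fin N)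
    (x : Fin 3 → ℝ) : ℝ :=
  c + ∑ k ∈ Finset.univ.erase i, m k / norm3 (x - a k)

/-- The difference quotient of `restCentre` along the ray from `a i` in the direction `n`. -/
noncomputable def restSlope (m : Fin N → ℝ) (a : Fin N → Fin 3 → ℝ) (i : Fin N) (r : ℝ)
    (n : Fin 3 → ℝ) : ℝ :=
  ∑ k ∈ Finset.univ.erase i, m k * (-(2 * ((a i - a k) ⬝ᵥ n) + r) /
    (norm3 (a i + r • n - a k) * norm3 (a i - a k) *
      (norm3 (a i - a k) + norm3 (a i + r • n - a k))))

variable {c : ℝ} {m : Fin N → ℝ} {a : Fin N → Fin 3 → ℝ} {i : Fin N} {x : Fin 3 → ℝ}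

theorem multiCentre_eq_restCentre (c : ℝ) (m : Fin N → ℝ) (a : Fin N → Fin 3 → ℝ) (i : Fin N)
    (x : Fin 3 → ℝ) : multiCentre c m a x = m i / norm3 (x - a i) + restCentre c m a i x := by
  rw [multiCentre, restCentre, ← Finset.add_sum_erase _ _ (Finset.mem_univ i)]
  ring

theorem contDiffAt_restCentre (hx : ∀ k, k ≠ i → x ≠ a k) :
    ContDiffAt ℝ ∞ (restCentre c m a i) x := by
  unfold restCentre
  simp only [div_eq_mul_inv]
  exact contDiffAt_const.add (ContDiffAt.sum fun k hk =>
    contDiffAt_const.mul (contDiffAt_inv_norm3_sub (hx k (Finset.ne_of_mem_erase hk))))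

theorem norm3_add_smul_sq (d n : Fin 3 → ℝ) (r : ℝ) :
    norm3 (d + r • n) ^ 2 = norm3 d ^ 2 + 2 * r * (d ⬝ᵥ n) + r ^ 2 * norm3 n ^ 2 := by
  simp only [norm3_sq, dotProduct, Fin.sum_univ_three, Pi.add_apply, Pi.smul_apply, smul_eq_mul]
  ring

/-- Write `1/|d + r n| - 1/|d|` with the numerator `|d|² - |d + r n|²`, which is divisible by `r`.
The division being carried out algebraically, `restSlope` stays smooth at `r = 0`. -/
theorem restCentre_radial {r : ℝ} {n : Fin 3 → ℝ} (hn : norm3 n = 1)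
    (h0 : ∀ k, k ≠ i → a i ≠ a k) (hx : ∀ k, k ≠ i → a i + r • n ≠ a k) :
    restCentre c m a i (a i + r • n) = restCentre c m a i (a i) + r * restSlope m a i r n := by
  rw [restCentre, restCentre, restSlope, add_assoc, Finset.mul_sum, ← Finset.sum_add_distrib]
  congr 1
  refine Finset.sum_congr rfl fun k hk => ?_
  have hk' := Finset.ne_of_mem_erase hk
  have d0 := norm3_pos.2 (sub_ne_zero.2 (h0 k hk'))
  have d1 := norm3_pos.2 (sub_ne_zero.2 (hx k hk'))
  have hsq := norm3_add_smul_sq (a i - a k) n r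
  have e : a i - a k + r • n = a i + r • n - a k := by abel
  rw [e, hn] at hsq
  have d2 : norm3 (a i - a k) + norm3 (a i + r • n - a k) ≠ 0 := by positivity
  field_simp
  linear_combination (-m k) * hsq

end Rest

/-! ## The parameters of the construction -/

/-- The data of a multi-centred solution, with `𝒬 < 0` written as `-multiCentre Q₀ q a`, together with
a length `δ` that is small compared with all the scales of the solution. -/
structure CentreData (N : ℕ) where
  G₀ : ℝ
  Q₀ : ℝ
  γ : Fin N → ℝ
  q : Fin N → ℝ
  a : Fin N → Fin 3 → ℝ
  δ : ℝ
  G₀_pos : 0 < G₀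
  Q₀_pos : 0 < Q₀
  γ_pos : ∀ i, 0 < γ i
  q_pos : ∀ i, 0 < q i
  δ_pos : 0 < δ
  sep : ∀ i j, i ≠ j → 10 * δ < norm3 (a i - a j)
  near_q : ∀ i x r, norm3 (x - a i) ≤ δ → |r| ≤ δ → 0 < q i + r * restCentre Q₀ q a i x
  near_γ : ∀ i x r, norm3 (x - a i) ≤ δ → |r| ≤ δ → 0 < γ i + r * restCentre G₀ γ a i x
  near_φ : ∀ i r, |r| ≤ δ → 0 < √(q i * γ i ^ 3) +
    (restCentre Q₀ q a i (a i) * γ i ^ 3 + 3 * q i * γ i ^ 2 * restCentre G₀ γ a i (a i))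
      / (2 * √(q i * γ i ^ 3)) * r

/-! ### Regular functions near one horizon component -/

namespace CentreData

variable {N : ℕ} (D : CentreData N) (i : Fin N) (y : Fin 3 → ℝ)

/-- The function `𝒢`. -/
noncomputable def calG : (Fin 3 → ℝ) → ℝ := multiCentre D.G₀ D.γ D.a

/-- The function `𝒬`. -/
noncomputable def calQ : (Fin 3 → ℝ) → ℝ := fun x => -multiCentre D.Q₀ D.q D.a x

/-- The distance to the horizon, negative inside. -/
noncomputable def rad : ℝ := norm3 (y - D.a i) - D.δ

/-- The direction from the centre. -/
noncomputable def dir : Fin 3 → ℝ := (norm3 (y - D.a i))⁻¹ • (y - D.a i)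

/-- The map that collapses the horizon to the centre. -/
noncomputable def chi : Fin 3 → ℝ := D.a i + D.rad i y • D.dir i y

/-- The regular part of `-𝒬`. -/
noncomputable def hh : ℝ := restCentre D.Q₀ D.q D.a i (D.chi i y)

/-- The regular part of `𝒢`. -/
noncomputable def kk : ℝ := restCentre D.G₀ D.γ D.a i (D.chi i y)

/-- `-r 𝒬`. -/
noncomputable def regQ : ℝ := D.q i + D.rad i y * D.hh i y

/-- `r 𝒢`. -/
noncomputable def regG : ℝ := D.γ i + D.rad i y * D.kk i y

/-- `r² √(-𝒬𝒢³)`. -/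
noncomputable def regS : ℝ := √(D.regQ i y * D.regG i y ^ 3)

/-- The value of `regS` at the horizon. -/
noncomputable def coef₀ : ℝ := √(D.q i * D.γ i ^ 3)

/-- The radial derivative of `regS` at the horizon. -/
noncomputable def coef₁ : ℝ := (restCentre D.Q₀ D.q D.a i (D.a i) * D.γ i ^ 3 +
  3 * D.q i * D.γ i ^ 2 * restCentre D.G₀ D.γ D.a i (D.a i)) / (2 * D.coef₀ i)

/-- The first-order Taylor polynomial of `regS`. -/
noncomputable def phi : ℝ := D.coef₀ i + D.coef₁ i * D.rad i y

/-- The regular quotient `(regS² - phi²) / r²`. -/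
noncomputable def ee : ℝ :=
  3 * D.q i * D.γ i ^ 2 * restSlope D.γ D.a i (D.rad i y) (D.dir i y)
    + restSlope D.q D.a i (D.rad i y) (D.dir i y) * D.γ i ^ 3
    + 3 * D.q i * D.γ i * D.kk i y ^ 2 + 3 * D.γ i ^ 2 * D.hh i y * D.kk i y
    + D.rad i y * (D.q i * D.kk i y ^ 3 + 3 * D.γ i * D.hh i y * D.kk i y ^ 2)
    + D.rad i y ^ 2 * D.hh i y * D.kk i y ^ 3 - D.coef₁ i ^ 2

/-- The punctured ball around a centre. -/
def shell : Set (Fin 3 → ℝ) := {y | 0 < norm3 (y - D.a i) ∧ norm3 (y - D.a i) < 4 * D.δ}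

/-- A neighbourhood of a horizon component. -/
def collar : Set (Fin 3 → ℝ) := {y | D.δ / 2 < norm3 (y - D.a i) ∧ norm3 (y - D.a i) < 2 * D.δ}

/-- The image of the exterior region. -/
def ext : Set (Fin 3 → ℝ) := {y | ∀ i, D.δ < norm3 (y - D.a i)}

/-- The extended region. -/
def extended : Set (Fin 3 → ℝ) := {y | ∀ i, D.δ / 2 < norm3 (y - D.a i)}

theorem continuous_dist : Continuous fun y => norm3 (y - D.a i) :=
  continuous_norm3.comp (continuous_id.sub continuous_const)

theorem isOpen_collar : IsOpen (D.collar i) :=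
  (isOpen_lt continuous_const (D.continuous_dist i)).inter
    (isOpen_lt (D.continuous_dist i) continuous_const)

theorem isOpen_ext : IsOpen D.ext := by
  have : D.ext = ⋂ i, {y | D.δ < norm3 (y - D.a i)} := by ext; simp [ext]
  rw [this]
  exact isOpen_iInter_of_finite fun i => isOpen_lt continuous_const (D.continuous_dist i)

theorem isOpen_extended : IsOpen D.extended := by
  have : D.extended = ⋂ i, {y | D.δ / 2 < norm3 (y - D.a i)} := by ext; simp [extended]
  rw [this]
  exact isOpen_iInter_of_finite fun i => isOpen_lt continuous_const (D.continuous_dist i)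

theorem injective_centre {i k : Fin N} (h : k ≠ i) : D.a i ≠ D.a k := by
  intro h'
  have := D.sep k i h
  rw [h', sub_self, norm3_zero] at this
  linarith [D.δ_pos]

variable {D i y}

theorem collar_subset_shell : D.collar i ⊆ D.shell i := fun y hy =>
  ⟨by linarith [hy.1, D.δ_pos], by linarith [hy.2, D.δ_pos]⟩

theorem norm3_dir (hy : y ∈ D.shell i) : norm3 (D.dir i y) = 1 := by
  rw [dir, norm3_smul, abs_of_pos (inv_pos.2 hy.1), inv_mul_cancel₀ hy.1.ne']

theorem dir_sq (hy : y ∈ D.shell i) :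
    D.dir i y 0 ^ 2 + D.dir i y 1 ^ 2 + D.dir i y 2 ^ 2 = 1 := by
  rw [← norm3_sq, norm3_dir hy, one_pow]

theorem norm3_chi_sub (hy : y ∈ D.shell i) : norm3 (D.chi i y - D.a i) = |D.rad i y| := by
  rw [chi, add_sub_cancel_left, norm3_smul, norm3_dir hy, mul_one]

theorem abs_rad_lt (hy : y ∈ D.shell i) : |D.rad i y| < 4 * D.δ := by
  have := D.δ_pos
  rw [rad, abs_lt]; constructor <;> linarith [hy.1, hy.2]

theorem abs_rad_le (hy : y ∈ D.collar i) : |D.rad i y| ≤ D.δ := by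
  have := D.δ_pos
  rw [rad, abs_le]; constructor <;> linarith [hy.1, hy.2]

theorem chi_ne (hy : y ∈ D.shell i) {k : Fin N} (hk : k ≠ i) : D.chi i y ≠ D.a k := by
  have h := lt_norm3_of_near (y := D.chi i y) D.sep hk ((norm3_chi_sub hy).trans_lt (abs_rad_lt hy))
  intro h'
  rw [h', sub_self, norm3_zero] at h
  linarith [D.δ_pos]

theorem regQ_pos (hy : y ∈ D.collar i) : 0 < D.regQ i y :=
  D.near_q i _ _ ((norm3_chi_sub (collar_subset_shell hy)).trans_le (abs_rad_le hy)) (abs_rad_le hy)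

theorem regG_pos (hy : y ∈ D.collar i) : 0 < D.regG i y :=
  D.near_γ i _ _ ((norm3_chi_sub (collar_subset_shell hy)).trans_le (abs_rad_le hy)) (abs_rad_le hy)

theorem regS_pos (hy : y ∈ D.collar i) : 0 < D.regS i y :=
  Real.sqrt_pos.2 (mul_pos (regQ_pos hy) (pow_pos (regG_pos hy) 3))

theorem phi_pos (hy : y ∈ D.collar i) : 0 < D.phi i y := D.near_φ i _ (abs_rad_le hy)

theorem coef₀_pos : 0 < D.coef₀ i := Real.sqrt_pos.2 (mul_pos (D.q_pos i) (pow_pos (D.γ_pos i) 3))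

/-- By `restCentre_radial` the direction enters `hh` and `kk` only at order `r`, hence the product
only at order `r²`. So its Taylor coefficients of order `0` and `1` are constants, and they match
those of `phi²`. For this reason a time shift depending on `r` alone regularises the metric. -/
theorem regQ_mul_regG (hy : y ∈ D.shell i) :
    D.regQ i y * D.regG i y ^ 3 = D.phi i y ^ 2 + D.rad i y ^ 2 * D.ee i y := by
  have h0 := D.coef₀_pos (i := i)
  have e0 : D.coef₀ i ^ 2 = D.q i * D.γ i ^ 3 :=
    Real.sq_sqrt (mul_pos (D.q_pos i) (pow_pos (D.γ_pos i) 3)).le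
  have e1 : 2 * D.coef₀ i * D.coef₁ i = restCentre D.Q₀ D.q D.a i (D.a i) * D.γ i ^ 3 +
      3 * D.q i * D.γ i ^ 2 * restCentre D.G₀ D.γ D.a i (D.a i) := by
    rw [coef₁]; field_simp
  have eh : D.hh i y = restCentre D.Q₀ D.q D.a i (D.a i)
      + D.rad i y * restSlope D.q D.a i (D.rad i y) (D.dir i y) :=
    restCentre_radial (norm3_dir hy) (fun k hk => D.injective_centre hk) fun k hk => chi_ne hy hk
  have ek : D.kk i y = restCentre D.G₀ D.γ D.a i (D.a i)
      + D.rad i y * restSlope D.γ D.a i (D.rad i y) (D.dir i y) :=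
    restCentre_radial (norm3_dir hy) (fun k hk => D.injective_centre hk) fun k hk => chi_ne hy hk
  rw [regQ, regG, phi, ee]
  linear_combination -e0 - D.rad i y * e1 + D.rad i y * D.γ i ^ 3 * eh
    + 3 * D.rad i y * D.q i * D.γ i ^ 2 * ek

theorem regS_sq (hy : y ∈ D.collar i) :
    D.regS i y ^ 2 = D.phi i y ^ 2 + D.rad i y ^ 2 * D.ee i y := by
  rw [regS, Real.sq_sqrt (mul_pos (regQ_pos hy) (pow_pos (regG_pos hy) 3)).le,
    regQ_mul_regG (collar_subset_shell hy)]

/-! ### Smoothness -/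

theorem contDiffAt_rad (hy : y ∈ D.shell i) : ContDiffAt ℝ ∞ (D.rad i) y :=
  (contDiffAt_norm3_sub hy.1).sub contDiffAt_const

theorem contDiffAt_dir (hy : y ∈ D.shell i) : ContDiffAt ℝ ∞ (D.dir i) y :=
  ((contDiffAt_norm3_sub hy.1).inv hy.1.ne').smul (by fun_prop)

theorem contDiffAt_chi (hy : y ∈ D.shell i) : ContDiffAt ℝ ∞ (D.chi i) y :=
  contDiffAt_const.add ((contDiffAt_rad hy).smul (contDiffAt_dir hy))

theorem contDiffAt_hh (hy : y ∈ D.shell i) : ContDiffAt ℝ ∞ (D.hh i) y :=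
  ContDiffAt.comp (g := restCentre D.Q₀ D.q D.a i) y
    (contDiffAt_restCentre fun _ hk => chi_ne hy hk) (contDiffAt_chi hy)

theorem contDiffAt_kk (hy : y ∈ D.shell i) : ContDiffAt ℝ ∞ (D.kk i) y :=
  ContDiffAt.comp (g := restCentre D.G₀ D.γ D.a i) y
    (contDiffAt_restCentre fun _ hk => chi_ne hy hk) (contDiffAt_chi hy)

theorem contDiffAt_regQ (hy : y ∈ D.shell i) : ContDiffAt ℝ ∞ (D.regQ i) y :=
  contDiffAt_const.add ((contDiffAt_rad hy).mul (contDiffAt_hh hy))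

theorem contDiffAt_regG (hy : y ∈ D.shell i) : ContDiffAt ℝ ∞ (D.regG i) y :=
  contDiffAt_const.add ((contDiffAt_rad hy).mul (contDiffAt_kk hy))

theorem contDiffAt_regS (hy : y ∈ D.collar i) : ContDiffAt ℝ ∞ (D.regS i) y :=
  ContDiffAt.sqrt ((contDiffAt_regQ (collar_subset_shell hy)).mul
    ((contDiffAt_regG (collar_subset_shell hy)).pow 3))
    (mul_pos (regQ_pos hy) (pow_pos (regG_pos hy) 3)).ne'

theorem contDiffAt_phi (hy : y ∈ D.shell i) : ContDiffAt ℝ ∞ (D.phi i) y :=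
  contDiffAt_const.add (contDiffAt_const.mul (contDiffAt_rad hy))

theorem contDiffAt_restSlope (hy : y ∈ D.shell i) (m : Fin N → ℝ) :
    ContDiffAt ℝ ∞ (fun y => restSlope m D.a i (D.rad i y) (D.dir i y)) y := by
  refine ContDiffAt.sum fun k hk => contDiffAt_const.mul ?_
  have hk' := Finset.ne_of_mem_erase hk
  have hr := contDiffAt_rad hy
  have hd : ∀ l, ContDiffAt ℝ ∞ (fun y => D.dir i y l) y := contDiffAt_pi.1 (contDiffAt_dir hy)
  have p0 := norm3_pos.2 (sub_ne_zero.2 (D.injective_centre hk'))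
  have p1 : 0 < norm3 (D.a i + D.rad i y • D.dir i y - D.a k) :=
    norm3_pos.2 (sub_ne_zero.2 (chi_ne hy hk'))
  have hn : ContDiffAt ℝ ∞ (fun y => norm3 (D.a i + D.rad i y • D.dir i y - D.a k)) y :=
    ContDiffAt.comp (g := fun x => norm3 (x - D.a k)) (f := D.chi i) y
      (contDiffAt_norm3_sub p1) (contDiffAt_chi hy)
  refine ContDiffAt.div ?_ ((hn.mul contDiffAt_const).mul (contDiffAt_const.add hn)) (by positivity)
  refine ((contDiffAt_const.mul ?_).add hr).neg
  exact ContDiffAt.sum fun l _ => contDiffAt_const.mul (hd l)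

theorem contDiffAt_ee (hy : y ∈ D.shell i) : ContDiffAt ℝ ∞ (D.ee i) y := by
  have h1 := contDiffAt_restSlope hy D.γ
  have h2 := contDiffAt_restSlope hy D.q
  have hr := contDiffAt_rad hy
  have hh := contDiffAt_hh hy
  have hk := contDiffAt_kk hy
  unfold ee
  fun_prop

/-- A bound on the slope of the time direction near the horizon. -/
theorem exists_slope (D : CentreData N) (i : Fin N) :
    ∃ κ : ℝ, 0 < κ ∧ ∀ y ∈ D.collar i, κ * |D.ee i y| ≤ D.phi i y := by
  have hδ := D.δ_pos
  set C : Set (Fin 3 → ℝ) := {y | D.δ / 2 ≤ norm3 (y - D.a i) ∧ norm3 (y - D.a i) ≤ 2 * D.δ}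
  have hCs : C ⊆ D.shell i := fun y hy => ⟨by linarith [hy.1], by linarith [hy.2]⟩
  have hCc : IsCompact C := by
    refine Metric.isCompact_of_isClosed_isBounded ((isClosed_le continuous_const
      (D.continuous_dist i)).inter (isClosed_le (D.continuous_dist i) continuous_const)) ?_
    refine (Metric.isBounded_iff_subset_closedBall (D.a i)).2 ⟨2 * D.δ, fun y hy => ?_⟩
    rw [mem_closedBall_iff_norm, pi_norm_le_iff_of_nonneg (by positivity)]
    exact fun k => (abs_le_norm3 (y - D.a i) k).trans hy.2
  obtain ⟨b, hb⟩ := hCc.exists_bound_of_continuousOn (f := D.ee i)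
    fun y hy => (contDiffAt_ee (hCs hy)).continuousAt.continuousWithinAt
  -- `phi` is affine in `rad`, so its minimum over `|rad| ≤ δ` is attained at an end point of the
  -- interval.
  set m := min (D.coef₀ i + D.coef₁ i * D.δ) (D.coef₀ i + D.coef₁ i * (-D.δ))
  have hm : 0 < m := lt_min (D.near_φ i _ (by rw [abs_of_pos hδ]))
    (D.near_φ i _ (by rw [abs_neg, abs_of_pos hδ]))
  refine ⟨m / (|b| + 1), by positivity, fun y hy => ?_⟩
  have h1 : |D.ee i y| ≤ |b| + 1 := (hb y ⟨hy.1.le, hy.2.le⟩).trans (by linarith [le_abs_self b])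
  have h2 : m ≤ D.phi i y := by
    have := abs_le.1 (abs_rad_le hy)
    rcases le_total 0 (D.coef₁ i) with h | h
    · exact (min_le_right _ _).trans (by rw [phi]; nlinarith)
    · exact (min_le_left _ _).trans (by rw [phi]; nlinarith)
  calc m / (|b| + 1) * |D.ee i y| ≤ m / (|b| + 1) * (|b| + 1) := by gcongr
    _ = m := by field_simp
    _ ≤ _ := h2

end CentreData

theorem eventually_pos_near {f : (Fin 3 → ℝ) × ℝ → ℝ} {b : Fin 3 → ℝ}
    (hf : ContinuousAt f (b, 0)) (h0 : 0 < f (b, 0)) :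
    ∀ᶠ δ in 𝓝[>] (0 : ℝ), ∀ x r, norm3 (x - b) ≤ δ → |r| ≤ δ → 0 < f (x, r) := by
  obtain ⟨ε, hε, h⟩ := Metric.eventually_nhds_iff.1 (hf.eventually (lt_mem_nhds h0))
  filter_upwards [Ioo_mem_nhdsGT hε] with δ hδ x r hx hr
  refine h ?_
  rw [Prod.dist_eq, max_lt_iff]
  refine ⟨?_, by rw [Real.dist_eq, sub_zero]; exact hr.trans_lt hδ.2⟩
  rw [dist_eq_norm, pi_norm_lt_iff hε]
  exact fun k => ((abs_le_norm3 (x - b) k).trans hx).trans_lt hδ.2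

/-- At `x = a i` and `r = 0` each required quantity is positive, so by continuity it stays positive
for all small `δ`; only finitely many conditions are involved. -/
theorem exists_centreData {N : ℕ} {G₀ Q₀ : ℝ} {γ q : Fin N → ℝ} {a : Fin N → Fin 3 → ℝ}
    (hG₀ : 0 < G₀) (hQ₀ : 0 < Q₀) (hγ : ∀ i, 0 < γ i) (hq : ∀ i, 0 < q i)
    (ha : Function.Injective a) :
    ∃ D : CentreData N, D.G₀ = G₀ ∧ D.Q₀ = Q₀ ∧ D.γ = γ ∧ D.q = q ∧ D.a = a := by
  have hsep : ∀ᶠ δ in 𝓝[>] (0 : ℝ), ∀ i j, i ≠ j → 10 * δ < norm3 (a i - a j) := by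
    simp only [eventually_all]
    intro i j hij
    have h : 0 < norm3 (a i - a j) / 10 := by
      have := norm3_pos.2 (sub_ne_zero.2 (ha.ne hij))
      positivity
    filter_upwards [Ioo_mem_nhdsGT h] with δ hδ
    linarith [hδ.2]
  have near : ∀ (c : ℝ) (m : Fin N → ℝ), (∀ i, 0 < m i) → ∀ᶠ δ in 𝓝[>] (0 : ℝ), ∀ i x r,
      norm3 (x - a i) ≤ δ → |r| ≤ δ → 0 < m i + r * restCentre c m a i x := by
    intro c m hm
    rw [eventually_all]
    intro i
    have hc : ContinuousAt (restCentre c m a i) (a i) :=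
      (contDiffAt_restCentre fun k hk => ha.ne hk.symm).continuousAt
    refine eventually_pos_near (f := fun z => m i + z.2 * restCentre c m a i z.1)
      (continuousAt_const.add (continuousAt_snd.mul ?_)) (by simpa using hm i)
    exact ContinuousAt.comp (f := Prod.fst) (x := (a i, (0 : ℝ))) hc continuousAt_fst
  have hφ : ∀ᶠ δ in 𝓝[>] (0 : ℝ), ∀ i r, |r| ≤ δ → 0 < √(q i * γ i ^ 3) +
      (restCentre Q₀ q a i (a i) * γ i ^ 3 + 3 * q i * γ i ^ 2 * restCentre G₀ γ a i (a i))
        / (2 * √(q i * γ i ^ 3)) * r := by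
    rw [eventually_all]
    intro i
    have h := eventually_pos_near (b := 0) (f := fun z => √(q i * γ i ^ 3) +
      (restCentre Q₀ q a i (a i) * γ i ^ 3 + 3 * q i * γ i ^ 2 * restCentre G₀ γ a i (a i))
        / (2 * √(q i * γ i ^ 3)) * z.2) (by fun_prop) (by
          simpa using mul_pos (hq i) (pow_pos (hγ i) 3))
    filter_upwards [h, self_mem_nhdsWithin] with δ hδ hpos r hr
    exact hδ 0 r (by rw [sub_zero, norm3_zero]; exact le_of_lt hpos) hr
  obtain ⟨δ, h1, h2, h3, h4, h5⟩ :=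
    (hsep.and ((near Q₀ q hq).and ((near G₀ γ hγ).and (hφ.and self_mem_nhdsWithin)))).exists
  exact ⟨⟨G₀, Q₀, γ, q, a, δ, hG₀, hQ₀, hγ, hq, h5, h1, h2, h3, h4⟩, rfl, rfl, rfl, rfl, rfl⟩

/-! ## Stationary maps -/

theorem spatial_cons (t : ℝ) (x : Fin 3 → ℝ) : spatial (Fin.cons t x : Fin 4 → ℝ) = x := by
  ext i; simp [spatial]

theorem cons_spatial (p : Fin 4 → ℝ) : (Fin.cons (p 0) (spatial p) : Fin 4 → ℝ) = p := by
  ext i; exact Fin.cases rfl (fun _ => rfl) i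

theorem HasPd.spatial {f : (Fin 3 → ℝ) → ℝ} {d : Fin 3 → ℝ} {p : Fin 4 → ℝ}
    (hf : HasPd f d (spatial p)) :
    HasPd (fun q => f (_root_.spatial q)) (Fin.cons 0 d : Fin 4 → ℝ) p := by
  refine ⟨hf.1.comp p (contDiff_spatial.contDiffAt.differentiableAt (by simp)), fun a => ?_⟩
  refine Fin.cases ?_ (fun i => ?_) a
  · exact pd_spatial_zero hf.1
  · rw [pd_spatial_succ i hf.1, hf.2, Fin.cons_succ]

/-- The map `(v, x) ↦ (v + f x, ψ x)`. -/
def stationaryMap (f : (Fin 3 → ℝ) → ℝ) (ψ : (Fin 3 → ℝ) → Fin 3 → ℝ) (p : Fin 4 → ℝ) : Fin 4 → ℝ :=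
  Fin.cons (p 0 + f (spatial p)) (ψ (spatial p))

section StationaryMap

variable {f : (Fin 3 → ℝ) → ℝ} {ψ : (Fin 3 → ℝ) → Fin 3 → ℝ} {p : Fin 4 → ℝ}

theorem spatial_stationaryMap : spatial (stationaryMap f ψ p) = ψ (spatial p) := spatial_cons _ _

theorem stationaryMap_zero : stationaryMap f ψ p 0 = p 0 + f (spatial p) := rfl

theorem contDiffAt_stationaryMap (hf : ContDiffAt ℝ ∞ f (spatial p))
    (hψ : ContDiffAt ℝ ∞ ψ (spatial p)) : ContDiffAt ℝ ∞ (stationaryMap f ψ) p := by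
  refine contDiffAt_pi.2 fun c => Fin.cases ?_ (fun k => ?_) c
  · exact ((contDiff_apply ℝ ℝ 0).contDiffAt).add (hf.comp p contDiff_spatial.contDiffAt)
  · exact (contDiffAt_pi.1 hψ k).comp p contDiff_spatial.contDiffAt

theorem hasPd_stationaryMap_zero {d : Fin 3 → ℝ} (hf : HasPd f d (spatial p)) :
    HasPd (fun q => stationaryMap f ψ q 0) (Fin.cons 1 d : Fin 4 → ℝ) p := by
  refine ((hasPd_coord 0).add hf.spatial).congr_deriv fun a => ?_
  refine Fin.cases ?_ (fun i => ?_) a <;> simp [Fin.succ_ne_zero]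

theorem hasPd_stationaryMap_succ {k : Fin 3} {d : Fin 3 → ℝ}
    (hψ : HasPd (fun x => ψ x k) d (spatial p)) :
    HasPd (fun q => stationaryMap f ψ q k.succ) (Fin.cons 0 d : Fin 4 → ℝ) p := hψ.spatial

theorem jac_stationaryMap_time (hf : DifferentiableAt ℝ f (spatial p))
    (hψ : DifferentiableAt ℝ ψ (spatial p)) (c : Fin 4) :
    jac (stationaryMap f ψ) p c 0 = (Pi.single 0 1 : Fin 4 → ℝ) c := by
  refine Fin.cases ?_ (fun k => ?_) c
  · rw [jac, (hasPd_stationaryMap_zero hf.hasPd).2]; simp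
  · rw [jac, (hasPd_stationaryMap_succ (differentiableAt_pi.1 hψ k).hasPd).2]; simp

theorem pullback2_staticMetric {s : (Fin 4 → ℝ) → ℝ} {f : Fin 4 → Fin 4 → ℝ}
    {φ : (Fin 4 → ℝ) → Fin 4 → ℝ} (h : ∀ c, HasPd (fun x => φ x c) (f c) p) (a b : Fin 4) :
    pullback2 φ (staticMetric s) p a b =
      -(s (φ p))⁻¹ * (f 0 a * f 0 b) + s (φ p) * ∑ k : Fin 3, f k.succ a * f k.succ b := by
  simp only [pullback2, jac_eq_of_hasPd h, staticMetric, Matrix.of_apply, Matrix.diagonal_apply,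
    mul_ite, mul_zero, Finset.sum_ite_eq, Finset.mem_univ, if_true]
  rw [Fin.sum_univ_four, Fin.sum_univ_three]
  simp
  ring

end StationaryMap

theorem pullback1_gradForm {m n : ℕ} {φ : (Fin m → ℝ) → Fin n → ℝ} {u : Fin m → ℝ}
    {f : (Fin n → ℝ) → ℝ} (hf : DifferentiableAt ℝ f (φ u)) (hφ : DifferentiableAt ℝ φ u)
    (a : Fin m) : ∑ c, jac φ u c a * gradForm f (φ u) c = pd a (fun x => f (φ x)) u :=
  ((hf.hasPd.comp_map hφ).2 a).symm

theorem pullback2_wedge11 {m n : ℕ} {φ : (Fin m → ℝ) → Fin n → ℝ} {u : Fin m → ℝ} {w : Cov2 n}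
    {k : ℝ} {α β : Fin n → ℝ} (hw : w (φ u) = k • wedge11 α β) :
    pullback2 φ w u = k • wedge11 (fun a => ∑ c, jac φ u c a * α c)
      (fun a => ∑ c, jac φ u c a * β c) := by
  ext a b
  simp only [pullback2, hw, Matrix.of_apply, Matrix.smul_apply, wedge11, smul_eq_mul]
  rw [Finset.sum_mul_sum, Finset.sum_mul_sum, Finset.sum_comm (f := fun i j => jac φ u i b * α i * _),
    ← Finset.sum_sub_distrib, Finset.mul_sum]
  refine Finset.sum_congr rfl fun c _ => ?_
  rw [← Finset.sum_sub_distrib, Finset.mul_sum]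
  exact Finset.sum_congr rfl fun d _ => by ring

theorem pullback2_congr {m n : ℕ} {φ ψ : (Fin m → ℝ) → Fin n → ℝ} {u : Fin m → ℝ} (w : Cov2 n)
    (h : φ =ᶠ[𝓝 u] ψ) : pullback2 φ w u = pullback2 ψ w u := by
  rw [pullback2_eq_mul, pullback2_eq_mul, jac_congr h, h.eq_of_nhds]

theorem pullback2_add {m n : ℕ} {φ : (Fin m → ℝ) → Fin n → ℝ} {u : Fin m → ℝ} {w w₁ w₂ : Cov2 n}
    (h : w (φ u) = w₁ (φ u) + w₂ (φ u)) : pullback2 φ w u = pullback2 φ w₁ u + pullback2 φ w₂ u := by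
  simp only [pullback2_eq_mul, h, Matrix.mul_add, Matrix.add_mul]

/-! ### The embedding of the exterior and its inverse -/

namespace CentreData

variable {N : ℕ} (D : CentreData N) (i : Fin N)

/-- The radial profile of the time shift. -/
noncomputable def shiftProfile (r : ℝ) : ℝ :=
  (-D.coef₀ i / r + D.coef₁ i * Real.log r) * (1 - Real.smoothTransition (r / D.δ - 1))

/-- The time shift to coordinates that are regular at the future horizon. -/
noncomputable def shift (x : Fin 3 → ℝ) : ℝ := ∑ i, D.shiftProfile i (norm3 (x - D.a i))

/-- The map that collapses all the horizon components. -/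
noncomputable def collapse : (Fin 3 → ℝ) → Fin 3 → ℝ := radialMap D.a (profile D.δ)

/-- The map that opens up the centres. -/
noncomputable def expand : (Fin 3 → ℝ) → Fin 3 → ℝ := radialMap D.a (profileInv D.δ)

/-- The embedding of the exterior region. -/
noncomputable def emb : (Fin 4 → ℝ) → Fin 4 → ℝ := stationaryMap D.shift D.expand

/-- The inverse of the embedding. -/
noncomputable def embInv : (Fin 4 → ℝ) → Fin 4 → ℝ :=
  stationaryMap (fun y => -D.shift (D.collapse y)) D.collapse

variable {D i} {x y : Fin 3 → ℝ} {p : Fin 4 → ℝ}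

theorem mem_punctured : x ∈ puncturedSpace D.a ↔ ∀ i, 0 < norm3 (x - D.a i) := by
  simp only [puncturedSpace, mem_ofPred_eq, norm3_pos, sub_ne_zero]

theorem profile_ge (ρ : ℝ) (h : 3 * D.δ ≤ ρ) : profile D.δ ρ = ρ := profile_of_ge D.δ_pos h

theorem profileInv_ge (ρ : ℝ) (h : 3 * D.δ ≤ ρ) : profileInv D.δ ρ = ρ := profileInv_of_ge D.δ_pos h

theorem collapse_expand (hx : x ∈ puncturedSpace D.a) : D.collapse (D.expand x) = x :=
  radialMap_radialMap D.δ_pos D.sep profileInv_ge profile_ge (profile_profileInv D.δ_pos)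
    (fun _ => profileInv_lt D.δ_pos) (mem_punctured.1 hx)
    fun i => D.δ_pos.trans (lt_profileInv D.δ_pos (mem_punctured.1 hx i))

theorem expand_collapse (hy : y ∈ D.ext) : D.expand (D.collapse y) = y :=
  radialMap_radialMap D.δ_pos D.sep profile_ge profileInv_ge (profileInv_profile D.δ_pos)
    (fun _ => profile_lt D.δ_pos) (fun i => D.δ_pos.trans (hy i))
    fun i => profile_pos D.δ_pos (hy i)

theorem expand_mem (hx : x ∈ puncturedSpace D.a) : D.expand x ∈ D.ext := by
  intro i
  have hδ := D.δ_pos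
  have h0 := mem_punctured.1 hx
  have hp := fun i => lt_profileInv hδ (h0 i)
  rcases near_or_far D.a (4 * D.δ) x with ⟨k, hk⟩ | h
  · have h1 : norm3 (D.expand x - D.a k) = _ :=
      norm3_radialMap_near D.sep profileInv_ge (h0 k) hk (hδ.trans (hp k))
    by_cases hik : i = k
    · subst hik; rw [h1]; exact hp i
    · have := lt_norm3_of_near D.sep hik (h1.trans_lt (profileInv_lt hδ hk))
      linarith
  · rw [expand, radialMap_far profileInv_ge fun i => by linarith [h i]]
    linarith [h i]

theorem collapse_mem (hy : y ∈ D.ext) : D.collapse y ∈ puncturedSpace D.a := by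
  rw [mem_punctured]
  intro i
  have hδ := D.δ_pos
  rcases near_or_far D.a (4 * D.δ) y with ⟨k, hk⟩ | h
  · have h1 : norm3 (D.collapse y - D.a k) = _ :=
      norm3_radialMap_near D.sep profile_ge (hδ.trans (hy k)) hk (profile_pos hδ (hy k))
    by_cases hik : i = k
    · subst hik; rw [h1]; exact profile_pos hδ (hy i)
    · have := lt_norm3_of_near D.sep hik (h1.trans_lt (profile_lt hδ hk))
      linarith
  · rw [collapse, radialMap_far profile_ge fun i => by linarith [h i]]
    linarith [h i]

theorem contDiffAt_shift (hx : x ∈ puncturedSpace D.a) : ContDiffAt ℝ ∞ D.shift x := by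
  refine ContDiffAt.sum fun i _ => ?_
  have h0 := mem_punctured.1 hx i
  have hn := contDiffAt_norm3_sub h0
  have hσ : ContDiff ℝ ∞ Real.smoothTransition := Real.smoothTransition.contDiff
  have h1 : ContDiffAt ℝ ∞ (fun x => Real.smoothTransition (norm3 (x - D.a i) / D.δ - 1)) x :=
    hσ.contDiffAt.comp x ((hn.div_const D.δ).sub contDiffAt_const)
  exact ((contDiffAt_const.div hn h0.ne').add (contDiffAt_const.mul (hn.log h0.ne'))).mul
    (contDiffAt_const.sub h1)

theorem contDiffAt_expand (hx : x ∈ puncturedSpace D.a) : ContDiffAt ℝ ∞ D.expand x :=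
  contDiffAt_radialMap (contDiff_profileInv D.δ_pos) (mem_punctured.1 hx)

theorem contDiffAt_collapse (hy : y ∈ D.extended) : ContDiffAt ℝ ∞ D.collapse y :=
  contDiffAt_radialMap contDiff_profile fun i => by linarith [hy i, D.δ_pos]

theorem ext_subset_extended : D.ext ⊆ D.extended := fun _ hy i => by linarith [hy i, D.δ_pos]

theorem contDiffAt_emb (hp : p ∈ nullRegion D.a) : ContDiffAt ℝ ∞ D.emb p :=
  contDiffAt_stationaryMap (contDiffAt_shift hp) (contDiffAt_expand hp)

theorem contDiffAt_shift_collapse (hy : y ∈ D.ext) :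
    ContDiffAt ℝ ∞ (fun y => -D.shift (D.collapse y)) y :=
  (ContDiffAt.comp (g := D.shift) y (contDiffAt_shift (collapse_mem hy))
    (contDiffAt_collapse (ext_subset_extended hy))).neg

theorem contDiffAt_embInv (hp : spatial p ∈ D.ext) : ContDiffAt ℝ ∞ D.embInv p :=
  contDiffAt_stationaryMap (contDiffAt_shift_collapse hp)
    (contDiffAt_collapse (ext_subset_extended hp))

theorem embInv_emb (hp : p ∈ nullRegion D.a) : D.embInv (D.emb p) = p := by
  have h : spatial p ∈ puncturedSpace D.a := hp
  rw [embInv, stationaryMap, emb, spatial_stationaryMap, stationaryMap_zero, collapse_expand h,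
    add_neg_cancel_right, cons_spatial]

theorem emb_embInv (hp : spatial p ∈ D.ext) : D.emb (D.embInv p) = p := by
  rw [emb, stationaryMap, embInv, spatial_stationaryMap, stationaryMap_zero, expand_collapse hp,
    neg_add_cancel_right, cons_spatial]

theorem emb_mem (hp : p ∈ nullRegion D.a) : spatial (D.emb p) ∈ D.ext := by
  rw [emb, spatial_stationaryMap]; exact expand_mem hp

theorem embInv_mem (hp : spatial p ∈ D.ext) : D.embInv p ∈ nullRegion D.a := by
  change spatial (D.embInv p) ∈ puncturedSpace D.a
  rw [embInv, spatial_stationaryMap]; exact collapse_mem hp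

theorem emb_image : D.emb '' nullRegion D.a = spatial ⁻¹' D.ext := by
  ext p
  constructor
  · rintro ⟨q, hq, rfl⟩; exact emb_mem hq
  · intro hp; exact ⟨_, embInv_mem hp, emb_embInv hp⟩

theorem jac_emb_time (hp : p ∈ nullRegion D.a) (c : Fin 4) :
    jac D.emb p c 0 = (Pi.single 0 1 : Fin 4 → ℝ) c :=
  jac_stationaryMap_time (contDiffAt_shift hp).diff
    ((contDiffAt_expand hp).differentiableAt (by simp)) c

theorem jac_embInv_time (hp : spatial p ∈ D.ext) (c : Fin 4) :
    jac D.embInv p c 0 = (Pi.single 0 1 : Fin 4 → ℝ) c :=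
  jac_stationaryMap_time (contDiffAt_shift_collapse hp).diff
    ((contDiffAt_collapse (ext_subset_extended hp)).differentiableAt (by simp)) c

theorem jac_embInv_mul_jac_emb (hp : p ∈ nullRegion D.a) :
    Matrix.of (jac D.embInv (D.emb p)) * Matrix.of (jac D.emb p) = 1 := by
  rw [← jac_comp ((contDiffAt_embInv (emb_mem hp)).differentiableAt (by simp))
    ((contDiffAt_emb hp).differentiableAt (by simp)), ← jac_id p]
  congr 1
  exact jac_congr (eventually_of_mem ((isOpen_nullRegion D.a).mem_nhds hp) fun q hq => embInv_emb hq)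

theorem pullback2_emb_embInv (hp : p ∈ nullRegion D.a) (w : Cov2 4) :
    pullback2 D.emb (pullback2 D.embInv w) p = w p := by
  rw [pullback2_comp w ((contDiffAt_embInv (emb_mem hp)).differentiableAt (by simp))
    ((contDiffAt_emb hp).differentiableAt (by simp))]
  exact pullback2_id_of_eventually w
    (eventually_of_mem ((isOpen_nullRegion D.a).mem_nhds hp) fun q hq => embInv_emb hq)

/-! ### The inverse embedding near a horizon component -/

theorem collapse_eq_chi (hy : y ∈ D.collar i) : D.collapse y = D.chi i y := by
  have hδ := D.δ_pos
  have hs := collar_subset_shell hy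
  rw [collapse, radialMap_near D.sep profile_ge hs.1 hs.2, profile_of_le hδ hy.2.le, chi, dir, rad,
    smul_smul, div_eq_mul_inv]

theorem shift_chi (hy : y ∈ D.collar i) (hr : 0 < D.rad i y) :
    D.shift (D.chi i y) = -D.coef₀ i / D.rad i y + D.coef₁ i * Real.log (D.rad i y) := by
  have hδ := D.δ_pos
  have hs := collar_subset_shell hy
  have h1 : norm3 (D.chi i y - D.a i) = D.rad i y := by rw [norm3_chi_sub hs, abs_of_pos hr]
  -- In the collar `r ≤ δ`, where the cut-off in `shiftProfile` equals `1`.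
  have h2 : D.rad i y ≤ D.δ := (le_abs_self _).trans (abs_rad_le hy)
  rw [shift, sum_eq_of_near D.sep (c := fun i x => D.shiftProfile i (norm3 (x - D.a i)))
    (fun k x h => ?_) (show norm3 (D.chi i y - D.a i) < 4 * D.δ by rw [h1]; linarith)]
  · rw [h1, shiftProfile, Real.smoothTransition.zero_of_nonpos, sub_zero, mul_one]
    rw [sub_nonpos, div_le_one hδ]; exact h2
  · rw [shiftProfile, Real.smoothTransition.one_of_one_le, sub_self, mul_zero]
    rw [le_sub_iff_add_le, le_div_iff₀ hδ]; linarith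

theorem mem_ext_of_collar (hy : y ∈ D.collar i) (hr : 0 < D.rad i y) : y ∈ D.ext := by
  intro k
  by_cases hk : k = i
  · subst hk; rw [rad] at hr; linarith
  · have := lt_norm3_of_near D.sep hk (collar_subset_shell hy).2
    linarith [D.δ_pos]

theorem hasPd_rad (hy : y ∈ D.shell i) : HasPd (D.rad i) (D.dir i y) y :=
  ((sub_map_hasPd (D.a i) y (hasPd_norm3 (norm3_pos.1 hy.1))).sub (hasPd_const _)).congr_deriv
    fun k => by simp [dir]; ring

theorem hasPd_chi (hy : y ∈ D.shell i) (k : Fin 3) : HasPd (fun y => D.chi i y k)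
    (fun l => D.dir i y k * D.dir i y l + D.rad i y / norm3 (y - D.a i) *
      ((if l = k then 1 else 0) - D.dir i y k * D.dir i y l)) y := by
  have h0 := hy.1.ne'
  have hn := sub_map_hasPd (D.a i) y (hasPd_norm3 (norm3_pos.1 hy.1))
  have hd : HasPd (fun y => D.dir i y k) (fun l => ((if l = k then 1 else 0)
      - D.dir i y k * D.dir i y l) / norm3 (y - D.a i)) y := by
    refine ((hn.inv h0).mul ((hasPd_coord k).sub (hasPd_const (D.a i k)))).congr_deriv fun l => ?_
    simp only [dir, Pi.smul_apply, Pi.sub_apply, smul_eq_mul, sub_zero]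
    generalize (if l = k then (1 : ℝ) else 0) = e
    field_simp; ring
  refine ((hasPd_const (D.a i k)).add ((hasPd_rad hy).mul hd)).congr_deriv fun l => ?_
  ring

/-- The profile `-c₀/r + c₁ log r` is chosen as a primitive of `phi/r²`, so in the new time
coordinate `dv = dw - (phi/r²) dr`. -/
theorem hasPd_shift_chi (hy : y ∈ D.collar i) (hr : 0 < D.rad i y) :
    HasPd (fun y => -D.shift (D.collapse y))
      (fun l => -(D.phi i y / D.rad i y ^ 2) * D.dir i y l) y := by
  have hs := collar_subset_shell hy
  have hrp := hasPd_rad hs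
  have h1 : HasPd (fun y => -(-D.coef₀ i / D.rad i y + D.coef₁ i * Real.log (D.rad i y)))
      (fun l => -(D.phi i y / D.rad i y ^ 2) * D.dir i y l) y := by
    refine (((hasPd_const _).div hrp hr.ne').add ((hrp.log hr.ne').const_mul _)).neg.congr_deriv
      fun l => ?_
    rw [phi]; field_simp; ring
  refine h1.congr ?_
  have hc : ∀ᶠ z in 𝓝 y, 0 < D.rad i z := (contDiffAt_rad hs).continuousAt.eventually (lt_mem_nhds hr)
  filter_upwards [(D.isOpen_collar i).mem_nhds hy, hc] with z hz hz'
  rw [collapse_eq_chi hz, shift_chi hz hz']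

variable (D i p) in
/-- The 1-form `dr` near a horizon component. -/
noncomputable def nu : Fin 4 → ℝ := Fin.cons 0 (D.dir i (spatial p))

theorem hasPd_embInv_zero (hp : spatial p ∈ D.collar i) (hr : 0 < D.rad i (spatial p)) :
    HasPd (fun q => D.embInv q 0) (fun a => (Pi.single 0 1 : Fin 4 → ℝ) a
      - D.phi i (spatial p) / D.rad i (spatial p) ^ 2 * D.nu i p a) p := by
  refine (hasPd_stationaryMap_zero (hasPd_shift_chi hp hr)).congr_deriv fun a => ?_
  refine Fin.cases ?_ (fun l => ?_) a <;> simp [nu]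

theorem hasPd_embInv_succ (hp : spatial p ∈ D.collar i) (k : Fin 3) :
    HasPd (fun q => D.embInv q k.succ) (Fin.cons 0 fun l => D.dir i (spatial p) k *
      D.dir i (spatial p) l + D.rad i (spatial p) / norm3 (spatial p - D.a i) *
      ((if l = k then 1 else 0) - D.dir i (spatial p) k * D.dir i (spatial p) l) : Fin 4 → ℝ) p :=
  hasPd_stationaryMap_succ ((hasPd_chi (collar_subset_shell hp) k).congr
    (eventually_of_mem ((D.isOpen_collar i).mem_nhds hp) fun y hy => by beta_reduce; rw [collapse_eq_chi hy]))

end CentreData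

/-! ## The fields near a horizon component -/

theorem star3d_add {f h : (Fin 3 → ℝ) → ℝ} {x : Fin 3 → ℝ} (hf : DifferentiableAt ℝ f x)
    (hh : DifferentiableAt ℝ h x) : star3d (fun y => f y + h y) x = star3d f x + star3d h x := by
  ext a b
  simp only [star3d_eq, (hf.hasPd.add hh.hasPd).2]
  fin_cases a <;> fin_cases b <;> simp <;> ring

theorem hasPd_div_norm3_sub {m : ℝ} {b x : Fin 3 → ℝ} (hx : x ≠ b) :
    HasPd (fun y => m / norm3 (y - b)) (fun k => -m * (x k - b k) / norm3 (x - b) ^ 3) x :=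
  ((sub_map_hasPd b x (hasPd_inv_norm3 (sub_ne_zero.2 hx))).const_mul m).congr_deriv
    fun k => by simp; ring

namespace CentreData

variable {N : ℕ} (D : CentreData N) (i : Fin N)

/-- The metric near a horizon component. -/
noncomputable def collarMetric : Cov2 4 := fun p => Matrix.of fun a b =>
  (-D.rad i (spatial p) ^ 2 * ((Pi.single 0 1 : Fin 4 → ℝ) a * (Pi.single 0 1 : Fin 4 → ℝ) b)
      + D.phi i (spatial p) * ((Pi.single 0 1 : Fin 4 → ℝ) a * D.nu i p b
        + D.nu i p a * (Pi.single 0 1 : Fin 4 → ℝ) b)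
      + D.ee i (spatial p) * (D.nu i p a * D.nu i p b)) / D.regS i (spatial p)
    + D.regS i (spatial p) / norm3 (spatial p - D.a i) ^ 2 *
      (Matrix.diagonal ![0, 1, 1, 1] a b - D.nu i p a * D.nu i p b)

/-- The fields near a horizon component. -/
noncomputable def collarFields : Fields4 where
  g := D.collarMetric i
  Φ := fun p => -(√3 / 2) * Real.log (D.regQ i (spatial p) / D.regG i (spatial p))
  ρ := fun _ => 0
  F := fun p =>
    pullback2 (fun q => D.chi i (spatial q))
        (fun x => (√3 / 2) • star3d (restCentre D.G₀ D.γ D.a i) x) p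
      + pullback2 spatial (fun x => (√3 / 2) • star3d (fun y => D.γ i / norm3 (y - D.a i)) x) p
  G := fun p => (D.regQ i (spatial p) ^ 2)⁻¹ •
    (wedge11 (Pi.single 0 1) (D.q i • D.nu i p
        - D.rad i (spatial p) ^ 2 • gradForm (fun q => D.hh i (spatial q)) p)
      + D.phi i (spatial p) • wedge11 (D.nu i p) (gradForm (fun q => D.hh i (spatial q)) p))

/-- The fields of the null class in the coordinates of the extension. -/
noncomputable def exteriorFields : Fields4 where
  g := pullback2 D.embInv (nullFields4 D.calG D.calQ).g
  Φ := fun p => (nullFields4 D.calG D.calQ).Φ (D.embInv p)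
  ρ := fun p => (nullFields4 D.calG D.calQ).ρ (D.embInv p)
  F := pullback2 D.embInv (nullFields4 D.calG D.calQ).F
  G := pullback2 D.embInv (nullFields4 D.calG D.calQ).G

variable {D i} {x y : Fin 3 → ℝ} {p : Fin 4 → ℝ}

theorem calG_pos (x : Fin 3 → ℝ) : 0 < D.calG x := multiCentre_pos D.G₀_pos D.γ_pos x

theorem calQ_neg (x : Fin 3 → ℝ) : D.calQ x < 0 := neg_neg_of_pos (multiCentre_pos D.Q₀_pos D.q_pos x)

theorem contDiffOn_calG : ContDiffOn ℝ ∞ D.calG (puncturedSpace D.a) := contDiffOn_multiCentre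

theorem contDiffOn_calQ : ContDiffOn ℝ ∞ D.calQ (puncturedSpace D.a) := contDiffOn_multiCentre.neg

theorem calG_chi (hy : y ∈ D.shell i) (hr : 0 < D.rad i y) :
    D.calG (D.chi i y) = D.regG i y / D.rad i y := by
  rw [calG, multiCentre_eq_restCentre (i := i), norm3_chi_sub hy, abs_of_pos hr, regG, kk]
  field_simp

theorem calQ_chi (hy : y ∈ D.shell i) (hr : 0 < D.rad i y) :
    D.calQ (D.chi i y) = -(D.regQ i y / D.rad i y) := by
  rw [calQ, multiCentre_eq_restCentre (i := i), norm3_chi_sub hy, abs_of_pos hr, regQ, hh]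
  field_simp

theorem conformal_chi (hy : y ∈ D.shell i) (hr : 0 < D.rad i y) :
    √(-(D.calQ (D.chi i y) * D.calG (D.chi i y) ^ 3)) = D.regS i y / D.rad i y ^ 2 := by
  have h : -(D.calQ (D.chi i y) * D.calG (D.chi i y) ^ 3)
      = (D.regQ i y * D.regG i y ^ 3) / (D.rad i y ^ 2) ^ 2 := by
    rw [calG_chi hy hr, calQ_chi hy hr]; field_simp
  rw [h, Real.sqrt_div' _ (by positivity), Real.sqrt_sq (by positivity), regS]

theorem spatial_embInv (p : Fin 4 → ℝ) : spatial (D.embInv p) = D.collapse (spatial p) :=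
  spatial_stationaryMap

/-- Substituting `dv = dw - (phi/r²) dr` in `-(r²/S) dv² + (S/r²) dr²` leaves the cross term `2 phi
dw dr / S` and the coefficient `(S² - phi²)/(r² S) = ee/S` of `dr²`. All poles at `r = 0` cancel. -/
theorem exteriorFields_g_collar (hp : spatial p ∈ D.collar i) (hr : 0 < D.rad i (spatial p)) :
    D.exteriorFields.g p = D.collarMetric i p := by
  have hs := collar_subset_shell hp
  have hg : (nullFields4 D.calG D.calQ).g = staticMetric fun q =>
      √(-(D.calQ (spatial q) * D.calG (spatial q) ^ 3)) := rfl
  have hJ : ∀ c, HasPd (fun q => D.embInv q c) ((Fin.cons (fun a => (Pi.single 0 1 : Fin 4 → ℝ) a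
      - D.phi i (spatial p) / D.rad i (spatial p) ^ 2 * D.nu i p a) fun k => (Fin.cons 0 fun l =>
      D.dir i (spatial p) k * D.dir i (spatial p) l + D.rad i (spatial p) / norm3 (spatial p - D.a i) *
      ((if l = k then 1 else 0) - D.dir i (spatial p) k * D.dir i (spatial p) l) : Fin 4 → ℝ) :
        Fin 4 → Fin 4 → ℝ) c) p := fun c => by
    refine Fin.cases (hasPd_embInv_zero hp hr) (fun k => hasPd_embInv_succ hp k) c
  have hS := regS_pos hp
  have hSsq := regS_sq hp
  have hn := dir_sq hs
  have hρ := hs.1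
  ext a b
  simp only [exteriorFields, hg]
  rw [pullback2_staticMetric hJ, spatial_embInv, collapse_eq_chi hp, conformal_chi hs hr]
  simp only [Fin.cons_zero, Fin.cons_succ, collarMetric, Matrix.of_apply]
  set r := D.rad i (spatial p)
  set φ := D.phi i (spatial p)
  set K := D.regS i (spatial p)
  set E := D.ee i (spatial p)
  set ρ := norm3 (spatial p - D.a i)
  refine Fin.cases ?_ (fun l => ?_) a <;> refine Fin.cases ?_ (fun m => ?_) b
  · simp [nu]; field_simp
  · simp [nu, Matrix.diagonal_apply_ne _ (Fin.succ_ne_zero m).symm]; field_simp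
  · simp [nu]; field_simp
  · have hdiag : (Matrix.diagonal ![0, 1, 1, 1] : Matrix (Fin 4) (Fin 4) ℝ) l.succ m.succ
        = if l = m then 1 else 0 := by
      fin_cases l <;> fin_cases m <;> simp
    -- `n ⊗ n` and `1 - n ⊗ n` are complementary orthogonal projections, so squaring `n ⊗ n + t (1 -
    -- n ⊗ n)` only squares `t`.
    have hsum : ∑ k, ((D.dir i (spatial p) k * D.dir i (spatial p) l + r / ρ *
        ((if l = k then 1 else 0) - D.dir i (spatial p) k * D.dir i (spatial p) l)) *
        (D.dir i (spatial p) k * D.dir i (spatial p) m + r / ρ *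
        ((if m = k then 1 else 0) - D.dir i (spatial p) k * D.dir i (spatial p) m)))
        = D.dir i (spatial p) l * D.dir i (spatial p) m + (r / ρ) ^ 2 *
          ((if l = m then 1 else 0) - D.dir i (spatial p) l * D.dir i (spatial p) m) := by
      generalize r / ρ = t
      generalize D.dir i (spatial p) = n at hn ⊢
      rw [Fin.sum_univ_three]
      fin_cases l <;> fin_cases m <;> simp
      · linear_combination (1 - t) ^ 2 * n 0 * n 0 * hn
      · linear_combination (1 - t) ^ 2 * n 0 * n 1 * hn
      · linear_combination (1 - t) ^ 2 * n 0 * n 2 * hn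
      · linear_combination (1 - t) ^ 2 * n 1 * n 0 * hn
      · linear_combination (1 - t) ^ 2 * n 1 * n 1 * hn
      · linear_combination (1 - t) ^ 2 * n 1 * n 2 * hn
      · linear_combination (1 - t) ^ 2 * n 2 * n 0 * hn
      · linear_combination (1 - t) ^ 2 * n 2 * n 1 * hn
      · linear_combination (1 - t) ^ 2 * n 2 * n 2 * hn
    refine (congrArg₂ (· + ·) rfl (congrArg (K / r ^ 2 * ·) hsum)).trans ?_
    rw [hdiag]
    simp only [nu, Fin.cons_succ, Pi.single_eq_of_ne (Fin.succ_ne_zero _)]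
    generalize (if l = m then (1 : ℝ) else 0) = e
    field_simp
    linear_combination ρ ^ 2 * D.dir i (spatial p) l * D.dir i (spatial p) m * hSsq

theorem exteriorFields_dilaton_collar (hp : spatial p ∈ D.collar i) (hr : 0 < D.rad i (spatial p)) :
    D.exteriorFields.Φ p = (D.collarFields i).Φ p := by
  have hs := collar_subset_shell hp
  simp only [exteriorFields, collarFields, nullFields4]
  rw [spatial_embInv, collapse_eq_chi hp, calG_chi hs hr, calQ_chi hs hr]
  have := regG_pos hp
  congr 2
  field_simp

theorem hasPd_calQ_embInv (hp : spatial p ∈ D.collar i) (hr : 0 < D.rad i (spatial p)) :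
    HasPd (fun q => D.calQ (spatial (D.embInv q))) (fun a =>
      D.q i / D.rad i (spatial p) ^ 2 * D.nu i p a - gradForm (fun q => D.hh i (spatial q)) p a) p := by
  have hs := collar_subset_shell hp
  have h1 : HasPd (fun q => -(D.q i / D.rad i (spatial q) + D.hh i (spatial q))) (fun a =>
      D.q i / D.rad i (spatial p) ^ 2 * D.nu i p a - gradForm (fun q => D.hh i (spatial q)) p a) p := by
    have hh : DifferentiableAt ℝ (fun q => D.hh i (spatial q)) p :=
      ((contDiffAt_hh hs).comp p contDiff_spatial.contDiffAt).diff
    refine (((hasPd_const _).div (hasPd_rad hs).spatial hr.ne').add hh.hasPd).neg.congr_deriv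
      fun a => ?_
    simp only [gradForm, nu]
    field_simp; ring
  refine h1.congr ?_
  have hc : ∀ᶠ q in 𝓝 p, 0 < D.rad i (spatial q) :=
    ((contDiffAt_rad hs).comp p contDiff_spatial.contDiffAt).continuousAt.eventually (lt_mem_nhds hr)
  filter_upwards [((D.isOpen_collar i).preimage continuous_spatial).mem_nhds hp, hc] with q hq hq'
  rw [spatial_embInv, collapse_eq_chi hq, calQ_chi (collar_subset_shell hq) hq', regQ]
  field_simp

/-- Here `𝒬⁻² = r²/regQ²`, `d𝒬 = q r⁻² dr - dh` and `dv = dw - phi r⁻² dr`. The term in `dr ∧ dr`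
drops out, so the factor `r²` absorbs the remaining poles. -/
theorem exteriorFields_G_collar (hp : spatial p ∈ D.collar i) (hr : 0 < D.rad i (spatial p)) :
    D.exteriorFields.G p = (D.collarFields i).G p := by
  have hs := collar_subset_shell hp
  have hext := mem_ext_of_collar hp hr
  have hJ := (contDiffAt_embInv (p := p) hext).differentiableAt (by simp)
  have hQd : DifferentiableAt ℝ (fun q => D.calQ (spatial q)) (D.embInv p) :=
    ((contDiffOn_spatial contDiffOn_calQ).contDiffAt
      ((isOpen_nullRegion D.a).mem_nhds (embInv_mem hext))).diff
  have e1 : ∀ a, ∑ c, jac D.embInv p c a * (Pi.single 0 1 : Fin 4 → ℝ) c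
      = (Pi.single 0 1 : Fin 4 → ℝ) a - D.phi i (spatial p) / D.rad i (spatial p) ^ 2 * D.nu i p a := by
    intro a
    refine Eq.trans ?_ ((hasPd_embInv_zero hp hr).2 a)
    simp [jac, Pi.single_apply]
  have e2 : ∀ a, ∑ c, jac D.embInv p c a * gradForm (fun q => D.calQ (spatial q)) (D.embInv p) c
      = _ := fun a => (pullback1_gradForm hQd hJ a).trans ((hasPd_calQ_embInv hp hr).2 a)
  change pullback2 D.embInv (nullFields4 D.calG D.calQ).G p = _
  rw [pullback2_wedge11 (w := (nullFields4 D.calG D.calQ).G) rfl, funext e1, funext e2]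
  rw [spatial_embInv, collapse_eq_chi hp, calQ_chi hs hr]
  have hq := regQ_pos hp
  ext a b
  simp only [collarFields, wedge11, Matrix.smul_apply, Matrix.add_apply, Matrix.of_apply,
    Pi.sub_apply, Pi.smul_apply, smul_eq_mul]
  field_simp
  ring

/-- `⋆₃ d(1/r)` is, up to sign, the solid angle form, which depends only on the direction and so is
unchanged by a radial map with `r > 0`. The pulled back field thus extends smoothly across the
horizon although its source point is singular. -/
theorem pullback2_chi_star3d (hy : y ∈ D.shell i) (hr : 0 < D.rad i y) (m κ : ℝ) :
    pullback2 (D.chi i) (fun x => κ • star3d (fun y => m / norm3 (y - D.a i)) x) y =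
      κ • star3d (fun y => m / norm3 (y - D.a i)) y := by
  have hρ := hy.1
  have hc : D.chi i y - D.a i = D.rad i y • D.dir i y := by rw [chi, add_sub_cancel_left]
  have h1 : norm3 (D.chi i y - D.a i) = D.rad i y := by rw [norm3_chi_sub hy, abs_of_pos hr]
  have hne : D.chi i y ≠ D.a i := sub_ne_zero.1 (norm3_pos.1 (h1 ▸ hr))
  have hne' : y ≠ D.a i := sub_ne_zero.1 (norm3_pos.1 hρ)
  have e1 : ∀ k, pd k (fun y => m / norm3 (y - D.a i)) (D.chi i y)
      = -m * D.dir i y k / D.rad i y ^ 2 := fun k => by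
    refine ((hasPd_div_norm3_sub hne).2 k).trans ?_
    rw [h1]
    have := congrFun hc k
    simp only [Pi.sub_apply, Pi.smul_apply, smul_eq_mul] at this
    beta_reduce
    rw [this]; field_simp
  have e2 : ∀ k, pd k (fun y => m / norm3 (y - D.a i)) y
      = -m * D.dir i y k / norm3 (y - D.a i) ^ 2 := fun k => by
    refine ((hasPd_div_norm3_sub hne').2 k).trans ?_
    beta_reduce
    simp only [dir, Pi.smul_apply, Pi.sub_apply, smul_eq_mul]
    field_simp
  have hj := jac_eq_of_hasPd fun k => hasPd_chi hy k
  ext a b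
  simp only [pullback2, hj, Matrix.of_apply, Matrix.smul_apply, star3d_eq, e1, e2, smul_eq_mul]
  set n := D.dir i y
  set r := D.rad i y
  set ρ := norm3 (y - D.a i)
  fin_cases a <;> fin_cases b <;> simp [Fin.sum_univ_three] <;> field_simp <;> ring

/-- Split off the contribution of the own centre. That part is invariant under the collapsing map;
the rest is smooth at the centre and is pulled back along the smooth map `chi`. -/
theorem exteriorFields_F_collar (hp : spatial p ∈ D.collar i) (hr : 0 < D.rad i (spatial p)) :
    D.exteriorFields.F p = (D.collarFields i).F p := by
  have hs := collar_subset_shell hp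
  have hext := mem_ext_of_collar hp hr
  have hJ := (contDiffAt_embInv (p := p) hext).differentiableAt (by simp)
  have hsd : ∀ q, DifferentiableAt ℝ spatial q := fun q =>
    contDiff_spatial.contDiffAt.differentiableAt (by simp)
  have hch : DifferentiableAt ℝ (D.chi i) (spatial p) := (contDiffAt_chi hs).differentiableAt (by simp)
  have h1 : norm3 (D.chi i (spatial p) - D.a i) = D.rad i (spatial p) := by
    rw [norm3_chi_sub hs, abs_of_pos hr]
  have hne : D.chi i (spatial p) ≠ D.a i := sub_ne_zero.1 (norm3_pos.1 (h1 ▸ hr))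
  change pullback2 D.embInv (pullback2 spatial fun x => (√3 / 2) • star3d D.calG x) p = _
  rw [pullback2_comp _ (hsd _) hJ]
  have hev : (fun q => spatial (D.embInv q)) =ᶠ[𝓝 p] fun q => D.chi i (spatial q) := by
    filter_upwards [((D.isOpen_collar i).preimage continuous_spatial).mem_nhds hp] with q hq
    rw [spatial_embInv, collapse_eq_chi hq]
  rw [pullback2_congr _ hev]
  have hsplit : (√3 / 2) • star3d D.calG (D.chi i (spatial p))
      = (√3 / 2) • star3d (restCentre D.G₀ D.γ D.a i) (D.chi i (spatial p))
        + (√3 / 2) • star3d (fun y => D.γ i / norm3 (y - D.a i)) (D.chi i (spatial p)) := by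
    rw [← smul_add, ← star3d_add (contDiffAt_restCentre fun _ hk => chi_ne hs hk).diff
      (hasPd_div_norm3_sub hne).1]
    congr 2
    funext x
    rw [calG, multiCentre_eq_restCentre (i := i), add_comm]
  rw [pullback2_add (w₁ := fun x => (√3 / 2) • star3d (restCentre D.G₀ D.γ D.a i) x)
    (w₂ := fun x => (√3 / 2) • star3d (fun y => D.γ i / norm3 (y - D.a i)) x) hsplit]
  simp only [collarFields]
  congr 1
  have e := pullback2_chi_star3d hs hr (D.γ i) (√3 / 2)
  rw [pullback2_eq_mul] at e
  rw [← pullback2_comp _ hch (hsd p), pullback2_eq_mul, pullback2_eq_mul, e]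
  exact (pullback2_eq_mul spatial
    (fun x => (√3 / 2) • star3d (fun y => D.γ i / norm3 (y - D.a i)) x) p).symm

/-! ### Smoothness -/

theorem contDiffAt_spatial_comp {f : (Fin 3 → ℝ) → ℝ} (hf : ContDiffAt ℝ ∞ f (spatial p)) :
    ContDiffAt ℝ ∞ (fun q => f (spatial q)) p := hf.comp p contDiff_spatial.contDiffAt

theorem contDiffAt_nu (hp : spatial p ∈ D.shell i) (a : Fin 4) :
    ContDiffAt ℝ ∞ (fun q => D.nu i q a) p := by
  refine Fin.cases ?_ (fun k => ?_) a
  · exact contDiffAt_const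
  · exact contDiffAt_spatial_comp (contDiffAt_pi.1 (contDiffAt_dir hp) k)

theorem collarFields_smoothOn : (D.collarFields i).SmoothOn (spatial ⁻¹' D.collar i) := by
  have hsh : ∀ p ∈ spatial ⁻¹' D.collar i, spatial p ∈ D.shell i := fun p hp => collar_subset_shell hp
  have hU : IsOpen (spatial ⁻¹' D.collar i) := (D.isOpen_collar i).preimage continuous_spatial
  refine ⟨fun a b p hp => ContDiffAt.contDiffWithinAt ?_, fun p hp => ContDiffAt.contDiffWithinAt ?_,
    contDiffOn_const, fun a b => ?_, fun a b p hp => ContDiffAt.contDiffWithinAt ?_⟩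
  · have hs := hsh p hp
    have h1 := contDiffAt_spatial_comp (contDiffAt_rad hs)
    have h2 := contDiffAt_spatial_comp (contDiffAt_phi hs)
    have h3 := contDiffAt_spatial_comp (contDiffAt_ee hs)
    have h4 := contDiffAt_spatial_comp (contDiffAt_regS hp)
    have h5 := contDiffAt_spatial_comp (contDiffAt_norm3_sub hs.1)
    have ha := contDiffAt_nu hs a
    have hb := contDiffAt_nu hs b
    simp only [collarFields, collarMetric, Matrix.of_apply]
    refine ContDiffAt.add (ContDiffAt.div ?_ h4 (regS_pos hp).ne')
      ((h4.div (h5.pow 2) (pow_ne_zero 2 hs.1.ne')).mul (contDiffAt_const.sub (ha.mul hb)))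
    exact (((h1.pow 2).neg.mul contDiffAt_const).add (h2.mul ((contDiffAt_const.mul hb).add
      (ha.mul contDiffAt_const)))).add (h3.mul (ha.mul hb))
  · have hs := hsh p hp
    have h1 := contDiffAt_spatial_comp (contDiffAt_regQ hs)
    have h2 := contDiffAt_spatial_comp (contDiffAt_regG hs)
    exact contDiffAt_const.mul ((h1.div h2 (regG_pos hp).ne').log
      (div_ne_zero (regQ_pos hp).ne' (regG_pos hp).ne'))
  · have hψ : ContDiffOn ℝ ∞ (fun q => D.chi i (spatial q)) (spatial ⁻¹' D.collar i) := fun p hp =>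
      ((contDiffAt_chi (hsh p hp)).comp p contDiff_spatial.contDiffAt).contDiffWithinAt
    have hR : IsOpen {x : Fin 3 → ℝ | ∀ k, k ≠ i → x ≠ D.a k} := by
      have : {x : Fin 3 → ℝ | ∀ k, k ≠ i → x ≠ D.a k} = ⋂ k, {x | k ≠ i → x ≠ D.a k} := by
        ext; simp
      rw [this]
      refine isOpen_iInter_of_finite fun k => ?_
      by_cases hk : k = i
      · simp [hk]
      · simpa [hk] using isOpen_ne
    have hP : IsOpen {x : Fin 3 → ℝ | x ≠ D.a i} := isOpen_ne
    have s1 := smul_star3d_smoothOn (√3 / 2) hR (f := restCentre D.G₀ D.γ D.a i)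
      fun x hx => (contDiffAt_restCentre hx).contDiffWithinAt
    have s2 := smul_star3d_smoothOn (√3 / 2) hP (f := fun y => D.γ i / norm3 (y - D.a i))
      fun x hx => (contDiffAt_const.div (contDiffAt_norm3_sub (norm3_pos.2 (sub_ne_zero.2 hx)))
        (norm3_pos.2 (sub_ne_zero.2 hx)).ne').contDiffWithinAt
    have m1 : MapsTo (fun q => D.chi i (spatial q)) (spatial ⁻¹' D.collar i)
      {x : Fin 3 → ℝ | ∀ k, k ≠ i → x ≠ D.a k} := fun p hp k hk => chi_ne (hsh p hp) hk
    exact (pullback2_smoothOn hU hψ m1 s1 a b).add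
      (pullback2_smoothOn hU contDiff_spatial.contDiffOn
        (fun p hp => sub_ne_zero.1 (norm3_pos.1 (hsh p hp).1)) s2 a b)
  · have hs := hsh p hp
    have h1 := contDiffAt_spatial_comp (contDiffAt_regQ hs)
    have h2 := contDiffAt_spatial_comp (contDiffAt_rad hs)
    have h3 := contDiffAt_spatial_comp (contDiffAt_phi hs)
    have h4 := fun a => (contDiffAt_spatial_comp (contDiffAt_hh hs)).pd a
    have h5 := fun a => contDiffAt_nu hs a
    have h6 : ContDiffAt ℝ ∞ (fun p => (D.regQ i (spatial p) ^ 2)⁻¹) p :=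
      (h1.pow 2).inv (pow_ne_zero 2 (regQ_pos hp).ne')
    have h7 := fun a => (contDiffAt_const (c := D.q i).mul (h5 a)).sub ((h2.pow 2).mul (h4 a))
    simp only [collarFields, wedge11, Matrix.smul_apply, Matrix.add_apply, Matrix.of_apply,
      Pi.sub_apply, Pi.smul_apply, smul_eq_mul, gradForm]
    exact h6.mul (((contDiffAt_const.mul (h7 b)).sub (contDiffAt_const.mul (h7 a))).add
      (h3.mul (((h5 a).mul (h4 b)).sub ((h5 b).mul (h4 a)))))

theorem exteriorFields_smoothOn : D.exteriorFields.SmoothOn (spatial ⁻¹' D.ext) := by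
  obtain ⟨h1, h2, -, h4, h5⟩ := nullFields4_smoothOn (isOpen_puncturedSpace D.a) contDiffOn_calG
    contDiffOn_calQ (fun x _ => calG_pos x) (fun x _ => calQ_neg x)
  have hU : IsOpen (spatial ⁻¹' D.ext) := D.isOpen_ext.preimage continuous_spatial
  have hJ : ContDiffOn ℝ ∞ D.embInv (spatial ⁻¹' D.ext) := fun p hp =>
    (contDiffAt_embInv hp).contDiffWithinAt
  have hm : MapsTo D.embInv (spatial ⁻¹' D.ext) (nullRegion D.a) := fun p hp => embInv_mem hp
  exact ⟨pullback2_smoothOn hU hJ hm h1, h2.comp hJ hm, contDiffOn_const,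
    pullback2_smoothOn hU hJ hm h4, pullback2_smoothOn hU hJ hm h5⟩

end CentreData

/-! ## The metric near a horizon component -/

theorem isLorentzian_minkowski : IsLorentzian minkowski :=
  ⟨Matrix.isSymm_diagonal _, 1, by simp, by simp⟩

/-- A metric that splits into a part on `⟨α, β⟩` and a multiple of the part orthogonal to `n`. -/
theorem isLorentzian_of_radial {n : Fin 3 → ℝ} (hn : n 0 ^ 2 + n 1 ^ 2 + n 2 ^ 2 = 1)
    {α₀ α₁ β₀ β₁ c : ℝ} (hdet : α₀ * β₁ - α₁ * β₀ ≠ 0) (hc : c ≠ 0) {m : Matrix (Fin 4) (Fin 4) ℝ}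
    (hm : ∀ a b, m a b =
      -((Fin.cons α₀ (α₁ • n) : Fin 4 → ℝ) a * (Fin.cons α₀ (α₁ • n) : Fin 4 → ℝ) b)
        + (Fin.cons β₀ (β₁ • n) : Fin 4 → ℝ) a * (Fin.cons β₀ (β₁ • n) : Fin 4 → ℝ) b
        + c ^ 2 * ((Matrix.diagonal ![0, 1, 1, 1] : Matrix (Fin 4) (Fin 4) ℝ) a b
          - (Fin.cons 0 n : Fin 4 → ℝ) a * (Fin.cons 0 n : Fin 4 → ℝ) b)) : IsLorentzian m := by
  -- The top row is the covector `α`; row `k` is `n k` times the covector `β` plus `c` times the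
  -- `k`-th row of the projection orthogonal to `n`.
  set P : Matrix (Fin 4) (Fin 4) ℝ :=
    !![α₀, α₁ * n 0, α₁ * n 1, α₁ * n 2;
       β₀ * n 0, β₁ * n 0 * n 0 + c * (1 - n 0 * n 0), β₁ * n 0 * n 1 - c * n 0 * n 1,
        β₁ * n 0 * n 2 - c * n 0 * n 2;
       β₀ * n 1, β₁ * n 1 * n 0 - c * n 1 * n 0, β₁ * n 1 * n 1 + c * (1 - n 1 * n 1),
        β₁ * n 1 * n 2 - c * n 1 * n 2;
       β₀ * n 2, β₁ * n 2 * n 0 - c * n 2 * n 0, β₁ * n 2 * n 1 - c * n 2 * n 1,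
        β₁ * n 2 * n 2 + c * (1 - n 2 * n 2)] with hP
  have hdetP : P.det ≠ 0 := by
    intro h0
    obtain ⟨X, hX, hPX⟩ := Matrix.exists_mulVec_eq_zero_iff.2 h0
    -- For a kernel vector, the time component and the component along `n` solve a `2 × 2` system
    -- with nonzero determinant; then `c ≠ 0` annihilates the orthogonal part.
    have e0 := congrFun hPX 0
    have e1 := congrFun hPX 1
    have e2 := congrFun hPX 2
    have e3 := congrFun hPX 3
    simp only [hP, Matrix.mulVec, dotProduct, Fin.sum_univ_four, Matrix.of_apply, Pi.zero_apply,
      Matrix.cons_val] at e0 e1 e2 e3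
    set ξ := n 0 * X 1 + n 1 * X 2 + n 2 * X 3 with hξ
    have f1 : β₀ * X 0 + β₁ * ξ = 0 := by
      rw [hξ]
      linear_combination n 0 * e1 + n 1 * e2 + n 2 * e3 - (β₀ * X 0 + (β₁ - c) *
        (n 0 * X 1 + n 1 * X 2 + n 2 * X 3)) * hn
    have f0 : α₀ * X 0 + α₁ * ξ = 0 := by rw [hξ]; linear_combination e0
    have g0 : X 0 = 0 := by
      refine (mul_eq_zero.1 ?_).resolve_left hdet
      linear_combination β₁ * f0 - α₁ * f1
    have g1 : ξ = 0 := by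
      refine (mul_eq_zero.1 ?_).resolve_left hdet
      linear_combination α₀ * f1 - β₀ * f0
    have k1 : X 1 = 0 := (mul_eq_zero.1 (show c * X 1 = 0 by
      rw [hξ] at g1; linear_combination e1 - β₀ * n 0 * g0 - (β₁ - c) * n 0 * g1)).resolve_left hc
    have k2 : X 2 = 0 := (mul_eq_zero.1 (show c * X 2 = 0 by
      rw [hξ] at g1; linear_combination e2 - β₀ * n 1 * g0 - (β₁ - c) * n 1 * g1)).resolve_left hc
    have k3 : X 3 = 0 := (mul_eq_zero.1 (show c * X 3 = 0 by
      rw [hξ] at g1; linear_combination e3 - β₀ * n 2 * g0 - (β₁ - c) * n 2 * g1)).resolve_left hc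
    refine hX (funext fun a => ?_)
    fin_cases a <;> assumption
  have : m = P.transpose * minkowski * P := by
    ext a b
    rw [hm, Matrix.mul_apply]
    simp only [minkowski, Matrix.mul_diagonal, Matrix.transpose_apply, Fin.sum_univ_four]
    have e1 : (Fin.cons 0 n : Fin 4 → ℝ) = ![0, n 0, n 1, n 2] := by
      ext k; fin_cases k <;> rfl
    have e2 : (Fin.cons α₀ (α₁ • n) : Fin 4 → ℝ) = ![α₀, α₁ * n 0, α₁ * n 1, α₁ * n 2] := by
      ext k; fin_cases k <;> rfl
    have e3 : (Fin.cons β₀ (β₁ • n) : Fin 4 → ℝ) = ![β₀, β₁ * n 0, β₁ * n 1, β₁ * n 2] := by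
      ext k; fin_cases k <;> rfl
    rw [e1, e2, e3]
    generalize n 0 = x at *
    generalize n 1 = y at *
    generalize n 2 = z at *
    fin_cases a <;> fin_cases b <;> simp [hP]
    · linear_combination (-β₀ * β₀) * hn
    · linear_combination (-β₀ * (β₁ - c) * x) * hn
    · linear_combination (-β₀ * (β₁ - c) * y) * hn
    · linear_combination (-β₀ * (β₁ - c) * z) * hn
    · linear_combination (-β₀ * (β₁ - c) * x) * hn
    · linear_combination (-(β₁ - c) ^ 2 * x * x) * hn
    · linear_combination (-(β₁ - c) ^ 2 * x * y) * hn
    · linear_combination (-(β₁ - c) ^ 2 * x * z) * hn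
    · linear_combination (-β₀ * (β₁ - c) * y) * hn
    · linear_combination (-(β₁ - c) ^ 2 * y * x) * hn
    · linear_combination (-(β₁ - c) ^ 2 * y * y) * hn
    · linear_combination (-(β₁ - c) ^ 2 * y * z) * hn
    · linear_combination (-β₀ * (β₁ - c) * z) * hn
    · linear_combination (-(β₁ - c) ^ 2 * z * x) * hn
    · linear_combination (-(β₁ - c) ^ 2 * z * y) * hn
    · linear_combination (-(β₁ - c) ^ 2 * z * z) * hn
  rw [this]
  exact isLorentzian_minkowski.pullback hdetP

namespace CentreData

variable {N : ℕ} (D : CentreData N) (i : Fin N)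

/-- A slope below which radial perturbations of the stationary direction are timelike. -/
noncomputable def slope : ℝ := (exists_slope D i).choose

variable {D i} {x y : Fin 3 → ℝ} {p : Fin 4 → ℝ} {β : ℝ}

theorem slope_pos : 0 < D.slope i := (exists_slope D i).choose_spec.1

theorem slope_mul_le (hy : y ∈ D.collar i) : D.slope i * |D.ee i y| ≤ D.phi i y :=
  (exists_slope D i).choose_spec.2 y hy

theorem mul_ee_le (hy : y ∈ D.collar i) (h0 : 0 ≤ β) (h1 : β ≤ D.slope i) :
    β * D.ee i y ≤ D.phi i y :=
  (mul_le_mul_of_nonneg_left (le_abs_self _) h0).trans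
    ((mul_le_mul_of_nonneg_right h1 (abs_nonneg _)).trans (slope_mul_le hy))

/-- The expression is `-S g(T, T)` for `T = ∂_w - β ∂_r`. It is positive even at `r = 0` because `β
ee ≤ phi` makes the middle term dominate. -/
theorem timelike_aux (hy : y ∈ D.collar i) (h0 : 0 < β) (h1 : β ≤ D.slope i) :
    0 < D.rad i y ^ 2 + 2 * D.phi i y * β - D.ee i y * β ^ 2 := by
  have h2 := mul_le_mul_of_nonneg_right (mul_ee_le hy h0.le h1) h0.le
  have h3 := mul_pos (phi_pos hy) h0
  nlinarith [sq_nonneg (D.rad i y)]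

/-- A frame for the `(w, r)`-block: `α` is the covector dual to `T = ∂_w - β ∂_r`, normalised, and
the second covector is a multiple of `β dw + dr`, which annihilates `T`. Its normalisation is fixed
by the determinant of the block, which is `-(phi² + r² ee)/S² = -1`. -/
theorem collarMetric_lorentzian (hp : spatial p ∈ D.collar i) : IsLorentzian (D.collarMetric i p) := by
  have hs := collar_subset_shell hp
  have hK := regS_pos hp
  have hρ := hs.1
  have hτ := timelike_aux hp slope_pos le_rfl
  have hsq := regS_sq hp
  set β := D.slope i
  set τ := D.rad i (spatial p) ^ 2 + 2 * D.phi i (spatial p) * β - D.ee i (spatial p) * β ^ 2 with hτd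
  set r := D.rad i (spatial p)
  set φ := D.phi i (spatial p)
  set E := D.ee i (spatial p)
  set K := D.regS i (spatial p)
  set ρ := norm3 (spatial p - D.a i)
  have hτK : √(τ * K) ^ 2 = τ * K := Real.sq_sqrt (mul_pos hτ hK).le
  have hKτ : √(K / τ) ^ 2 = K / τ := Real.sq_sqrt (div_pos hK hτ).le
  have hc : (√K / ρ) ^ 2 = K / ρ ^ 2 := by rw [div_pow, Real.sq_sqrt hK.le]
  have hA : 0 < √(τ * K) := Real.sqrt_pos.2 (mul_pos hτ hK)
  have hB : 0 < √(K / τ) := Real.sqrt_pos.2 (div_pos hK hτ)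
  refine isLorentzian_of_radial (dir_sq hs) (α₀ := (-r ^ 2 - β * φ) / √(τ * K))
    (α₁ := (φ - β * E) / √(τ * K)) (β₀ := β * √(K / τ)) (β₁ := √(K / τ)) (c := √K / ρ) ?_
    (by positivity) fun a b => ?_
  · have : (-r ^ 2 - β * φ) / √(τ * K) * √(K / τ) - (φ - β * E) / √(τ * K) * (β * √(K / τ))
        = -(τ / √(τ * K) * √(K / τ)) := by rw [hτd]; ring
    rw [this]
    exact neg_ne_zero.2 (by positivity)
  · rw [hc]
    simp only [collarMetric, Matrix.of_apply]
    have e : ∀ a, (Fin.cons ((-r ^ 2 - β * φ) / √(τ * K)) (((φ - β * E) / √(τ * K)) •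
        D.dir i (spatial p)) : Fin 4 → ℝ) a = ((-r ^ 2 - β * φ) * (Pi.single 0 1 : Fin 4 → ℝ) a
          + (φ - β * E) * D.nu i p a) / √(τ * K) := fun a => by
      refine Fin.cases ?_ (fun k => ?_) a
      · simp [nu]
      · simp [nu]; ring
    have e' : ∀ a, (Fin.cons (β * √(K / τ)) (√(K / τ) • D.dir i (spatial p)) : Fin 4 → ℝ) a
        = √(K / τ) * (β * (Pi.single 0 1 : Fin 4 → ℝ) a + D.nu i p a) := fun a => by
      refine Fin.cases ?_ (fun k => ?_) a
      · simp [nu]; ring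
      · simp [nu]
    rw [e, e, e', e']
    change (-r ^ 2 * _ + φ * _ + E * _) / K + _ = _ + _ + K / ρ ^ 2 * (_ - D.nu i p a * D.nu i p b)
    generalize D.nu i p a = u
    generalize D.nu i p b = v
    generalize (Pi.single 0 1 : Fin 4 → ℝ) a = u'
    generalize (Pi.single 0 1 : Fin 4 → ℝ) b = v'
    refine congrArg₂ (· + ·) ?_ rfl
    have e2 : √(K / τ) * (β * u' + u) * (√(K / τ) * (β * v' + v))
        = K / τ * ((β * u' + u) * (β * v' + v)) := by
      linear_combination ((β * u' + u) * (β * v' + v)) * hKτ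
    rw [div_mul_div_comm, ← sq, hτK, e2]
    have hτ' := hτ.ne'
    field_simp
    rw [hsq, hτd]
    ring

theorem gdot_collarMetric (X Y : Fin 4 → ℝ) :
    gdot (D.collarMetric i p) X Y =
      (-D.rad i (spatial p) ^ 2 * (X 0 * Y 0)
        + D.phi i (spatial p) * (X 0 * (D.dir i (spatial p) ⬝ᵥ spatial Y)
          + (D.dir i (spatial p) ⬝ᵥ spatial X) * Y 0)
        + D.ee i (spatial p) * ((D.dir i (spatial p) ⬝ᵥ spatial X) *
          (D.dir i (spatial p) ⬝ᵥ spatial Y))) / D.regS i (spatial p)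
      + D.regS i (spatial p) / norm3 (spatial p - D.a i) ^ 2 * (spatial X ⬝ᵥ spatial Y
        - (D.dir i (spatial p) ⬝ᵥ spatial X) * (D.dir i (spatial p) ⬝ᵥ spatial Y)) := by
  have e1 : D.nu i p = ![0, D.dir i (spatial p) 0, D.dir i (spatial p) 1, D.dir i (spatial p) 2] := by
    ext k; fin_cases k <;> rfl
  have e2 : (Pi.single 0 1 : Fin 4 → ℝ) = ![1, 0, 0, 0] := by
    ext k; fin_cases k <;> rfl
  simp only [gdot, collarMetric, Matrix.of_apply, e1, e2, dotProduct, Fin.sum_univ_three,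
    Fin.sum_univ_four, spatial]
  simp
  ring

end CentreData

/-! ## The extended spacetime -/

theorem Fields4.SmoothOn.of_cover {X : Fields4} {M : Set (Fin 4 → ℝ)}
    (h : ∀ p ∈ M, ∃ (U : Set (Fin 4 → ℝ)) (Y : Fields4), IsOpen U ∧ p ∈ U ∧ Y.SmoothOn U ∧
      ∀ q ∈ U, X.g q = Y.g q ∧ X.Φ q = Y.Φ q ∧ X.ρ q = Y.ρ q ∧ X.F q = Y.F q ∧ X.G q = Y.G q) :
    X.SmoothOn M := by
  have key : ∀ {f : Fields4 → (Fin 4 → ℝ) → ℝ},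
      (∀ {U : Set (Fin 4 → ℝ)} {Y : Fields4}, Y.SmoothOn U → ContDiffOn ℝ ∞ (f Y) U) →
      (∀ {Y : Fields4} {q}, X.g q = Y.g q ∧ X.Φ q = Y.Φ q ∧ X.ρ q = Y.ρ q ∧ X.F q = Y.F q ∧
        X.G q = Y.G q → f X q = f Y q) → ContDiffOn ℝ ∞ (f X) M := by
    intro f h1 h2 p hp
    obtain ⟨U, Y, hU, hpU, hY, he⟩ := h p hp
    exact (((h1 hY).contDiffAt (hU.mem_nhds hpU)).congr_of_eventuallyEq
      (eventually_of_mem (hU.mem_nhds hpU) fun q hq => h2 (he q hq))).contDiffWithinAt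
  exact ⟨fun a b => key (f := fun Y p => Y.g p a b) (fun h => h.1 a b) fun h => by rw [h.1],
    key (f := fun Y p => Y.Φ p) (fun h => h.2.1) fun h => h.2.1,
    key (f := fun Y p => Y.ρ p) (fun h => h.2.2.1) fun h => h.2.2.1,
    fun a b => key (f := fun Y p => Y.F p a b) (fun h => h.2.2.2.1 a b) fun h => by rw [h.2.2.2.1],
    fun a b => key (f := fun Y p => Y.G p a b) (fun h => h.2.2.2.2 a b) fun h => by rw [h.2.2.2.2]⟩

namespace CentreData

variable {N : ℕ} (D : CentreData N) (i : Fin N)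

/-- The conformal factor of the static metric. -/
noncomputable def conf (x : Fin 3 → ℝ) : ℝ := √(-(D.calQ x * D.calG x ^ 3))

open Classical in
/-- The fields that are used near a point. -/
noncomputable def localFields (p : Fin 4 → ℝ) : Fields4 :=
  if h : ∃ i, spatial p ∈ D.collar i then D.collarFields h.choose else D.exteriorFields

/-- The fields on the extended spacetime. -/
noncomputable def fields : Fields4 where
  g := fun p => (D.localFields p).g p
  Φ := fun p => (D.localFields p).Φ p
  ρ := fun p => (D.localFields p).ρ p
  F := fun p => (D.localFields p).F p
  G := fun p => (D.localFields p).G p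

/-- The domain of the extended spacetime. -/
def domain : Set (Fin 4 → ℝ) := spatial ⁻¹' D.extended

/-- The inclination of the time direction. -/
noncomputable def tilt (ρ : ℝ) : ℝ := D.slope i * (1 - Real.smoothTransition (ρ / D.δ - 1))

/-- The time orientation. -/
noncomputable def timeDir (p : Fin 4 → ℝ) : Fin 4 → ℝ :=
  Fin.cons 1 (∑ i, -(D.tilt i (norm3 (spatial p - D.a i)) / norm3 (spatial p - D.a i)) •
    (spatial p - D.a i))

variable {D i} {x y : Fin 3 → ℝ} {p : Fin 4 → ℝ} {X Y : Fin 4 → ℝ}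

theorem conf_pos (x : Fin 3 → ℝ) : 0 < D.conf x := by
  have h1 := pow_pos (D.calG_pos x) 3
  exact Real.sqrt_pos.2 (by nlinarith [D.calQ_neg x])

theorem isOpen_domain : IsOpen D.domain := D.isOpen_extended.preimage continuous_spatial

/-- Collars of different centres are disjoint; this makes the choice in `localFields` harmless. -/
theorem collar_unique {k : Fin N} (h : y ∈ D.collar i) (h' : y ∈ D.collar k) : k = i := by
  by_contra hk
  have := lt_norm3_of_near D.sep hk (collar_subset_shell h).2
  linarith [h'.2, D.δ_pos]

theorem localFields_collar (hp : spatial p ∈ D.collar i) : D.localFields p = D.collarFields i := by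
  have h : ∃ i, spatial p ∈ D.collar i := ⟨i, hp⟩
  rw [localFields, dif_pos h, collar_unique hp h.choose_spec]

theorem fields_ext (hp : spatial p ∈ D.ext) :
    D.fields.g p = D.exteriorFields.g p ∧ D.fields.Φ p = D.exteriorFields.Φ p ∧
      D.fields.ρ p = D.exteriorFields.ρ p ∧ D.fields.F p = D.exteriorFields.F p ∧
      D.fields.G p = D.exteriorFields.G p := by
  by_cases h : ∃ i, spatial p ∈ D.collar i
  · obtain ⟨i, hi⟩ := h
    have hr : 0 < D.rad i (spatial p) := sub_pos.2 (hp i)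
    simp only [fields, localFields_collar hi]
    exact ⟨(exteriorFields_g_collar hi hr).symm, (exteriorFields_dilaton_collar hi hr).symm, rfl,
      (exteriorFields_F_collar hi hr).symm, (exteriorFields_G_collar hi hr).symm⟩
  · simp only [fields, localFields, dif_neg h, and_self]

theorem fields_g_collar (hp : spatial p ∈ D.collar i) : D.fields.g p = D.collarMetric i p := by
  simp only [fields, localFields_collar hp]; rfl

theorem collar_or_far (hy : y ∈ D.extended) :
    (∃ i, y ∈ D.collar i) ∨ ∀ i, 2 * D.δ ≤ norm3 (y - D.a i) := by
  rcases near_or_far D.a (2 * D.δ) y with ⟨i, hi⟩ | h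
  · exact Or.inl ⟨i, hy i, hi⟩
  · exact Or.inr h

theorem mem_ext_of_far (h : ∀ i, 2 * D.δ ≤ norm3 (y - D.a i)) : y ∈ D.ext := fun i => by
  linarith [h i, D.δ_pos]

theorem mem_extended_of_collar (hy : y ∈ D.collar i) : y ∈ D.extended := by
  intro k
  by_cases hk : k = i
  · subst hk; exact hy.1
  · linarith [lt_norm3_of_near D.sep hk (collar_subset_shell hy).2, D.δ_pos]

theorem fields_smoothOn : D.fields.SmoothOn D.domain := by
  refine Fields4.SmoothOn.of_cover fun p hp => ?_
  rcases collar_or_far hp with ⟨i, hi⟩ | h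
  · exact ⟨_, _, (D.isOpen_collar i).preimage continuous_spatial, hi, collarFields_smoothOn,
      fun q hq => by simp only [fields, localFields_collar hq, and_self]⟩
  · exact ⟨_, _, D.isOpen_ext.preimage continuous_spatial, mem_ext_of_far h, exteriorFields_smoothOn,
      fun q hq => fields_ext hq⟩

theorem jac_emb_mul_jac_embInv (hp : spatial p ∈ D.ext) :
    Matrix.of (jac D.emb (D.embInv p)) * Matrix.of (jac D.embInv p) = 1 := by
  have h := jac_embInv_mul_jac_emb (embInv_mem hp)
  rw [emb_embInv hp] at h
  exact mul_eq_one_comm.1 h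

theorem exteriorFields_g_eq :
    D.exteriorFields.g = pullback2 D.embInv (staticMetric fun q => D.conf (spatial q)) := rfl

theorem fields_lorentzian (hp : p ∈ D.domain) : IsLorentzian (D.fields.g p) := by
  rcases collar_or_far hp with ⟨i, hi⟩ | h
  · rw [fields_g_collar hi]; exact collarMetric_lorentzian hi
  · have he := mem_ext_of_far h
    rw [(fields_ext he).1, exteriorFields_g_eq, pullback2_eq_mul]
    refine (isLorentzian_diagonal (conf_pos _)).pullback fun h0 => ?_
    have := congrArg Matrix.det (jac_emb_mul_jac_embInv he)
    rw [Matrix.det_mul, h0, mul_zero, Matrix.det_one] at this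
    exact zero_ne_one this

/-! ### Time orientation -/

theorem tilt_of_ge {ρ : ℝ} (h : 2 * D.δ ≤ ρ) : D.tilt i ρ = 0 := by
  have hδ := D.δ_pos
  rw [tilt, Real.smoothTransition.one_of_one_le, sub_self, mul_zero]
  rw [le_sub_iff_add_le, le_div_iff₀ hδ]; linarith

theorem tilt_pos {ρ : ℝ} (h : ρ < 2 * D.δ) : 0 < D.tilt i ρ := by
  refine mul_pos slope_pos (sub_pos.2 (Real.smoothTransition.lt_one_of_lt_one ?_))
  rw [sub_lt_iff_lt_add, div_lt_iff₀ D.δ_pos]; linarith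

theorem tilt_le (ρ : ℝ) : D.tilt i ρ ≤ D.slope i :=
  mul_le_of_le_one_right slope_pos.le (sub_le_self _ (Real.smoothTransition.nonneg _))

theorem timeDir_collar (hp : spatial p ∈ D.collar i) : D.timeDir p =
    Fin.cons 1 (-D.tilt i (norm3 (spatial p - D.a i)) • D.dir i (spatial p)) := by
  have hδ := D.δ_pos
  rw [timeDir, sum_eq_of_near D.sep
    (c := fun i y => -(D.tilt i (norm3 (y - D.a i)) / norm3 (y - D.a i)) • (y - D.a i))
    (fun k y h => by rw [tilt_of_ge (by linarith), zero_div, neg_zero, zero_smul])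
    (collar_subset_shell hp).2, dir, smul_smul, div_eq_mul_inv, neg_mul]

theorem timeDir_far (h : ∀ i, 2 * D.δ ≤ norm3 (spatial p - D.a i)) :
    D.timeDir p = Pi.single 0 1 := by
  rw [timeDir, Finset.sum_eq_zero fun k _ => by rw [tilt_of_ge (h k), zero_div, neg_zero, zero_smul]]
  ext c
  refine Fin.cases ?_ (fun k => ?_) c <;> simp

theorem timeDir_smoothOn : ContDiffOn ℝ ∞ D.timeDir D.domain := by
  intro p hp
  refine (contDiffAt_pi.2 fun c => Fin.cases ?_ (fun k => ?_) c).contDiffWithinAt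
  · exact contDiffAt_const
  · have h : ContDiffAt ℝ ∞ (fun y : Fin 3 → ℝ => ∑ i, -(D.tilt i (norm3 (y - D.a i)) /
        norm3 (y - D.a i)) • (y - D.a i)) (spatial p) := by
      refine ContDiffAt.sum fun i _ => ?_
      have h0 : 0 < norm3 (spatial p - D.a i) := by
        have := hp i
        linarith [D.δ_pos]
      have hn := contDiffAt_norm3_sub h0
      have hσ : ContDiff ℝ ∞ Real.smoothTransition := Real.smoothTransition.contDiff
      have h1 : ContDiffAt ℝ ∞ (fun x => Real.smoothTransition (norm3 (x - D.a i) / D.δ - 1))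
        (spatial p) := hσ.contDiffAt.comp _ ((hn.div_const D.δ).sub contDiffAt_const)
      exact (((contDiffAt_const.mul (contDiffAt_const.sub h1)).div hn h0.ne').neg).smul (by fun_prop)
    exact contDiffAt_spatial_comp (contDiffAt_pi.1 h k)

theorem gdot_static {s : (Fin 4 → ℝ) → ℝ} :
    gdot (staticMetric s p) X Y = -(s p)⁻¹ * (X 0 * Y 0) + s p * (spatial X ⬝ᵥ spatial Y) := by
  simp only [gdot, staticMetric, Matrix.diagonal_apply, dotProduct, spatial]
  simp [Fin.sum_univ_four, Fin.sum_univ_three]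
  ring

/-- The metric product in the exterior region, in terms of the static metric. -/
theorem gdot_fields_ext (hp : spatial p ∈ D.ext) (X Y : Fin 4 → ℝ) :
    gdot (D.fields.g p) X Y =
      -(D.conf (D.collapse (spatial p)))⁻¹ * ((Matrix.of (jac D.embInv p)).mulVec X 0 *
        (Matrix.of (jac D.embInv p)).mulVec Y 0) + D.conf (D.collapse (spatial p)) *
        (spatial ((Matrix.of (jac D.embInv p)).mulVec X) ⬝ᵥ
          spatial ((Matrix.of (jac D.embInv p)).mulVec Y)) := by
  rw [(fields_ext hp).1, exteriorFields_g_eq, gdot_pullback2, gdot_static, spatial_embInv]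

theorem jac_embInv_mulVec_time (hp : spatial p ∈ D.ext) :
    (Matrix.of (jac D.embInv p)).mulVec (Pi.single 0 1) = Pi.single 0 1 := by
  ext c
  rw [Matrix.mulVec_single_one]
  exact jac_embInv_time hp c

theorem spatial_single : spatial (Pi.single 0 1 : Fin 4 → ℝ) = 0 := by
  ext k; simp [spatial]

theorem gdot_fields_time_time (hp : spatial p ∈ D.ext) :
    gdot (D.fields.g p) (Pi.single 0 1) (Pi.single 0 1) < 0 := by
  rw [gdot_fields_ext hp, jac_embInv_mulVec_time hp, spatial_single]
  simp [conf_pos]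

theorem spatial_fin_cons (t : ℝ) (x : Fin 3 → ℝ) : spatial (Fin.cons t x : Fin 4 → ℝ) = x := rfl

theorem dir_dotProduct_self (hy : y ∈ D.shell i) : D.dir i y ⬝ᵥ D.dir i y = 1 := by
  rw [← dir_sq hy, dotProduct, Fin.sum_univ_three]; ring

theorem timeDir_timelike (hp : p ∈ D.domain) :
    gdot (D.fields.g p) (D.timeDir p) (D.timeDir p) < 0 := by
  rcases collar_or_far hp with ⟨i, hi⟩ | h
  · have hs := collar_subset_shell hi
    have hτ := timelike_aux hi (tilt_pos hi.2) (tilt_le (norm3 (spatial p - D.a i)))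
    rw [fields_g_collar hi, timeDir_collar hi, gdot_collarMetric]
    simp only [spatial_fin_cons, Fin.cons_zero, dotProduct_smul, smul_dotProduct,
      dir_dotProduct_self hs, smul_eq_mul, mul_one]
    have hK := regS_pos hi
    set β := D.tilt i (norm3 (spatial p - D.a i))
    rw [sub_self, mul_zero, add_zero]
    exact div_neg_of_neg_of_pos (by nlinarith) hK
  · rw [timeDir_far h]; exact gdot_fields_time_time (mem_ext_of_far h)

/-- In a collar the product is `-(r² + phi · tilt)/S`; outside the collars the two vectors coincide.
-/
theorem gdot_timeDir_time (hp : spatial p ∈ D.ext) :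
    gdot (D.fields.g p) (D.timeDir p) (Pi.single 0 1) < 0 := by
  rcases collar_or_far (ext_subset_extended hp) with ⟨i, hi⟩ | h
  · have hs := collar_subset_shell hi
    have hr : 0 < D.rad i (spatial p) := sub_pos.2 (hp i)
    rw [fields_g_collar hi, timeDir_collar hi, gdot_collarMetric, spatial_single]
    simp only [spatial_fin_cons, Fin.cons_zero, dotProduct_smul, dir_dotProduct_self hs, smul_eq_mul,
      mul_one, dotProduct_zero, mul_zero, sub_zero, add_zero, zero_add, Pi.single_eq_same]
    have h1 := mul_pos (phi_pos hi) (tilt_pos (i := i) hi.2)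
    exact div_neg_of_neg_of_pos (by nlinarith [pow_pos hr 2]) (regS_pos hi)
  · rw [timeDir_far h]; exact gdot_fields_time_time (mem_ext_of_far h)

/-! ### Connectedness -/

variable (D) in
/-- The same data with half the length scale. -/
noncomputable def half : CentreData N where
  G₀ := D.G₀
  Q₀ := D.Q₀
  γ := D.γ
  q := D.q
  a := D.a
  δ := D.δ / 2
  G₀_pos := D.G₀_pos
  Q₀_pos := D.Q₀_pos
  γ_pos := D.γ_pos
  q_pos := D.q_pos
  δ_pos := half_pos D.δ_pos
  sep := fun i j h => by linarith [D.sep i j h, D.δ_pos]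
  near_q := fun i x r h h' => D.near_q i x r (h.trans (half_le_self D.δ_pos.le))
    (h'.trans (half_le_self D.δ_pos.le))
  near_γ := fun i x r h h' => D.near_γ i x r (h.trans (half_le_self D.δ_pos.le))
    (h'.trans (half_le_self D.δ_pos.le))
  near_φ := fun i r h => D.near_φ i r (h.trans (half_le_self D.δ_pos.le))

/-- The extended region for `δ` is the exterior region for `δ/2`, so it is a continuous image of the
connected region `nullRegion`. The defining conditions of `CentreData` are inherited by smaller
lengths. -/
theorem isConnected_domain : IsConnected D.domain := by
  have : D.domain = D.half.emb '' nullRegion D.half.a := D.half.emb_image.symm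
  rw [this]
  exact (isConnected_nullRegion _).image _ fun p hp => (contDiffAt_emb hp).continuousAt.continuousWithinAt

theorem isSpacetime : IsSpacetime D.domain D.fields.g D.timeDir where
  isOpen := isOpen_domain
  connected := isConnected_domain
  smooth := fields_smoothOn.1
  lorentzian := fun _ => fields_lorentzian
  smooth_time := timeDir_smoothOn
  timelike := fun _ => timeDir_timelike

theorem isFieldEmbedding :
    IsFieldEmbedding (nullRegion D.a) (nullFields4 D.calG D.calQ) D.domain D.fields D.emb := by
  refine ⟨fun p hp => (contDiffAt_emb hp).contDiffWithinAt, fun p hp q hq h => ?_,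
    fun p hp => ext_subset_extended (emb_mem hp), fun p hp => ?_⟩
  · rw [← embInv_emb hp, h, embInv_emb hq]
  · have he := emb_mem hp
    obtain ⟨h1, h2, h3, h4, h5⟩ := fields_ext he
    refine ⟨fun h0 => ?_, ?_, ?_, ?_, ?_, ?_⟩
    · have := congrArg Matrix.det (jac_embInv_mul_jac_emb hp)
      rw [Matrix.det_mul, h0, mul_zero, Matrix.det_one] at this
      exact zero_ne_one this
    · rw [← pullback2_emb_embInv hp (nullFields4 D.calG D.calQ).g, pullback2_eq_mul, h1,
        pullback2_eq_mul D.emb (pullback2 _ _)]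
      rfl
    · rw [h2]; exact congrArg (nullFields4 D.calG D.calQ).Φ (embInv_emb hp)
    · rw [h3]; exact congrArg (nullFields4 D.calG D.calQ).ρ (embInv_emb hp)
    · rw [← pullback2_emb_embInv hp (nullFields4 D.calG D.calQ).F, pullback2_eq_mul, h4,
        pullback2_eq_mul D.emb (pullback2 _ _)]
      rfl
    · rw [← pullback2_emb_embInv hp (nullFields4 D.calG D.calQ).G, pullback2_eq_mul, h5,
        pullback2_eq_mul D.emb (pullback2 _ _)]
      rfl

theorem jac_emb_time_eq (hp : p ∈ nullRegion D.a) :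
    (fun c => jac D.emb p c 0) = (Pi.single 0 1 : Fin 4 → ℝ) := funext fun c => jac_emb_time hp c

theorem time_future (hp : p ∈ nullRegion D.a) :
    gdot (D.fields.g (D.emb p)) (D.timeDir (D.emb p)) (fun c => jac D.emb p c 0) < 0 := by
  rw [jac_emb_time_eq hp]; exact gdot_timeDir_time (emb_mem hp)

end CentreData

/-! ## Functions that decay like `1 / R`, with two derivatives -/

/-- Outside the ball of radius `R` the function is `O(1/r)`, its first derivatives are `O(1/r²)` and its
second derivatives are `O(1/r³)`. -/
def Decays (R : ℝ) (f : (Fin 3 → ℝ) → ℝ) : Prop :=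
  ∃ C : ℝ, 0 ≤ C ∧ ∀ x, R < norm3 x → ContDiffAt ℝ ∞ f x ∧ |f x| ≤ C * (norm3 x)⁻¹ ∧
    (∀ c, |pd c f x| ≤ C * (norm3 x)⁻¹ ^ 2) ∧ ∀ c d, |pd d (pd c f) x| ≤ C * (norm3 x)⁻¹ ^ 3

namespace Decays

variable {R : ℝ} {f h : (Fin 3 → ℝ) → ℝ}

theorem isOpen_region (R : ℝ) : IsOpen {x : Fin 3 → ℝ | R < norm3 x} :=
  isOpen_lt continuous_const continuous_norm3

theorem inv_mem (hR : 1 ≤ R) {x : Fin 3 → ℝ} (hx : R < norm3 x) :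
    0 < (norm3 x)⁻¹ ∧ (norm3 x)⁻¹ ≤ 1 :=
  ⟨inv_pos.2 (by linarith), inv_le_one_of_one_le₀ (by linarith)⟩

theorem zero : Decays R fun _ => 0 := by
  refine ⟨0, le_rfl, fun x _ => ⟨contDiffAt_const, by simp, fun c => ?_, fun c d => ?_⟩⟩
  · simp [pd_const]
  · have : pd c (fun _ : Fin 3 → ℝ => (0 : ℝ)) = fun _ => 0 := funext fun _ => pd_const c 0
    rw [this, pd_const]; simp

theorem add (hf : Decays R f) (hh : Decays R h) : Decays R fun x => f x + h x := by
  obtain ⟨C, hC, hf⟩ := hf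
  obtain ⟨B, hB, hh⟩ := hh
  refine ⟨C + B, by positivity, fun x hx => ?_⟩
  obtain ⟨f0, f1, f2, f3⟩ := hf x hx
  obtain ⟨h0, h1, h2, h3⟩ := hh x hx
  have e1 : ∀ c, pd c (fun x => f x + h x) x = pd c f x + pd c h x := (f0.diff.hasPd.add h0.diff.hasPd).2
  have e2 : ∀ c d, pd d (pd c fun x => f x + h x) x = pd d (pd c f) x + pd d (pd c h) x := fun c d => by
    rw [pd_congr_of_isOpen (isOpen_region R) hx (h := fun x => pd c f x + pd c h x) fun y hy =>
      ((hf y hy).1.diff.hasPd.add (hh y hy).1.diff.hasPd).2 c]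
    exact ((f0.pd c).diff.hasPd.add (h0.pd c).diff.hasPd).2 d
  refine ⟨f0.add h0, ?_, fun c => ?_, fun c d => ?_⟩
  · rw [add_mul]; exact (abs_add_le _ _).trans (add_le_add f1 h1)
  · rw [e1, add_mul]; exact (abs_add_le _ _).trans (add_le_add (f2 c) (h2 c))
  · rw [e2, add_mul]; exact (abs_add_le _ _).trans (add_le_add (f3 c d) (h3 c d))

theorem mul (hR : 1 ≤ R) (hf : Decays R f) (hh : Decays R h) : Decays R fun x => f x * h x := by
  obtain ⟨C, hC, hf⟩ := hf
  obtain ⟨B, hB, hh⟩ := hh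
  -- The second derivative of a product has four terms; each decays one power faster than needed,
  -- and `1/|x| ≤ 1`.
  refine ⟨4 * (C * B), by positivity, fun x hx => ?_⟩
  obtain ⟨f0, f1, f2, f3⟩ := hf x hx
  obtain ⟨h0, h1, h2, h3⟩ := hh x hx
  obtain ⟨t0, t1⟩ := inv_mem hR hx
  set t := (norm3 x)⁻¹
  have m : ∀ {a b : ℝ} {i j : ℕ}, |a| ≤ C * t ^ i → |b| ≤ B * t ^ j → |a * b| ≤ C * B * t ^ (i + j) :=
    fun {a b i j} ha hb => by
      rw [abs_mul, pow_add]
      calc |a| * |b| ≤ (C * t ^ i) * (B * t ^ j) := mul_le_mul ha hb (abs_nonneg _) (by positivity)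
        _ = _ := by ring
  rw [← pow_one t] at f1 h1
  have hCB : 0 ≤ C * B := by positivity
  have p : ∀ {i j : ℕ}, i ≤ j → C * B * t ^ j ≤ C * B * t ^ i := fun h =>
    mul_le_mul_of_nonneg_left (pow_le_pow_of_le_one t0.le t1 h) hCB
  have e1 : ∀ c, pd c (fun x => f x * h x) x = pd c f x * h x + f x * pd c h x :=
    (f0.diff.hasPd.mul h0.diff.hasPd).2
  have e2 : ∀ c d, pd d (pd c fun x => f x * h x) x = pd d (pd c f) x * h x + pd c f x * pd d h x
      + (pd d f x * pd c h x + f x * pd d (pd c h) x) := fun c d => by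
    rw [pd_congr_of_isOpen (isOpen_region R) hx (h := fun x => pd c f x * h x + f x * pd c h x)
      fun y hy => ((hf y hy).1.diff.hasPd.mul (hh y hy).1.diff.hasPd).2 c]
    exact (((f0.pd c).diff.hasPd.mul h0.diff.hasPd).add (f0.diff.hasPd.mul (h0.pd c).diff.hasPd)).2 d
  refine ⟨f0.mul h0, ?_, fun c => ?_, fun c d => ?_⟩
  · have k1 := m f1 h1
    have k2 := p (show 1 ≤ 1 + 1 by norm_num)
    have k3 : 0 ≤ C * B * t ^ 1 := by positivity
    rw [pow_one] at k2 k3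
    linarith
  · rw [e1]
    have k1 := m (f2 c) h1
    have k2 := m f1 (h2 c)
    have k3 := p (show 2 ≤ 2 + 1 by norm_num)
    have k4 : 0 ≤ C * B * t ^ 2 := by positivity
    refine (abs_add_le _ _).trans ?_
    rw [show 1 + 2 = 2 + 1 from rfl] at k2
    linarith
  · rw [e2]
    have k1 := m (f3 c d) h1
    have k2 := m (f2 c) (h2 d)
    have k3 := m (f2 d) (h2 c)
    have k4 := m f1 (h3 c d)
    have k5 := p (show 3 ≤ 3 + 1 by norm_num)
    rw [show 2 + 2 = 3 + 1 from rfl] at k2 k3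
    rw [show 1 + 3 = 3 + 1 from rfl] at k4
    refine (abs_add_le _ _).trans ((add_le_add (abs_add_le _ _) (abs_add_le _ _)).trans ?_)
    linarith

/-- Composition with a function whose first two derivatives are bounded on the half-line. -/
theorem comp (hR : 1 ≤ R) (hf : Decays R f) (hpos : ∀ x, R < norm3 x → 0 ≤ f x) {k k' k'' : ℝ → ℝ}
    (hk : ∀ t, 0 ≤ t → ContDiffAt ℝ ∞ k t) (hk' : ∀ t, -1 < t → HasDerivAt k (k' t) t)
    (hk'' : ∀ t, 0 ≤ t → HasDerivAt k' (k'' t) t) (b0 : ∀ t, 0 ≤ t → |k t| ≤ t)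
    (b1 : ∀ t, 0 ≤ t → |k' t| ≤ 1) (b2 : ∀ t, 0 ≤ t → |k'' t| ≤ 1) : Decays R fun x => k (f x) := by
  obtain ⟨C, hC, hf⟩ := hf
  -- `C²` bounds `k''` times two first derivatives of `f`, and `C` bounds `k'` times a second
  -- derivative.
  refine ⟨C ^ 2 + C, by positivity, fun x hx => ?_⟩
  obtain ⟨f0, f1, f2, f3⟩ := hf x hx
  have hx0 := hpos x hx
  obtain ⟨t0, t1⟩ := inv_mem hR hx
  set t := (norm3 x)⁻¹
  have e1 : ∀ c, pd c (fun x => k (f x)) x = k' (f x) * pd c f x :=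
    (HasPd.comp (hk' _ (by linarith)) f0.diff.hasPd).2
  have e2 : ∀ c d, pd d (pd c fun x => k (f x)) x = k'' (f x) * pd d f x * pd c f x
      + k' (f x) * pd d (pd c f) x := fun c d => by
    rw [pd_congr_of_isOpen (isOpen_region R) hx (h := fun x => k' (f x) * pd c f x) fun y hy =>
      (HasPd.comp (hk' _ (by linarith [hpos y hy])) (hf y hy).1.diff.hasPd).2 c]
    exact ((HasPd.comp (hk'' _ hx0) f0.diff.hasPd).mul (f0.pd c).diff.hasPd).2 d
  refine ⟨(hk _ hx0).comp x f0, ?_, fun c => ?_, fun c d => ?_⟩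
  · rw [abs_of_nonneg hx0] at f1
    refine (b0 _ hx0).trans (f1.trans ?_)
    nlinarith [sq_nonneg C]
  · rw [e1, abs_mul]
    have := mul_le_mul (b1 _ hx0) (f2 c) (abs_nonneg _) zero_le_one
    have h2 : 0 ≤ C ^ 2 * t ^ 2 := by positivity
    linarith
  · rw [e2]
    refine (abs_add_le _ _).trans ?_
    rw [abs_mul, abs_mul, abs_mul]
    have k1 := mul_le_mul (b1 _ hx0) (f3 c d) (abs_nonneg _) zero_le_one
    have k2 := mul_le_mul (mul_le_mul (b2 _ hx0) (f2 d) (abs_nonneg _) zero_le_one) (f2 c) (abs_nonneg _)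
      (by positivity)
    have k3 : C ^ 2 * t ^ 4 ≤ C ^ 2 * t ^ 3 :=
      mul_le_mul_of_nonneg_left (pow_le_pow_of_le_one t0.le t1 (by norm_num)) (sq_nonneg C)
    linarith

theorem inv_norm3_sub {b : Fin 3 → ℝ} (hR : 1 ≤ R) (hb : 2 * norm3 b ≤ R) :
    Decays R fun x => (norm3 (x - b))⁻¹ := by
  -- Since `2|b| ≤ R`, `|x - b|⁻¹ ≤ 2|x|⁻¹`. For second derivatives this costs `2³`, and the angular
  -- coefficient is at most `4`.
  refine ⟨32, by norm_num, fun x hx => ?_⟩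
  have hx0 : 0 < norm3 x := by linarith
  have h1 : norm3 x / 2 ≤ norm3 (x - b) := by
    have := norm3_add_le (x - b) b
    rw [sub_add_cancel] at this
    linarith
  have hs0 : 0 < norm3 (x - b) := by linarith
  have hne : x ≠ b := sub_ne_zero.1 (norm3_pos.1 hs0)
  have hle : (norm3 (x - b))⁻¹ ≤ 2 * (norm3 x)⁻¹ := by
    rw [← div_eq_mul_inv, le_div_iff₀ hx0, inv_mul_le_iff₀ hs0]; linarith
  have e1 : ∀ c y, y ≠ b → pd c (fun x => (norm3 (x - b))⁻¹) y
      = -(y - b) c / norm3 (y - b) ^ 3 := fun c y hy =>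
    (sub_map_hasPd b y (hasPd_inv_norm3 (sub_ne_zero.2 hy))).2 c
  have e2 : ∀ c d, pd d (pd c fun x => (norm3 (x - b))⁻¹) x = 3 * (x - b) c * (x - b) d /
      norm3 (x - b) ^ 5 - (if d = c then 1 else 0) / norm3 (x - b) ^ 3 := fun c d => by
    rw [pd_congr_of_isOpen isOpen_ne hne (h := fun y => -(y - b) c / norm3 (y - b) ^ 3)
      fun y hy => e1 c y hy]
    exact (sub_map_hasPd b x (hasPd_pd_inv_norm3 c (sub_ne_zero.2 hne))).2 d
  have hc := abs_le_norm3 (x - b)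
  set s := norm3 (x - b)
  set z := x - b
  have q : ∀ c, |z c / s| ≤ 1 := fun c => by
    rw [abs_div, abs_of_pos hs0, div_le_one hs0]; exact hc c
  have hi : 0 < s⁻¹ := inv_pos.2 hs0
  have ht : 0 < (norm3 x)⁻¹ := inv_pos.2 hx0
  have p2 : s⁻¹ ^ 2 ≤ 4 * (norm3 x)⁻¹ ^ 2 := by
    calc s⁻¹ ^ 2 ≤ (2 * (norm3 x)⁻¹) ^ 2 := pow_le_pow_left₀ hi.le hle 2
      _ = _ := by ring
  have p3 : s⁻¹ ^ 3 ≤ 8 * (norm3 x)⁻¹ ^ 3 := by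
    calc s⁻¹ ^ 3 ≤ (2 * (norm3 x)⁻¹) ^ 3 := pow_le_pow_left₀ hi.le hle 3
      _ = _ := by ring
  refine ⟨contDiffAt_inv_norm3_sub hne, ?_, fun c => ?_, fun c d => ?_⟩
  · rw [abs_of_pos hi]; linarith
  · rw [e1 c x hne]
    have : -z c / s ^ 3 = -(z c / s) * s⁻¹ ^ 2 := by field_simp
    rw [this, abs_mul, abs_neg, abs_of_pos (pow_pos hi 2)]
    have := mul_le_mul (q c) p2 (by positivity) zero_le_one
    have h2 : 0 ≤ (norm3 x)⁻¹ ^ 2 := by positivity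
    linarith
  · rw [e2]
    have : 3 * z c * z d / s ^ 5 - (if d = c then 1 else 0) / s ^ 3
        = (3 * (z c / s) * (z d / s) - (if d = c then 1 else 0)) * s⁻¹ ^ 3 := by
      generalize (if d = c then (1 : ℝ) else 0) = e
      field_simp
    rw [this, abs_mul, abs_of_pos (pow_pos hi 3)]
    have k1 : |3 * (z c / s) * (z d / s) - (if d = c then (1 : ℝ) else 0)| ≤ 4 := by
      refine (abs_sub _ _).trans ?_
      rw [abs_mul, abs_mul, abs_of_pos (show (0 : ℝ) < 3 by norm_num)]
      have k2 := mul_le_mul (q c) (q d) (abs_nonneg _) zero_le_one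
      have k3 : |(if d = c then (1 : ℝ) else 0)| ≤ 1 := by split_ifs <;> simp
      linarith
    have := mul_le_mul k1 p3 (by positivity) (by norm_num)
    linarith

theorem const_mul (k : ℝ) (hf : Decays R f) : Decays R fun x => k * f x := by
  obtain ⟨C, hC, hf⟩ := hf
  refine ⟨|k| * C, by positivity, fun x hx => ?_⟩
  obtain ⟨f0, f1, f2, f3⟩ := hf x hx
  have e2 : ∀ c d, pd d (pd c fun x => k * f x) x = k * pd d (pd c f) x := fun c d => by
    rw [pd_congr_of_isOpen (isOpen_region R) hx (h := fun x => k * pd c f x) fun y hy =>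
      ((hf y hy).1.diff.hasPd.const_mul k).2 c]
    exact ((f0.pd c).diff.hasPd.const_mul k).2 d
  refine ⟨contDiffAt_const.mul f0, ?_, fun c => ?_, fun c d => ?_⟩
  · rw [abs_mul, mul_assoc]; exact mul_le_mul_of_nonneg_left f1 (abs_nonneg k)
  · rw [(f0.diff.hasPd.const_mul k).2 c, abs_mul, mul_assoc]
    exact mul_le_mul_of_nonneg_left (f2 c) (abs_nonneg k)
  · rw [e2, abs_mul, mul_assoc]; exact mul_le_mul_of_nonneg_left (f3 c d) (abs_nonneg k)

theorem sum {ι : Type*} (s : Finset ι) {f : ι → (Fin 3 → ℝ) → ℝ}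
    (hf : ∀ i ∈ s, Decays R (f i)) : Decays R fun x => ∑ i ∈ s, f i x := by
  classical
  induction s using Finset.induction_on with
  | empty => simpa using zero
  | insert i s hi ih =>
    simp only [Finset.sum_insert hi]
    exact (hf i (Finset.mem_insert_self i s)).add (ih fun j hj => hf j (Finset.mem_insert_of_mem hj))

theorem sqrt_one_add (hR : 1 ≤ R) (hf : Decays R f) (hpos : ∀ x, R < norm3 x → 0 ≤ f x) :
    Decays R fun x => √(1 + f x) - 1 := by
  have hs : ∀ t : ℝ, 0 ≤ t → 1 ≤ √(1 + t) := fun t ht => Real.one_le_sqrt.2 (by linarith)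
  refine hf.comp hR hpos (k := fun t => √(1 + t) - 1) (k' := fun t => 1 / (2 * √(1 + t)))
    (k'' := fun t => -(1 / (4 * ((1 + t) * √(1 + t))))) (fun t ht => ?_) (fun t ht => ?_)
    (fun t ht => ?_) (fun t ht => ?_) (fun t ht => ?_) fun t ht => ?_
  · exact ((contDiffAt_const.add contDiffAt_id).sqrt (by positivity)).sub contDiffAt_const
  · exact (((hasDerivAt_id t).const_add 1).sqrt (by simp; linarith)).sub_const 1
  · have h0 : (0 : ℝ) < 1 + t := by linarith
    have h1 := (((hasDerivAt_id t).const_add 1).sqrt h0.ne').const_mul 2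
    refine ((h1.inv (by have := hs t ht; simp; positivity)).congr_deriv ?_).congr_of_eventuallyEq ?_
    · simp only [id]
      have h2 := Real.sq_sqrt h0.le
      have h3 : 0 < √(1 + t) := Real.sqrt_pos.2 h0
      rw [mul_pow, h2]; field_simp; norm_num
    · exact Eventually.of_forall fun s => by simp [one_div]
  · have h1 := hs t ht
    have h2 := Real.sq_sqrt (show 0 ≤ 1 + t by linarith)
    rw [abs_of_nonneg (by linarith)]
    nlinarith
  · have h1 := hs t ht
    rw [abs_of_nonneg (by positivity), div_le_one (by positivity)]; linarith
  · have h1 := hs t ht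
    rw [abs_neg, abs_of_nonneg (by positivity), div_le_one (by positivity)]
    nlinarith

theorem inv_one_add (hR : 1 ≤ R) (hf : Decays R f) (hpos : ∀ x, R < norm3 x → 0 ≤ f x) :
    Decays R fun x => 1 - (1 + f x)⁻¹ := by
  -- The second derivative of `1 - (1 + t)⁻¹` is bounded only by `2`; halving the function meets the
  -- bounds required by `Decays.comp`.
  have key : Decays R fun x => (1 / 2) * (1 - (1 + f x)⁻¹) := by
    refine hf.comp hR hpos (k := fun t => (1 / 2) * (1 - (1 + t)⁻¹))
      (k' := fun t => (1 / 2) * ((1 + t) ^ 2)⁻¹) (k'' := fun t => -((1 + t) ^ 3)⁻¹) (fun t ht => ?_)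
      (fun t ht => ?_) (fun t ht => ?_) (fun t ht => ?_) (fun t ht => ?_) fun t ht => ?_
    · exact contDiffAt_const.mul (contDiffAt_const.sub
        ((contDiffAt_const.add contDiffAt_id).inv (by positivity)))
    · have h0 : (0 : ℝ) < 1 + t := by linarith
      refine (((((hasDerivAt_id t).const_add 1).inv h0.ne').const_sub 1).const_mul (1 / 2)).congr_deriv ?_
      simp; ring
    · have h0 : (0 : ℝ) < 1 + t := by linarith
      refine (((((hasDerivAt_id t).const_add 1).pow 2).inv (by simp; positivity)).const_mul
        (1 / 2)).congr_deriv ?_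
      simp; field_simp
    · have h0 : (0 : ℝ) < 1 + t := by linarith
      have e : (1 / 2 : ℝ) * (1 - (1 + t)⁻¹) = t / (2 * (1 + t)) := by field_simp; ring
      rw [e, abs_of_nonneg (by positivity), div_le_iff₀ (by positivity)]
      nlinarith
    · have h1 : ((1 + t) ^ 2)⁻¹ ≤ 1 := inv_le_one_of_one_le₀ (one_le_pow₀ (by linarith))
      have h2 : 0 ≤ ((1 + t) ^ 2)⁻¹ := by positivity
      rw [abs_of_nonneg (by positivity)]; linarith
    · have h1 : ((1 + t) ^ 3)⁻¹ ≤ 1 := inv_le_one_of_one_le₀ (one_le_pow₀ (by linarith))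
      have h2 : 0 ≤ ((1 + t) ^ 3)⁻¹ := by positivity
      rw [abs_neg, abs_of_nonneg h2]; exact h1
  have := key.const_mul 2
  simpa [← mul_assoc] using this

end Decays

theorem decays_multiCentre {N : ℕ} {R : ℝ} (hR : 1 ≤ R) {a : Fin N → Fin 3 → ℝ}
    (ha : ∀ i, 2 * norm3 (a i) ≤ R) (m : Fin N → ℝ) : Decays R (multiCentre 0 m a) := by
  have h := Decays.sum Finset.univ (f := fun i x => m i * (norm3 (x - a i))⁻¹)
    fun i _ => (Decays.inv_norm3_sub hR (ha i)).const_mul (m i)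
  refine (show multiCentre 0 m a = _ from ?_) ▸ h
  funext x
  simp [multiCentre, div_eq_mul_inv]

/-! ### The conformal factor near infinity -/

namespace CentreData

variable {N : ℕ} {D : CentreData N}

theorem multiCentre_eq_const_add {c : ℝ} {m : Fin N → ℝ} {a : Fin N → Fin 3 → ℝ} (hc : c ≠ 0)
    (x : Fin 3 → ℝ) : multiCentre c m a x = c * (1 + c⁻¹ * multiCentre 0 m a x) := by
  simp only [multiCentre]; field_simp; ring

/-- The conformal factor tends to its value at infinity. -/
theorem exists_decays_conf (hQG : D.Q₀ * D.G₀ ^ 3 = 1 / D.Q₀ ^ 2) {R : ℝ} (hR : 1 ≤ R)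
    (ha : ∀ i, 2 * norm3 (D.a i) ≤ R) :
    ∃ f : (Fin 3 → ℝ) → ℝ, Decays R f ∧ (∀ x, 0 ≤ f x) ∧ ∀ x, D.Q₀ * D.conf x = 1 + f x := by
  have hQ := D.Q₀_pos
  have hG := D.G₀_pos
  set f₁ : (Fin 3 → ℝ) → ℝ := fun x => D.Q₀⁻¹ * multiCentre 0 D.q D.a x with hf₁
  set f₂ : (Fin 3 → ℝ) → ℝ := fun x => D.G₀⁻¹ * multiCentre 0 D.γ D.a x with hf₂
  have mc : ∀ {m : Fin N → ℝ}, (∀ i, 0 < m i) → ∀ x, 0 ≤ multiCentre 0 m D.a x := fun hm x => by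
    rw [multiCentre, zero_add]
    exact Finset.sum_nonneg fun i _ => div_nonneg (hm i).le (norm3_nonneg _)
  have p₁ : ∀ x, 0 ≤ f₁ x := fun x => mul_nonneg (inv_nonneg.2 hQ.le) (mc D.q_pos x)
  have p₂ : ∀ x, 0 ≤ f₂ x := fun x => mul_nonneg (inv_nonneg.2 hG.le) (mc D.γ_pos x)
  have d₁ : Decays R f₁ := (decays_multiCentre hR ha D.q).const_mul _
  have d₂ : Decays R f₂ := (decays_multiCentre hR ha D.γ).const_mul _
  -- The expansion of `(1 + f₁)(1 + f₂)³ - 1`, arranged as sums of products of decaying nonnegative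
  -- functions.
  set W : (Fin 3 → ℝ) → ℝ := fun x => f₁ x + (3 * f₂ x + (3 * (f₂ x * f₂ x) + f₂ x * (f₂ x * f₂ x))
    + f₁ x * (3 * f₂ x + (3 * (f₂ x * f₂ x) + f₂ x * (f₂ x * f₂ x)))) with hW
  have dW : Decays R W := by
    have d22 := d₂.mul hR d₂
    have d3 := (d₂.const_mul 3).add ((d22.const_mul 3).add (d₂.mul hR d22))
    exact d₁.add (d3.add (d₁.mul hR d3))
  have pW : ∀ x, 0 ≤ W x := fun x => by have := p₁ x; have := p₂ x; simp only [hW]; positivity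
  refine ⟨fun x => √(1 + W x) - 1, dW.sqrt_one_add hR fun x _ => pW x, fun x => ?_, fun x => ?_⟩
  · exact sub_nonneg.2 (Real.one_le_sqrt.2 (by linarith [pW x]))
  · rw [add_sub_cancel, conf, calQ, calG, multiCentre_eq_const_add hQ.ne' x,
      multiCentre_eq_const_add hG.ne' x]
    have e : -(-(D.Q₀ * (1 + D.Q₀⁻¹ * multiCentre 0 D.q D.a x)) *
        (D.G₀ * (1 + D.G₀⁻¹ * multiCentre 0 D.γ D.a x)) ^ 3) = (1 + W x) / D.Q₀ ^ 2 := by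
      have : (1 + W x) = (1 + f₁ x) * (1 + f₂ x) ^ 3 := by simp only [hW]; ring
      rw [this]
      simp only [hf₁, hf₂]
      linear_combination (1 + D.Q₀⁻¹ * multiCentre 0 D.q D.a x) *
        (1 + D.G₀⁻¹ * multiCentre 0 D.γ D.a x) ^ 3 * hQG
    rw [e, Real.sqrt_div' _ (by positivity), Real.sqrt_sq hQ.le]
    field_simp

end CentreData

/-! ## The asymptotically flat end -/

theorem hasPd_spatial_smul {f : (Fin 3 → ℝ) → ℝ} {d : Fin 3 → ℝ} {κ : ℝ} {u : Fin 4 → ℝ}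
    (hf : HasPd f d (κ • spatial u)) :
    HasPd (fun u => f (κ • spatial u)) (Fin.cons 0 (κ • d) : Fin 4 → ℝ) u := by
  have h : HasPd (fun x => f (κ • x)) (κ • d) (spatial u) := by
    refine (hf.comp_map (φ := fun x => κ • x) (by fun_prop)).congr_deriv fun a => ?_
    have : jac (fun x : Fin 3 → ℝ => κ • x) (spatial u) = fun c a => κ * if a = c then 1 else 0 :=
      jac_eq_of_hasPd fun c => (hasPd_coord c).const_mul κ
    simp [this]
  exact h.spatial

theorem Decays.spatial {R κ : ℝ} {f : (Fin 3 → ℝ) → ℝ} (hf : Decays R f) (hκ : 0 < κ) :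
    ∃ C : ℝ, 0 ≤ C ∧ ∀ u : Fin 4 → ℝ, R < κ * norm3 (_root_.spatial u) →
      |f (κ • _root_.spatial u)| ≤ C * (norm3 (_root_.spatial u))⁻¹ ∧
      (∀ c, |pd c (fun u => f (κ • _root_.spatial u)) u| ≤ C * (norm3 (_root_.spatial u))⁻¹ ^ 2) ∧
      ∀ c d, |pd d (pd c fun u => f (κ • _root_.spatial u)) u| ≤
        C * (norm3 (_root_.spatial u))⁻¹ ^ 3 := by
  obtain ⟨C, hC, hf⟩ := hf
  refine ⟨C * κ⁻¹, by positivity, fun u hu => ?_⟩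
  have hn : ∀ u : Fin 4 → ℝ, norm3 (κ • _root_.spatial u) = κ * norm3 (_root_.spatial u) := fun u => by
    rw [norm3_smul, abs_of_pos hκ]
  obtain ⟨f0, f1, f2, f3⟩ := hf _ (hu.trans_eq (hn u).symm)
  rw [hn, mul_inv] at f1 f2 f3
  have hU : IsOpen {u : Fin 4 → ℝ | R < κ * norm3 (_root_.spatial u)} :=
    isOpen_lt continuous_const (continuous_const.mul (continuous_norm3.comp continuous_spatial))
  have e1 : ∀ u : Fin 4 → ℝ, R < κ * norm3 (_root_.spatial u) → ∀ k : Fin 3,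
      pd k.succ (fun u => f (κ • _root_.spatial u)) u = κ * pd k f (κ • _root_.spatial u) :=
    fun u hu k => (hasPd_spatial_smul (hf _ (hu.trans_eq (hn u).symm)).1.diff.hasPd).2 k.succ
  have e0 : ∀ u : Fin 4 → ℝ, R < κ * norm3 (_root_.spatial u) →
      pd 0 (fun u => f (κ • _root_.spatial u)) u = 0 :=
    fun u hu => (hasPd_spatial_smul (hf _ (hu.trans_eq (hn u).symm)).1.diff.hasPd).2 0
  set t := (norm3 (_root_.spatial u))⁻¹
  have ht : 0 ≤ t := inv_nonneg.2 (norm3_nonneg _)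
  refine ⟨by rw [mul_assoc]; exact f1, fun c => ?_, fun c d => ?_⟩
  · refine Fin.cases ?_ (fun k => ?_) c
    · rw [e0 u hu, abs_zero]; positivity
    · rw [e1 u hu, abs_mul, abs_of_pos hκ]
      refine (mul_le_mul_of_nonneg_left (f2 k) hκ.le).trans (le_of_eq ?_)
      field_simp
  · refine Fin.cases ?_ (fun k => ?_) c
    · rw [pd_congr_of_isOpen hU hu (h := fun _ => 0) e0, pd_const, abs_zero]; positivity
    · have h2 : HasPd (pd k.succ fun u => f (κ • _root_.spatial u)) _ u :=
        ((hasPd_spatial_smul (f0.pd k).diff.hasPd).const_mul κ).congr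
          (eventually_of_mem (hU.mem_nhds hu) fun u hu => e1 u hu k)
      rw [h2.2]
      refine Fin.cases ?_ (fun l => ?_) d
      · simp only [Fin.cons_zero, mul_zero, abs_zero]; positivity
      · simp only [Fin.cons_succ, Pi.smul_apply, smul_eq_mul]
        rw [abs_mul, abs_mul, abs_of_pos hκ]
        refine (mul_le_mul_of_nonneg_left (mul_le_mul_of_nonneg_left (f3 k l) hκ.le) hκ.le).trans
          (le_of_eq ?_)
        field_simp

namespace CentreData

variable {N : ℕ} (D : CentreData N)

/-- Outside the ball of this radius the embedding is the identity. -/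
noncomputable def outer : ℝ := 1 + 4 * D.δ + ∑ i, 2 * norm3 (D.a i)

/-- The scale factors of the asymptotically Minkowskian coordinates. -/
noncomputable def endScale : Fin 4 → ℝ := Fin.cons (√D.Q₀)⁻¹ fun _ => √D.Q₀

/-- The asymptotically Minkowskian coordinates. -/
noncomputable def endMap (u : Fin 4 → ℝ) : Fin 4 → ℝ := fun c => D.endScale c * u c

/-- The inner radius of the asymptotic end. -/
noncomputable def endRadius : ℝ := D.outer / √D.Q₀

variable {D} {x y : Fin 3 → ℝ} {p u : Fin 4 → ℝ}

theorem two_norm3_le_outer (i : Fin N) : 2 * norm3 (D.a i) ≤ D.outer := by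
  have := Finset.single_le_sum (f := fun i => 2 * norm3 (D.a i))
    (fun i _ => mul_nonneg zero_le_two (norm3_nonneg _)) (Finset.mem_univ i)
  rw [outer]
  have := D.δ_pos
  linarith

theorem one_le_outer : 1 ≤ D.outer := by
  have := Finset.sum_nonneg (s := Finset.univ) (f := fun i => 2 * norm3 (D.a i))
    (fun i _ => mul_nonneg zero_le_two (norm3_nonneg _))
  rw [outer]
  linarith [D.δ_pos]

theorem lt_norm3_of_outer (hx : D.outer < norm3 x) (i : Fin N) : 4 * D.δ < norm3 (x - D.a i) := by
  have h1 := Finset.single_le_sum (f := fun i => 2 * norm3 (D.a i))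
    (fun i _ => mul_nonneg zero_le_two (norm3_nonneg _)) (Finset.mem_univ i)
  have h2 := norm3_add_le (x - D.a i) (D.a i)
  rw [sub_add_cancel] at h2
  rw [outer] at hx
  have := norm3_nonneg (D.a i)
  linarith

theorem mem_ext_of_outer (hx : D.outer < norm3 x) : x ∈ D.ext := fun i => by
  linarith [lt_norm3_of_outer hx i, D.δ_pos]

theorem collapse_of_outer (hx : D.outer < norm3 x) : D.collapse x = x :=
  radialMap_far profile_ge fun i => by linarith [lt_norm3_of_outer hx i, D.δ_pos]

theorem shift_of_outer (hx : D.outer < norm3 x) : D.shift x = 0 := by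
  refine Finset.sum_eq_zero fun i _ => ?_
  have hδ := D.δ_pos
  rw [shiftProfile, Real.smoothTransition.one_of_one_le, sub_self, mul_zero]
  rw [le_sub_iff_add_le, le_div_iff₀ hδ]; linarith [lt_norm3_of_outer hx i]

theorem embInv_of_outer (hp : D.outer < norm3 (spatial p)) : D.embInv p = p := by
  rw [embInv, stationaryMap, collapse_of_outer hp, shift_of_outer hp, neg_zero, add_zero, cons_spatial]

theorem isOpen_outer : IsOpen {p : Fin 4 → ℝ | D.outer < norm3 (spatial p)} :=
  isOpen_lt continuous_const (continuous_norm3.comp continuous_spatial)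

theorem fields_g_outer (hp : D.outer < norm3 (spatial p)) :
    D.fields.g p = staticMetric (fun q => D.conf (spatial q)) p := by
  rw [(fields_ext (mem_ext_of_outer hp)).1, exteriorFields_g_eq]
  exact pullback2_id_of_eventually _
    (eventually_of_mem (isOpen_outer.mem_nhds hp) fun q hq => embInv_of_outer hq)

theorem sqrt_Q₀_pos : 0 < √D.Q₀ := Real.sqrt_pos.2 D.Q₀_pos

theorem endScale_pos (c : Fin 4) : 0 < D.endScale c := by
  refine Fin.cases ?_ (fun k => ?_) c
  · exact inv_pos.2 sqrt_Q₀_pos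
  · exact sqrt_Q₀_pos

theorem spatial_endMap : spatial (D.endMap u) = √D.Q₀ • spatial u := rfl

theorem norm3_endMap : norm3 (spatial (D.endMap u)) = √D.Q₀ * norm3 (spatial u) := by
  rw [spatial_endMap, norm3_smul, abs_of_pos sqrt_Q₀_pos]

theorem outer_lt_endMap : u ∈ exteriorRegion D.endRadius ↔ D.outer < norm3 (spatial (D.endMap u)) := by
  rw [norm3_endMap, exteriorRegion, Set.mem_ofPred_eq, endRadius, div_lt_iff₀' sqrt_Q₀_pos]

theorem jac_endMap : jac D.endMap u = fun c a => D.endScale c * if a = c then 1 else 0 :=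
  jac_eq_of_hasPd fun c => (hasPd_coord c).const_mul _

theorem of_jac_endMap : Matrix.of (jac D.endMap u) = Matrix.diagonal D.endScale := by
  ext c a
  rw [jac_endMap, Matrix.of_apply, Matrix.diagonal_apply]
  by_cases h : c = a
  · simp [h]
  · simp [h, Ne.symm h]

theorem contDiff_endMap : ContDiff ℝ ∞ D.endMap :=
  contDiff_pi.2 fun c => contDiff_const.mul (contDiff_apply ℝ ℝ c)

theorem exists_endMap (p : Fin 4 → ℝ) : ∃ u, D.endMap u = p :=
  ⟨fun c => (D.endScale c)⁻¹ * p c, funext fun c => by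
    rw [endMap, mul_inv_cancel_left₀ (endScale_pos c).ne']⟩

theorem endMap_injective : Function.Injective D.endMap := fun _ _ h => funext fun c =>
  mul_left_cancel₀ (endScale_pos c).ne' (congrFun h c)

theorem endMap_image (R : ℝ) : D.endMap '' {u | R ≤ norm3 (spatial u)} =
    {p | √D.Q₀ * R ≤ norm3 (spatial p)} := by
  ext p
  constructor
  · rintro ⟨u, hu, rfl⟩
    rw [Set.mem_ofPred_eq, norm3_endMap]
    exact mul_le_mul_of_nonneg_left hu sqrt_Q₀_pos.le
  · intro hp
    obtain ⟨u, rfl⟩ := exists_endMap (D := D) p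
    rw [Set.mem_ofPred_eq, norm3_endMap] at hp
    exact ⟨u, le_of_mul_le_mul_left hp sqrt_Q₀_pos, rfl⟩

theorem endMap_exteriorRegion : D.endMap '' exteriorRegion D.endRadius =
    {p | D.outer < norm3 (spatial p)} := by
  ext p
  constructor
  · rintro ⟨u, hu, rfl⟩; exact outer_lt_endMap.1 hu
  · intro hp
    obtain ⟨u, rfl⟩ := exists_endMap (D := D) p
    exact ⟨u, outer_lt_endMap.2 hp, rfl⟩

/-- The scale factors turn the diagonal entries into `-(Q₀ conf)⁻¹` and `Q₀ conf`. The normalisation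
`G₀ = Q₀⁻¹` is what makes `Q₀ conf` tend to `1`. -/
theorem exists_falloff (hL : D.G₀ = D.Q₀⁻¹) (a b : Fin 4) : ∃ f : (Fin 3 → ℝ) → ℝ, Decays D.outer f ∧
    ∀ u ∈ exteriorRegion D.endRadius,
      pullback2 D.endMap D.fields.g u a b = f (√D.Q₀ • spatial u) + minkowski a b := by
  have hQ := D.Q₀_pos
  obtain ⟨f, hf, hf0, hfe⟩ := exists_decays_conf (D := D) (by rw [hL]; field_simp) one_le_outer
    two_norm3_le_outer
  have hinv := hf.inv_one_add one_le_outer fun x _ => hf0 x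
  have hg : ∀ u ∈ exteriorRegion D.endRadius, pullback2 D.endMap D.fields.g u =
      Matrix.diagonal fun c => D.endScale c ^ 2 * ![-(D.conf (√D.Q₀ • spatial u))⁻¹,
        D.conf (√D.Q₀ • spatial u), D.conf (√D.Q₀ • spatial u), D.conf (√D.Q₀ • spatial u)] c := by
    intro u hu
    rw [pullback2_eq_mul, of_jac_endMap, fields_g_outer (outer_lt_endMap.1 hu), staticMetric,
      Matrix.diagonal_transpose, Matrix.diagonal_mul_diagonal, Matrix.diagonal_mul_diagonal,
      spatial_endMap]
    congr 1
    funext c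
    ring
  have hs := Real.sq_sqrt hQ.le
  by_cases hab : a = b
  · subst hab
    refine Fin.cases ?_ (fun k => ?_) a
    · refine ⟨_, hinv, fun u hu => ?_⟩
      rw [hg u hu, Matrix.diagonal_apply_eq, ← hfe]
      simp [endScale, minkowski, hs]
      ring
    · refine ⟨_, hf, fun u hu => ?_⟩
      rw [hg u hu, Matrix.diagonal_apply_eq]
      have e := hfe (√D.Q₀ • spatial u)
      rw [show D.endScale k.succ = √D.Q₀ from rfl, hs]
      fin_cases k <;> simp [minkowski] <;> linarith
  · refine ⟨_, Decays.zero, fun u hu => ?_⟩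
    rw [hg u hu, Matrix.diagonal_apply_ne _ hab, minkowski, Matrix.diagonal_apply_ne _ hab, add_zero]

theorem isOpen_exteriorRegion (R : ℝ) : IsOpen (exteriorRegion R) :=
  isOpen_lt continuous_const (continuous_norm3.comp continuous_spatial)

theorem endRadius_pos : 0 < D.endRadius :=
  div_pos (by linarith [D.one_le_outer]) sqrt_Q₀_pos

theorem isAFEnd (hL : D.G₀ = D.Q₀⁻¹) : IsAFEnd D.domain D.fields.g D.endRadius D.endMap where
  radius_pos := endRadius_pos
  smooth := contDiff_endMap.contDiffOn
  injOn := endMap_injective.injOn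
  immersion := fun u _ => by
    rw [of_jac_endMap, Matrix.det_diagonal]
    exact Finset.prod_ne_zero_iff.2 fun c _ => (endScale_pos c).ne'
  mapsTo := fun u hu => ext_subset_extended (mem_ext_of_outer (outer_lt_endMap.1 hu))
  isEnd := fun R₁ _ => by
    have hc : IsClosed {p : Fin 4 → ℝ | √D.Q₀ * R₁ ≤ norm3 (spatial p)} :=
      isClosed_le continuous_const (continuous_norm3.comp continuous_spatial)
    rw [endMap_image, hc.closure_eq]
    exact inter_subset_left
  falloff := by
    choose f hf hfg using exists_falloff (D := D) hL
    choose C hC hb using fun a b => (hf a b).spatial sqrt_Q₀_pos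
    -- The decay rate is `α = 1`; the sum of the constants of all components serves every component.
    refine ⟨1, ∑ a, ∑ b, C a b, D.endRadius + 1, one_pos, by linarith, fun u hu a b => ?_⟩
    have hu' : u ∈ exteriorRegion D.endRadius := by
      rw [exteriorRegion, Set.mem_ofPred_eq]; linarith
    have hle : C a b ≤ ∑ a, ∑ b, C a b :=
      (Finset.single_le_sum (f := fun b => C a b) (fun b _ => hC a b) (Finset.mem_univ b)).trans
        (Finset.single_le_sum (f := fun a => ∑ b, C a b)
          (fun a _ => Finset.sum_nonneg fun b _ => hC a b) (Finset.mem_univ a))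
    obtain ⟨b0, b1, b2⟩ := hb a b u (by rw [← norm3_endMap]; exact outer_lt_endMap.1 hu')
    have hr : 0 < norm3 (spatial u) := by linarith [D.endRadius_pos]
    have r1 : norm3 (spatial u) ^ (-1 : ℝ) = (norm3 (spatial u))⁻¹ := Real.rpow_neg_one _
    have r2 : norm3 (spatial u) ^ (-1 - 1 : ℝ) = (norm3 (spatial u))⁻¹ ^ 2 := by
      rw [show (-1 - 1 : ℝ) = -((2 : ℕ) : ℝ) by norm_num, Real.rpow_neg hr.le, Real.rpow_natCast, inv_pow]
    have r3 : norm3 (spatial u) ^ (-1 - 2 : ℝ) = (norm3 (spatial u))⁻¹ ^ 3 := by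
      rw [show (-1 - 2 : ℝ) = -((3 : ℕ) : ℝ) by norm_num, Real.rpow_neg hr.le, Real.rpow_natCast, inv_pow]
    have hreg : ∀ w ∈ exteriorRegion D.endRadius,
        DifferentiableAt ℝ (fun u => f a b (√D.Q₀ • spatial u)) w := fun w hw => by
      obtain ⟨_, _, hx⟩ := hf a b
      exact (hasPd_spatial_smul (hx _ (outer_lt_endMap.1 hw)).1.diff.hasPd).1
    have e1 : ∀ w ∈ exteriorRegion D.endRadius, ∀ c,
        pd c (fun w => pullback2 D.endMap D.fields.g w a b) w
          = pd c (fun u => f a b (√D.Q₀ • spatial u)) w := fun w hw c => by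
      rw [pd_congr_of_isOpen (isOpen_exteriorRegion _) hw (hfg a b)]
      exact (((hreg w hw).hasPd.add (hasPd_const _)).2 c).trans (add_zero _)
    rw [r1, r2, r3]
    refine ⟨?_, fun c => ?_, fun c d => ?_⟩
    · rw [hfg a b u hu', add_sub_cancel_right]
      exact b0.trans (mul_le_mul_of_nonneg_right hle (by positivity))
    · rw [e1 u hu']
      exact (b1 c).trans (mul_le_mul_of_nonneg_right hle (by positivity))
    · rw [pd_congr_of_isOpen (isOpen_exteriorRegion _) hu' fun w hw => e1 w hw c]
      exact (b2 c d).trans (mul_le_mul_of_nonneg_right hle (by positivity))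

theorem endMap_time (u : Fin 4 → ℝ) (hu : u ∈ exteriorRegion D.endRadius) :
    ∃ p ∈ nullRegion D.a, D.endMap u = D.emb p ∧
      ∀ c, jac D.endMap u c 0 = (√D.Q₀)⁻¹ * jac D.emb p c 0 := by
  have he := mem_ext_of_outer (outer_lt_endMap.1 hu)
  refine ⟨_, embInv_mem he, (emb_embInv he).symm, fun c => ?_⟩
  rw [jac_emb_time (embInv_mem he), jac_endMap]
  refine Fin.cases ?_ (fun k => ?_) c
  · simp [endScale]
  · simp [(Fin.succ_ne_zero k).symm]

end CentreData

/-! ## The causal structure of the extended spacetime -/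

theorem dotProduct_sq_le (x y : Fin 3 → ℝ) : (x ⬝ᵥ y) ^ 2 ≤ norm3 x ^ 2 * norm3 y ^ 2 := by
  rw [norm3_sq, norm3_sq, dotProduct, Fin.sum_univ_three]
  nlinarith [sq_nonneg (x 0 * y 1 - x 1 * y 0), sq_nonneg (x 0 * y 2 - x 2 * y 0),
    sq_nonneg (x 1 * y 2 - x 2 * y 1)]

theorem dotProduct_self_eq (x : Fin 3 → ℝ) : x ⬝ᵥ x = norm3 x ^ 2 := by
  rw [norm3_sq, dotProduct, Fin.sum_univ_three]; ring

theorem fderiv_eq_mulVec {m n : ℕ} {φ : (Fin m → ℝ) → Fin n → ℝ} {p : Fin m → ℝ}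
    (h : DifferentiableAt ℝ φ p) (X : Fin m → ℝ) :
    fderiv ℝ φ p X = (Matrix.of (jac φ p)).mulVec X := by
  ext c
  have h1 : fderiv ℝ φ p X c = fderiv ℝ (fun q => φ q c) p X := by
    rw [fderiv_apply h c]; rfl
  rw [h1, fderiv_apply_eq_sum_pd]
  rfl

/-- A vector inside the future light cone has negative product with a future timelike vector. -/
theorem static_future {s x₀ A : ℝ} {x w : Fin 3 → ℝ} (hs : 0 < s) (hx₀ : 0 < x₀)
    (hx : -s⁻¹ * (x₀ * x₀) + s * (x ⬝ᵥ x) < 0) (hA : s * norm3 w < A) :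
    -s⁻¹ * (x₀ * A) + s * (x ⬝ᵥ w) < 0 := by
  have hw := norm3_nonneg w
  have h1 : (s * norm3 x) ^ 2 < x₀ ^ 2 := by
    rw [dotProduct_self_eq] at hx
    have : s * (-s⁻¹ * (x₀ * x₀) + s * norm3 x ^ 2) < 0 := mul_neg_of_pos_of_neg hs hx
    have e : s * (-s⁻¹ * (x₀ * x₀) + s * norm3 x ^ 2) = (s * norm3 x) ^ 2 - x₀ ^ 2 := by
      field_simp; ring
    linarith
  have h2 : s * norm3 x < x₀ := lt_of_pow_lt_pow_left₀ 2 hx₀.le h1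
  have h3 : x ⬝ᵥ w ≤ norm3 x * norm3 w := by
    refine abs_le_of_sq_le_sq' ?_ (mul_nonneg (norm3_nonneg x) hw) |>.2
    rw [mul_pow]; exact dotProduct_sq_le x w
  have h4 : s * (s * (x ⬝ᵥ w)) < x₀ * A := by
    calc s * (s * (x ⬝ᵥ w)) ≤ s * (s * (norm3 x * norm3 w)) := by gcongr
      _ = (s * norm3 x) * (s * norm3 w) := by ring
      _ ≤ x₀ * (s * norm3 w) := by gcongr
      _ < x₀ * A := by gcongr
  have e : -s⁻¹ * (x₀ * A) + s * (x ⬝ᵥ w) = s⁻¹ * (s * (s * (x ⬝ᵥ w)) - x₀ * A) := by field_simp; ring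
  rw [e]
  exact mul_neg_of_pos_of_neg (inv_pos.2 hs) (by linarith)

/-- From every point of the punctured space one can move to infinity along a straight line. -/
theorem exists_segment {N : ℕ} {a : Fin N → Fin 3 → ℝ} {x : Fin 3 → ℝ} (hx : x ∈ puncturedSpace a)
    (B : ℝ) : ∃ w, B < norm3 (x + w) ∧ ∀ t : ℝ, x + t • w ∈ puncturedSpace a := by
  -- A line through `x` with direction `(1, m, 0)` can meet a centre only if `m` is one of these
  -- finitely many slopes. Where the denominator is zero the quotient is meaningless but harmless:
  -- away from `x`, points of the line differ from `x` in coordinate `0`.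
  obtain ⟨m, hm⟩ := (Set.finite_range fun i => (a i - x) 1 / (a i - x) 0).infinite_compl.nonempty
  set r : ℝ := |x 0| + |B| + 1 with hr
  have hr0 : 0 < r := by positivity
  refine ⟨r • ![1, m, 0], ?_, fun t i h => ?_⟩
  · have h1 := (le_abs_self _).trans (abs_le_norm3 (x + r • ![1, m, 0]) 0)
    simp only [Pi.add_apply, Pi.smul_apply, Matrix.cons_val_zero, smul_eq_mul, mul_one] at h1
    have := neg_abs_le (x 0)
    have := le_abs_self B
    linarith
  · have e : a i - x = (t * r) • ![1, m, 0] := by rw [← h, add_sub_cancel_left, smul_smul]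
    by_cases h0 : t * r = 0
    · rw [h0, zero_smul, sub_eq_zero] at e
      exact hx i e.symm
    · refine hm ⟨i, ?_⟩
      simp only [e]
      simp [h0]

namespace CentreData

variable {N : ℕ} {D : CentreData N} {i : Fin N} {x y w : Fin 3 → ℝ} {p q : Fin 4 → ℝ}

theorem horizon_mem_collar (h : norm3 (y - D.a i) = D.δ) : y ∈ D.collar i := by
  have := D.δ_pos
  exact ⟨by rw [h]; linarith, by rw [h]; linarith⟩

/-- Future timelike vectors at the horizon point inwards. -/
theorem radial_neg_of_horizon (h : norm3 (spatial p - D.a i) = D.δ) {V : Fin 4 → ℝ}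
    (hV : gdot (D.fields.g p) V V < 0) (hT : gdot (D.fields.g p) (D.timeDir p) V < 0) :
    D.dir i (spatial p) ⬝ᵥ spatial V < 0 := by
  have hc := horizon_mem_collar h
  have hs := collar_subset_shell hc
  have hK := regS_pos hc
  have hφ := phi_pos hc
  have hr : D.rad i (spatial p) = 0 := sub_eq_zero.2 h
  have hβ0 := tilt_pos (i := i) hc.2
  have hβ := mul_ee_le hc hβ0.le (tilt_le (norm3 (spatial p - D.a i)))
  have hcs := dotProduct_sq_le (D.dir i (spatial p)) (spatial V)
  rw [norm3_dir hs, one_pow, one_mul, ← dotProduct_self_eq] at hcs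
  rw [fields_g_collar hc, gdot_collarMetric, hr] at hV
  rw [fields_g_collar hc, timeDir_collar hc, gdot_collarMetric, hr] at hT
  simp only [spatial_fin_cons, Fin.cons_zero, dotProduct_smul, smul_dotProduct,
    dir_dotProduct_self hs, smul_eq_mul, mul_one] at hT
  set β := D.tilt i (norm3 (spatial p - D.a i))
  set φ := D.phi i (spatial p)
  set E := D.ee i (spatial p)
  set K := D.regS i (spatial p)
  set ξ := D.dir i (spatial p) ⬝ᵥ spatial V
  have hT' : (φ * (ξ - β * V 0) - E * β * ξ) / K < 0 := by
    refine lt_of_eq_of_lt ?_ hT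
    ring
  have hT2 : φ * (ξ - β * V 0) - E * β * ξ < 0 := by
    rwa [div_lt_iff₀ hK, zero_mul] at hT'
  -- The part of `V` tangent to the sphere contributes a nonnegative term, by Cauchy-Schwarz, and
  -- can be dropped.
  have hV' : (2 * φ * V 0 * ξ + E * ξ ^ 2) / K < 0 := by
    have : 0 ≤ K / norm3 (spatial p - D.a i) ^ 2 * (spatial V ⬝ᵥ spatial V - ξ * ξ) :=
      mul_nonneg (by positivity) (by nlinarith)
    refine lt_of_le_of_lt ?_ hV
    rw [show (2 * φ * V 0 * ξ + E * ξ ^ 2) = -0 ^ 2 * (V 0 * V 0) + φ * (V 0 * ξ + ξ * V 0)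
      + E * (ξ * ξ) by ring]
    linarith
  have hV2 : (2 * φ * V 0 + E * ξ) * ξ < 0 := by
    rw [div_lt_iff₀ hK, zero_mul] at hV'
    linarith
  by_contra! hξ
  rcases hξ.eq_or_lt with h0 | h0
  · rw [← h0] at hV2; simp at hV2
  · have h3 : 2 * φ * V 0 + E * ξ < 0 := by
      by_contra! h4
      have := mul_nonneg h4 hξ
      linarith
    nlinarith [mul_neg_of_pos_of_neg hβ0 h3, mul_nonneg hξ (sub_nonneg.2 hβ), mul_pos hφ h0]

/-- The exterior region is a past set. -/
theorem ext_of_chron (h : Chron D.domain D.fields.g D.timeDir p q) (hq : spatial q ∈ D.ext) :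
    spatial p ∈ D.ext := by
  by_contra hp
  obtain ⟨i, hi⟩ : ∃ i, norm3 (spatial p - D.a i) ≤ D.δ := by
    by_contra! h'
    exact hp h'
  obtain ⟨c, rfl, rfl, hc, hV⟩ := h
  set V := derivWithin c (Icc 0 1)
  have hd : ∀ t ∈ Icc (0 : ℝ) 1, DifferentiableAt ℝ (fun p => D.rad i (spatial p)) (c t) := by
    intro t ht
    have h0 : 0 < norm3 (spatial (c t) - D.a i) := by linarith [(hV t ht).1 i, D.δ_pos]
    exact (contDiffAt_spatial_comp ((contDiffAt_norm3_sub h0).sub contDiffAt_const)).diff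
  have hcd : ∀ t ∈ Icc (0 : ℝ) 1, HasDerivWithinAt c (V t) (Icc 0 1) t := fun t ht =>
    (hc.differentiableOn (by simp) t ht).hasDerivWithinAt
  -- Barrier argument with the constant bound `0`: `r` starts nonpositive, and whenever it equals
  -- `0` its derivative along the curve is negative, so it can never become positive.
  have key := image_le_of_deriv_right_lt_deriv_boundary' (a := 0) (b := 1)
    (f := fun t => D.rad i (spatial (c t)))
    (f' := fun t => fderiv ℝ (fun p => D.rad i (spatial p)) (c t) (V t)) (B := fun _ => 0)
    (B' := fun _ => 0) (fun t ht => ((hd t ht).continuousAt.comp_continuousWithinAt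
      (hc.continuousOn t ht))) (fun t ht => ?_) (by simp only [rad]; linarith) continuousOn_const
    (fun t _ => hasDerivWithinAt_const _ _ _) (fun t ht h0 => ?_) (right_mem_Icc.2 zero_le_one)
  · have := hq i
    simp only [rad] at key
    linarith
  · have ht' : t ∈ Icc (0 : ℝ) 1 := Ico_subset_Icc_self ht
    refine ((hd t ht').hasFDerivAt.comp_hasDerivWithinAt t (hcd t ht')).mono_of_mem_nhdsWithin ?_
    exact Icc_mem_nhdsGE_of_mem ht
  · have ht' : t ∈ Icc (0 : ℝ) 1 := Ico_subset_Icc_self ht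
    have hδ : norm3 (spatial (c t) - D.a i) = D.δ := sub_eq_zero.1 h0
    have hs := collar_subset_shell (horizon_mem_collar hδ)
    have hneg := radial_neg_of_horizon hδ (hV t ht').2.1 (hV t ht').2.2
    have hpd : ∀ a, pd a (fun p => D.rad i (spatial p)) (c t) = _ := (hasPd_rad hs).spatial.2
    rw [fderiv_apply_eq_sum_pd]
    simp only [hpd]
    rw [Fin.sum_univ_succ]
    simpa [dotProduct, spatial] using hneg

theorem continuousOn_conf : ContinuousOn D.conf (puncturedSpace D.a) :=
  ((contDiffOn_calQ.continuousOn.mul (contDiffOn_calG.continuousOn.pow 3)).neg).sqrt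

/-- A straight segment lifts to a timelike curve, if time passes fast enough. -/
theorem exists_chron (hseg : ∀ t ∈ Icc (0 : ℝ) 1, x + t • w ∈ puncturedSpace D.a) :
    ∃ A : ℝ, ∀ v : ℝ, Chron D.domain D.fields.g D.timeDir (D.emb (Fin.cons v x : Fin 4 → ℝ))
      (D.emb (Fin.cons (v + A) (x + w) : Fin 4 → ℝ)) := by
  obtain ⟨B, hB⟩ := isCompact_Icc.exists_bound_of_continuousOn (s := Icc (0 : ℝ) 1)
    (f := fun t => D.conf (x + t • w))
    (continuousOn_conf.comp (by fun_prop) hseg)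
  refine ⟨B * norm3 w + 1, fun v => ?_⟩
  -- `(A, w)` is timelike for `-dv²/s + s dx²` exactly when `s |w| < |A|`; the bound of `s` over the
  -- segment gives one speed that works throughout, and the `1` makes it strict.
  set A := B * norm3 w + 1 with hA
  set l : ℝ → Fin 4 → ℝ := fun t => Fin.cons (v + t * A) (x + t • w) with hl
  have hlm : ∀ t ∈ Icc (0 : ℝ) 1, l t ∈ nullRegion D.a := fun t ht => hseg t ht
  have hld : ∀ t, HasDerivAt l (Fin.cons A w : Fin 4 → ℝ) t := fun t => by
    refine hasDerivAt_pi.2 fun c => Fin.cases ?_ (fun k => ?_) c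
    · simpa [hl] using ((hasDerivAt_id t).mul_const A).const_add v
    · simpa [hl] using ((hasDerivAt_id t).mul_const (w k)).const_add (x k)
  have hlc : ContDiff ℝ 1 l := by
    refine contDiff_pi.2 fun c => Fin.cases ?_ (fun k => ?_) c
    · simp only [hl, Fin.cons_zero]; fun_prop
    · simp only [hl, Fin.cons_succ, Pi.add_apply, Pi.smul_apply, smul_eq_mul]; fun_prop
  refine ⟨fun t => D.emb (l t), ?_, ?_, fun t ht => ?_, fun t ht => ?_⟩
  · simp [hl]
  · simp [hl]
  · exact (((contDiffAt_emb (hlm t ht)).of_le (by simp)).comp t hlc.contDiffAt).contDiffWithinAt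
  · have hm := hlm t ht
    have he := emb_mem hm
    have hde : DifferentiableAt ℝ D.emb (l t) := (contDiffAt_emb hm).differentiableAt (by simp)
    have hderiv : derivWithin (fun t => D.emb (l t)) (Icc 0 1) t =
        (Matrix.of (jac D.emb (l t))).mulVec (Fin.cons A w : Fin 4 → ℝ) := by
      rw [← fderiv_eq_mulVec hde]
      exact ((hde.hasFDerivAt.comp_hasDerivAt t (hld t)).hasDerivWithinAt).derivWithin
        (uniqueDiffOn_Icc_zero_one t ht)
    have hcol : D.collapse (spatial (D.emb (l t))) = x + t • w := by
      rw [← spatial_embInv, embInv_emb hm]; rfl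
    have hback : (Matrix.of (jac D.embInv (D.emb (l t)))).mulVec
        ((Matrix.of (jac D.emb (l t))).mulVec (Fin.cons A w : Fin 4 → ℝ)) = Fin.cons A w := by
      rw [Matrix.mulVec_mulVec, jac_embInv_mul_jac_emb hm, Matrix.one_mulVec]
    have hs := conf_pos (D := D) (x + t • w)
    have hsB : D.conf (x + t • w) * norm3 w < A := by
      have h1 := (le_abs_self _).trans (hB t ht)
      have := mul_le_mul_of_nonneg_right h1 (norm3_nonneg w)
      rw [hA]; linarith
    have hsw : 0 ≤ D.conf (x + t • w) * norm3 w := mul_nonneg hs.le (norm3_nonneg w)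
    refine ⟨ext_subset_extended he, ?_, ?_⟩
    · rw [hderiv, gdot_fields_ext he, hback, hcol]
      simp only [Fin.cons_zero, spatial_fin_cons]
      rw [dotProduct_self_eq]
      have h2 : (D.conf (x + t • w) * norm3 w) ^ 2 < A ^ 2 := pow_lt_pow_left₀ hsB hsw two_ne_zero
      have e : -(D.conf (x + t • w))⁻¹ * (A * A) + D.conf (x + t • w) * norm3 w ^ 2
          = (D.conf (x + t • w))⁻¹ * ((D.conf (x + t • w) * norm3 w) ^ 2 - A ^ 2) := by
        field_simp; ring
      rw [e]
      exact mul_neg_of_pos_of_neg (inv_pos.2 hs) (by linarith)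
    · have hT := timeDir_timelike (D := D) (p := D.emb (l t)) (ext_subset_extended he)
      have hT0 := gdot_timeDir_time he
      rw [gdot_fields_ext he, hcol] at hT
      rw [gdot_fields_ext he, jac_embInv_mulVec_time he, spatial_single, hcol] at hT0
      rw [hderiv, gdot_fields_ext he, hback, hcol]
      simp only [Fin.cons_zero, spatial_fin_cons]
      refine static_future hs ?_ hT hsB
      simp only [Pi.single_eq_same, mul_one, dotProduct_zero, mul_zero, add_zero, neg_mul,
        neg_lt_zero] at hT0
      exact (mul_pos_iff_of_pos_left (inv_pos.2 hs)).1 hT0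

theorem emb_of_outer (hp : D.outer < norm3 (spatial p)) : D.emb p = p := by
  have := emb_embInv (mem_ext_of_outer hp)
  rwa [embInv_of_outer hp] at this

/-- The past of the asymptotic end is the exterior region. -/
theorem chronPast_eq : chronPast D.domain D.fields.g D.timeDir (D.endMap '' exteriorRegion D.endRadius)
    = spatial ⁻¹' D.ext := by
  rw [endMap_exteriorRegion]
  ext p
  constructor
  · rintro ⟨q, hq, h⟩
    exact ext_of_chron h (mem_ext_of_outer hq)
  · intro hp
    obtain ⟨w, hw, hseg⟩ := exists_segment (embInv_mem hp) D.outer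
    obtain ⟨A, hA⟩ := exists_chron (D := D) fun t _ => hseg t
    have h := hA (D.embInv p 0)
    rw [cons_spatial, emb_embInv hp] at h
    refine ⟨_, ?_, h⟩
    rw [emb_of_outer (by rwa [spatial_fin_cons])]
    exact hw

/-- The segment to infinity is run backwards, from a far point at the earlier time `v - A`, so that
it arrives at the given point at time `v`. -/
theorem subset_chronFuture : spatial ⁻¹' D.ext ⊆
    chronFuture D.domain D.fields.g D.timeDir (D.endMap '' exteriorRegion D.endRadius) := by
  rw [endMap_exteriorRegion]
  intro p hp
  obtain ⟨w, hw, hseg⟩ := exists_segment (embInv_mem hp) D.outer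
  obtain ⟨A, hA⟩ := exists_chron (D := D) (x := spatial (D.embInv p) + w) (w := -w) fun t _ => by
    have := hseg (1 - t)
    rwa [sub_smul, one_smul, sub_eq_add_neg, ← add_assoc, ← smul_neg] at this
  have h := hA (D.embInv p 0 - A)
  rw [sub_add_cancel, add_neg_cancel_right, cons_spatial, emb_embInv hp] at h
  refine ⟨_, ?_, h⟩
  rw [emb_of_outer (by rwa [spatial_fin_cons])]
  exact hw

theorem domainOuterComm_eq :
    domainOuterComm D.domain D.fields.g D.timeDir (D.endMap '' exteriorRegion D.endRadius)
      = D.emb '' nullRegion D.a := by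
  rw [domainOuterComm, chronPast_eq, emb_image]
  exact inter_eq_right.2 subset_chronFuture

end CentreData

/-! ## The event horizon -/

namespace CentreData

variable {N : ℕ} (D : CentreData N) (i : Fin N)

/-- The component of the event horizon that belongs to a centre. -/
def horizon : Set (Fin 4 → ℝ) := {p | norm3 (spatial p - D.a i) = D.δ}

variable {D i} {p : Fin 4 → ℝ}

theorem horizon_subset_domain : D.horizon i ⊆ D.domain := fun _ hp =>
  mem_extended_of_collar (horizon_mem_collar hp)

theorem horizon_subset_closure : D.horizon i ⊆ closure (spatial ⁻¹' D.ext) := by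
  intro p hp
  have hδ := D.δ_pos
  have hp' : norm3 (spatial p - D.a i) = D.δ := hp
  have hc : Continuous fun t : ℝ =>
      (Fin.cons (p 0) (D.a i + (1 + t) • (spatial p - D.a i)) : Fin 4 → ℝ) :=
    continuous_pi fun c => Fin.cases (by simp only [Fin.cons_zero]; fun_prop)
      (fun k => by simp only [Fin.cons_succ, Pi.add_apply, Pi.smul_apply, smul_eq_mul]; fun_prop) c
  have h0 : (Fin.cons (p 0) (D.a i + (1 + (0 : ℝ)) • (spatial p - D.a i)) : Fin 4 → ℝ) = p := by
    rw [add_zero, one_smul, add_sub_cancel, cons_spatial]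
  have ht := (hc.tendsto 0).mono_left (nhdsWithin_le_nhds (s := Ioi 0))
  rw [h0] at ht
  refine mem_closure_of_tendsto ht ?_
  filter_upwards [Ioo_mem_nhdsGT (show (0 : ℝ) < 1 by norm_num)] with t ht
  have hn : norm3 (D.a i + (1 + t) • (spatial p - D.a i) - D.a i) = (1 + t) * D.δ := by
    rw [add_sub_cancel_left, norm3_smul, hp', abs_of_pos (by linarith [ht.1])]
  refine mem_ext_of_collar (i := i) ⟨?_, ?_⟩ ?_
  · rw [spatial_fin_cons, hn]; nlinarith [ht.1]
  · rw [spatial_fin_cons, hn]; nlinarith [ht.2]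
  · rw [spatial_fin_cons, rad, hn]; nlinarith [mul_pos ht.1 hδ]

/-- The exterior is open, so its boundary consists of the points of its closure at which some
inequality `δ < |y - a i|` becomes an equality. Conversely, points of these spheres are limits of
radially displaced exterior points. -/
theorem eventHorizon_eq :
    eventHorizon D.domain D.fields.g D.timeDir (D.endMap '' exteriorRegion D.endRadius)
      = ⋃ i, D.horizon i := by
  rw [eventHorizon, chronPast_eq, (D.isOpen_ext.preimage continuous_spatial).frontier_eq]
  ext p
  rw [mem_iUnion]
  constructor
  · rintro ⟨-, hcl, hp⟩
    have hle : ∀ i, D.δ ≤ norm3 (spatial p - D.a i) := fun i =>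
      closure_minimal (t := {p : Fin 4 → ℝ | D.δ ≤ norm3 (spatial p - D.a i)})
        (fun q hq => (hq i).le)
        (isClosed_le continuous_const ((D.continuous_dist i).comp continuous_spatial)) hcl
    by_contra! h
    exact hp fun i => (hle i).lt_of_ne' (h i)
  · rintro ⟨i, hi⟩
    have hi' : norm3 (spatial p - D.a i) = D.δ := hi
    exact ⟨horizon_subset_domain hi, horizon_subset_closure hi, fun h => (h i).ne' hi'⟩

theorem mem_horizon_of_collar (hp : spatial p ∈ D.collar i) (h : p ∈ ⋃ i, D.horizon i) :
    p ∈ D.horizon i := by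
  obtain ⟨k, hk⟩ := mem_iUnion.1 h
  rwa [← collar_unique hp (horizon_mem_collar hk)]

/-- The defining function is `r`, whose gradient is nonzero because the direction is a unit vector.
-/
theorem isNullHypersurface : IsNullHypersurface D.domain D.fields.g (⋃ i, D.horizon i) := by
  refine ⟨iUnion_subset fun i => horizon_subset_domain, fun h hh => ?_⟩
  obtain ⟨i, hi⟩ := mem_iUnion.1 hh
  refine ⟨spatial ⁻¹' D.collar i, (D.isOpen_collar i).preimage continuous_spatial,
    horizon_mem_collar hi, fun p hp => mem_extended_of_collar hp, fun p => D.rad i (spatial p),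
    fun p hp => (contDiffAt_spatial_comp (contDiffAt_rad (collar_subset_shell hp))).contDiffWithinAt,
    fun p hp => ⟨fun h => sub_eq_zero.2 (mem_horizon_of_collar hp h),
      fun h => mem_iUnion.2 ⟨i, sub_eq_zero.1 h⟩⟩, fun p hp => ?_⟩
  obtain ⟨hc, hp⟩ := hp
  have hh := mem_horizon_of_collar hc hp
  have hs := collar_subset_shell hc
  have hr : D.rad i (spatial p) = 0 := sub_eq_zero.2 hh
  have hφ := phi_pos hc
  have hK := regS_pos hc
  have hgrad : gradForm (fun p => D.rad i (spatial p)) p = D.nu i p :=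
    funext (hasPd_rad hs).spatial.2
  -- At `r = 0` lowering the index of `∂_w` gives `(phi/S) dr`. So the gradient vector of `r` is a
  -- multiple of `∂_w`, which is tangent to `r = 0`; hence `dr` is null.
  have hX : (D.fields.g p).mulVec ((D.regS i (spatial p) / D.phi i (spatial p)) • Pi.single 0 1)
      = D.nu i p := by
    rw [Matrix.mulVec_smul, Matrix.mulVec_single_one]
    funext a
    simp only [Pi.smul_apply, Matrix.col_apply, fields_g_collar hc, collarMetric, Matrix.of_apply,
      hr, smul_eq_mul]
    have h0 : D.nu i p 0 = 0 := rfl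
    have hd : (Matrix.diagonal ![0, 1, 1, 1] : Matrix (Fin 4) (Fin 4) ℝ) a 0 = 0 := by
      fin_cases a <;> simp
    rw [h0, hd]
    simp only [Pi.single_eq_same]
    field_simp
    ring
  have hinv : (D.fields.g p)⁻¹.mulVec (D.nu i p) =
      (D.regS i (spatial p) / D.phi i (spatial p)) • Pi.single 0 1 := by
    rw [← hX, Matrix.mulVec_mulVec, Matrix.nonsing_inv_mul _
      (fields_lorentzian (mem_extended_of_collar hc)).isUnit_det, Matrix.one_mulVec]
  rw [hgrad]
  refine ⟨fun h0 => ?_, ?_⟩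
  · have h1 := dir_sq hs
    have h2 : ∀ k, D.dir i (spatial p) k = 0 := fun k => congrFun h0 k.succ
    simp [h2] at h1
  · rw [gdot_eq, hinv, dotProduct_smul, dotProduct_single_one]
    exact smul_zero _

variable (D i) in
/-- The horizon components are cylinders over the sphere. -/
noncomputable def horizonHomeomorph :
    D.horizon i ≃ₜ ℝ × Metric.sphere (0 : EuclideanSpace ℝ (Fin 3)) 1 where
  toFun p := (p.1 0, ⟨WithLp.toLp 2 (D.δ⁻¹ • (spatial p.1 - D.a i)), by
    have hp : norm3 (spatial p.1 - D.a i) = D.δ := p.2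
    rw [mem_sphere_zero_iff_norm, ← norm3_eq_norm, norm3_smul, hp, abs_of_pos (inv_pos.2 D.δ_pos),
      inv_mul_cancel₀ D.δ_pos.ne']⟩)
  invFun s := ⟨Fin.cons s.1 (D.a i + D.δ • WithLp.ofLp s.2.1), by
    have hs : ‖s.2.1‖ = 1 := mem_sphere_zero_iff_norm.1 s.2.2
    have hs' : norm3 (WithLp.ofLp s.2.1) = 1 := by rw [norm3_eq_norm]; exact hs
    change norm3 (D.a i + D.δ • WithLp.ofLp s.2.1 - D.a i) = D.δ
    rw [add_sub_cancel_left, norm3_smul, hs', mul_one, abs_of_pos D.δ_pos]⟩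
  left_inv p := by
    refine Subtype.ext ?_
    change (Fin.cons (p.1 0) (D.a i + D.δ • (D.δ⁻¹ • (spatial p.1 - D.a i))) : Fin 4 → ℝ) = p.1
    rw [smul_inv_smul₀ D.δ_pos.ne', add_sub_cancel, cons_spatial]
  right_inv s := by
    refine Prod.ext rfl (Subtype.ext ?_)
    change WithLp.toLp 2 (D.δ⁻¹ • (D.a i + D.δ • WithLp.ofLp s.2.1 - D.a i)) = s.2.1
    rw [add_sub_cancel_left, inv_smul_smul₀ D.δ_pos.ne']
  continuous_toFun := by
    refine ((continuous_apply 0).comp continuous_subtype_val).prodMk (Continuous.subtype_mk ?_ _)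
    have h : Continuous fun p : D.horizon i => D.δ⁻¹ • (spatial p.1 - D.a i) := by
      have := continuous_spatial.comp (continuous_subtype_val (p := (· ∈ D.horizon i)))
      exact (continuous_const (y := D.δ⁻¹)).smul (this.sub (continuous_const (y := D.a i)))
    exact (PiLp.continuous_toLp 2 _).comp h
  continuous_invFun := by
    refine Continuous.subtype_mk (continuous_pi fun c => Fin.cases ?_ (fun k => ?_) c) _
    · exact continuous_fst
    · have h : Continuous fun s : ℝ × Metric.sphere (0 : EuclideanSpace ℝ (Fin 3)) 1 =>
          D.a i + D.δ • WithLp.ofLp s.2.1 := by fun_prop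
      exact (continuous_apply k).comp h

theorem isPreconnected_horizon : IsPreconnected (D.horizon i) := by
  have h : IsPreconnected (Metric.sphere (0 : EuclideanSpace ℝ (Fin 3)) 1) := by
    refine isPreconnected_sphere ?_ 0 1
    rw [← Module.finrank_eq_rank, finrank_euclideanSpace_fin]
    norm_num
  have : PreconnectedSpace (Metric.sphere (0 : EuclideanSpace ℝ (Fin 3)) 1) :=
    isPreconnected_iff_preconnectedSpace.1 h
  have : PreconnectedSpace (D.horizon i) :=
    (D.horizonHomeomorph i).symm.surjective.denseRange.preconnectedSpace
      (D.horizonHomeomorph i).symm.continuous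
  exact isPreconnected_iff_preconnectedSpace.2 this

/-- The sphere of radius `2 δ` about `a i` separates this cylinder from the others, and the cylinder
itself is connected. -/
theorem connectedComponentIn_horizon (hp : p ∈ D.horizon i) :
    connectedComponentIn (⋃ i, D.horizon i) p = D.horizon i := by
  have hδ := D.δ_pos
  have hpU : p ∈ ⋃ i, D.horizon i := mem_iUnion.2 ⟨i, hp⟩
  refine Subset.antisymm (fun q hq => ?_)
    (isPreconnected_horizon.subset_connectedComponentIn hp (subset_iUnion _ i))
  have hcont := (D.continuous_dist i).comp continuous_spatial
  have hsub := connectedComponentIn_subset (⋃ i, D.horizon i) p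
  have key := isPreconnected_connectedComponentIn (F := ⋃ i, D.horizon i) (x := p)
    |>.subset_left_of_subset_union
      (u := spatial ⁻¹' {y | norm3 (y - D.a i) < 2 * D.δ})
      (v := spatial ⁻¹' {y | 2 * D.δ < norm3 (y - D.a i)})
      (isOpen_lt hcont continuous_const) (isOpen_lt continuous_const hcont)
      (Set.disjoint_left.2 fun q (h1 : norm3 (spatial q - D.a i) < 2 * D.δ)
        (h2 : 2 * D.δ < norm3 (spatial q - D.a i)) => lt_asymm h1 h2) (fun q hq => ?_)
      ⟨p, mem_connectedComponentIn hpU, (horizon_mem_collar hp).2⟩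
  · refine mem_horizon_of_collar ⟨?_, key hq⟩ (hsub hq)
    obtain ⟨k, hk⟩ := mem_iUnion.1 (hsub hq)
    exact horizon_subset_domain hk i
  · obtain ⟨k, hk⟩ := mem_iUnion.1 (hsub hq)
    by_cases hki : k = i
    · subst hki; exact Or.inl (horizon_mem_collar hk).2
    · refine Or.inr ?_
      have := lt_norm3_of_near D.sep (Ne.symm hki) (collar_subset_shell (horizon_mem_collar hk)).2
      change 2 * D.δ < norm3 (spatial q - D.a i)
      linarith

/-- `collapse` is continuous across the horizon, where its value is the centre, and on the image of
the embedding it recovers the original spatial coordinates. -/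
theorem tendsto_spatial_horizon {h : Fin 4 → ℝ} (hh : h ∈ D.horizon i) :
    Tendsto spatial (𝓟 (nullRegion D.a) ⊓ comap D.emb (𝓝 h)) (𝓝 (D.a i)) := by
  have hc := horizon_mem_collar hh
  have hval : D.collapse (spatial h) = D.a i := by
    have hr : D.rad i (spatial h) = 0 := sub_eq_zero.2 hh
    rw [collapse_eq_chi hc, chi, hr, zero_smul, add_zero]
  have ht : Tendsto (fun q => D.collapse (spatial q)) (𝓝 h) (𝓝 (D.a i)) := by
    rw [← hval]
    exact (contDiffAt_collapse (mem_extended_of_collar hc)).continuousAt.comp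
      continuous_spatial.continuousAt
  have h1 : Tendsto (fun p => D.collapse (spatial (D.emb p)))
      (𝓟 (nullRegion D.a) ⊓ comap D.emb (𝓝 h)) (𝓝 (D.a i)) :=
    (ht.comp tendsto_comap).mono_left inf_le_right
  refine h1.congr' ?_
  filter_upwards [mem_inf_of_left (mem_principal_self _)] with p hp
  rw [← spatial_embInv, embInv_emb hp]

theorem isAFBlackHole (hL : D.G₀ = D.Q₀⁻¹) :
    IsAFBlackHole (nullRegion D.a) (nullFields4 D.calG D.calQ) D.a := by
  refine ⟨D.domain, D.fields, D.timeDir, D.emb, D.endMap, D.endRadius, isSpacetime, fields_smoothOn,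
    isFieldEmbedding, fun p hp => time_future hp, isAFEnd hL,
    ⟨(√D.Q₀)⁻¹, inv_pos.2 sqrt_Q₀_pos, endMap_time⟩, domainOuterComm_eq, ?_, D.horizon, ?_,
    fun i => ⟨⟨D.horizonHomeomorph i⟩, fun h hh => ⟨?_, tendsto_spatial_horizon hh⟩⟩⟩
  · rw [eventHorizon_eq]; exact isNullHypersurface
  · exact eventHorizon_eq.symm
  · rw [eventHorizon_eq]; exact connectedComponentIn_horizon hh

end CentreData

/-! ### Assembly of the main theorem -/

theorem mainTheorem6 (N : ℕ) (L : ℝ) (γ q : Fin N → ℝ) (a : Fin N → Fin 3 → ℝ)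
    (hL : 0 < L) (hγ : ∀ i, 0 < γ i) (hq : ∀ i, q i < 0) (ha : Function.Injective a)
    (𝒢 𝒬 : (Fin 3 → ℝ) → ℝ) (h𝒢 : 𝒢 = multiCentre L⁻¹ γ a) (h𝒬 : 𝒬 = multiCentre (-L) q a) :
    IsKKReduction (nullRegion a) (nullMetric5 𝒢 𝒬) (nullMaxwell5 𝒢) (nullFields4 𝒢 𝒬) ∧
    (∀ Y : Fields4, IsKKReduction (nullRegion a) (nullMetric5 𝒢 𝒬) (nullMaxwell5 𝒢) Y →
      (∀ p ∈ nullRegion a, Y.g p = (nullFields4 𝒢 𝒬).g p ∧ Y.Φ p = (nullFields4 𝒢 𝒬).Φ p ∧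
        Y.F p = (nullFields4 𝒢 𝒬).F p ∧ Y.G p = (nullFields4 𝒢 𝒬).G p) ∧
      ∃ c : ℝ, ∀ p ∈ nullRegion a, Y.ρ p = c) ∧
    (∀ σ : ℝ, σ = 1 ∨ σ = -1 → IsSolution4 σ (nullRegion a) (nullFields4 𝒢 𝒬)) ∧
    IsAFBlackHole (nullRegion a) (nullFields4 𝒢 𝒬) a := by
  have hG : ∀ x, 0 < 𝒢 x := fun x => h𝒢 ▸ multiCentre_pos (inv_pos.2 hL) hγ x
  -- As all `q i` are negative, `-𝒬` is a multi-centred function with positive coefficients, the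
  -- form in which `CentreData` stores it.
  have h𝒬' : 𝒬 = fun x => -multiCentre L (fun i => -q i) a x := by
    rw [h𝒬]
    funext x
    rw [← multiCentre_neg]
    simp only [neg_neg]
  have hQ : ∀ x, 𝒬 x < 0 := fun x => by
    rw [h𝒬']
    exact neg_neg_of_pos (multiCentre_pos hL (fun i => neg_pos.2 (hq i)) x)
  have hred := nullFields4_isKKReduction h𝒢 h𝒬 hG hQ
  refine ⟨hred, fun Y hY => ⟨fun p hp => ?_, ?_⟩, fun σ _ => ?_, ?_⟩
  · obtain ⟨h1, h2, h3, h4, -⟩ := hred.unique (isOpen_nullRegion a) hY hp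
    exact ⟨h1, h2, h3, h4⟩
  · exact hred.axion_const (isOpen_nullRegion a) (isConnected_nullRegion a) hY fun _ => rfl
  · refine nullFields4_isSolution (isOpen_puncturedSpace a) (h𝒢 ▸ contDiffOn_multiCentre)
      (h𝒬 ▸ contDiffOn_multiCentre) hG hQ (fun x hx => h𝒢 ▸ multiCentre_harmonic hx)
      (fun x hx => h𝒬 ▸ multiCentre_harmonic hx) (fun p hp => ?_) σ
    rw [h𝒢]
    exact exists_potential L⁻¹ (√3 / 2) γ a hp
  · obtain ⟨D, hDG, hDQ, hDγ, hDq, rfl⟩ :=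
      exists_centreData (inv_pos.2 hL) hL hγ (fun i => neg_pos.2 (hq i)) ha
    have e1 : 𝒢 = D.calG := by rw [h𝒢, CentreData.calG, hDG, hDγ]
    have e2 : 𝒬 = D.calQ := by rw [h𝒬', ← hDQ, ← hDq]; rfl
    rw [e1, e2]
    exact D.isAFBlackHole (by rw [hDG, hDQ])
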